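/- Let $N\ge 1$ be a squarefree integer. Put $\mathrm{Sp}_2(\mathbb R)=\{M\in\mathbb R^{4\times4} : M'JM=J\}$, $J=\begin{pmatrix}0&-E\\E&0\end{pmatrix}$ with $2\times 2$ blocks, where $'$ denotes the transpose. Let $\Sigma_N\subset \mathrm{Sp}_2(\mathbb R)$ be the paramodular group of level $N$, i.e. the group of all symplectic matrices of the form $$\begin{pmatrix} a_1&a_2N&b_1&b_2\\ a_3&a_4&b_3&b_4/N\\ c_1&c_2N&d_1&d_2\\ c_3N&c_4N&d_3N&d_4\end{pmatrix},\qquad a_i,b_i,c_i,d_i\in\mathbb Z ,$$ and let $\mathbb G=\{\tfrac1{\sqrt m}M\in \mathrm{Sp}_2(\mathbb R) : M\in\mathbb Z^{4\times4},\ m\in\mathbb Z_{\ge 1}\}$. Let $\mathcal H(\Sigma_N,\mathbb G)$ be the Hecke algebra over $\mathbb Z$ of the Hecke pair $(\Sigma_N,\mathbb G)$: the free $\mathbb Z$-module on the double cosets $\Sigma_N g\Sigma_N$, $g\in\mathbb G$, where the coefficient of $\Sigma_N x\Sigma_N$ in the product $A\cdot B$ of two double cosets is the number of right cosets $\Sigma_N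 y\subseteq B$ with $xy^{-1}\in A$. For every prime $p\mid N$ let $W_p=\begin{pmatrix}V_p&0\\0&V_p'^{-1}\end{pmatrix}$, where $V_p=\tfrac1{\sqrt p}\begin{pmatrix}\alpha p&\beta N\\ \gamma&\delta p\end{pmatrix}$ with any $\alpha,\beta,\gamma,\delta\in\mathbb Z$ such that $\det V_p=1$. For every prime $q$ let $$\mathcal T_{N,1}(q)=\Sigma_N\tfrac1{\sqrt q}\operatorname{diag}(1,1,q,q)\Sigma_N,\qquad \mathcal T_{N,2}(q)=\Sigma_N\tfrac1q\operatorname{diag}(1,q,q^2,q)\Sigma_N .$$ Then $\mathcal H(\Sigma_N,\mathbb G)$ is generated, as a $\mathbb Z$-algebra, by the double cosets $$\Sigma_N,\quad \Sigma_NW_p\Sigma_N\ (p \text{ prime},\ p\mid N),\quad \mathcal T_{N,1}(q),\ \mathcal T_{N,2}(q)\ (q\text{ prime}).$$ If $N>1$, then $\mathcal H(\Sigma_N,\mathbb G)$ is not commutative and contains zero-divisors, i.e. there are nonzero $S,T\in\mathcal H(\Sigma_N,\mathbb G)$ with $S\cdot T=0$. -/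

import Mathlib

open scoped HeckeCosetModule

noncomputable section

/-! ### The product of the Hecke ring of a Hecke pair

The additive group `𝕋 Δ H ℤ` of finite formal `ℤ`-linear combinations of the double cosets
`H g H`, `g ∈ Δ`, is Mathlib's.  Here it gets its usual product. -/

namespace HeckeProduct

variable {G : Type*} [Group G] {Δ : Submonoid G} {H : Subgroup G}

/-- The space `H \ G` of right cosets `H y`. -/
abbrev RightCoset (H : Subgroup G) : Type _ := Quotient (QuotientGroup.rightRel H)

open Classical in
/-- The coefficient of `f` at the double coset `H x H` (and `0` if `x ∉ Δ`), i.e. `f` as a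
bi-`H`-invariant function on the whole group. -/
def coeffAt (f : 𝕋 Δ H ℤ) (x : G) : ℤ :=
  if hx : x ∈ Δ then f (HeckeCoset.mk H H ⟨x, hx⟩) else 0

/-- The coefficient at `H x H` of the product `f * g`: the sum over the right cosets `H y` of
`f(x y⁻¹) g(y)`.  For single double cosets `f = A`, `g = B` this is the number of right cosets
`H y ⊆ B` with `x y⁻¹ ∈ A`; if `A` is the disjoint union of the `H a i` and `B` the disjoint union
of the `H b j`, this is the number of pairs `(i, j)` with `H (a i) (b j) = H x`. -/
def conv (f g : 𝕋 Δ H ℤ) (x : G) : ℤ :=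
  ∑ᶠ y : RightCoset H, coeffAt f (x * y.out⁻¹) * coeffAt g y.out

lemma mk_eq_mk {a b : Δ} : HeckeCoset.mk H H a = HeckeCoset.mk H H b ↔
    ∃ h ∈ H, ∃ k ∈ H, (b : G) = h * a * k :=
  Quotient.eq.trans DoubleCoset.rel_iff

lemma mem_of_mem [hΔ : IsHeckeTriple Δ H H] {h : G} (hh : h ∈ H) : h ∈ Δ := hΔ.left_le hh

lemma coeffAt_mul_mul [IsHeckeTriple Δ H H] (f : 𝕋 Δ H ℤ) {h k : G} (hh : h ∈ H) (hk : k ∈ H)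
    (x : G) : coeffAt f (h * x * k) = coeffAt f x := by
  have key : h * x * k ∈ Δ ↔ x ∈ Δ := by
    constructor
    · intro hx
      have := Δ.mul_mem (Δ.mul_mem (mem_of_mem (Δ := Δ) (H.inv_mem hh)) hx)
        (mem_of_mem (Δ := Δ) (H.inv_mem hk))
      simpa [mul_assoc] using this
    · intro hx
      exact Δ.mul_mem (Δ.mul_mem (mem_of_mem hh) hx) (mem_of_mem hk)
  unfold coeffAt
  by_cases hx : x ∈ Δ
  · rw [dif_pos (key.2 hx), dif_pos hx]
    congr 1
    exact (mk_eq_mk.2 ⟨h, hh, k, hk, rfl⟩).symm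
  · rw [dif_neg (mt key.1 hx), dif_neg hx]

lemma coeffAt_mul_left [IsHeckeTriple Δ H H] (f : 𝕋 Δ H ℤ) {h : G} (hh : h ∈ H) (x : G) :
    coeffAt f (h * x) = coeffAt f x := by
  simpa using coeffAt_mul_mul f hh H.one_mem x

lemma coeffAt_mul_right [IsHeckeTriple Δ H H] (f : 𝕋 Δ H ℤ) {h : G} (hh : h ∈ H) (x : G) :
    coeffAt f (x * h) = coeffAt f x := by
  simpa using coeffAt_mul_mul f H.one_mem hh x

lemma out_mk (x : G) : ∃ h ∈ H, (Quotient.mk _ x : RightCoset H).out = h * x := by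
  have := Quotient.exact (Quotient.out_eq (Quotient.mk _ x : RightCoset H))
  have h2 : x * (Quotient.mk _ x : RightCoset H).out⁻¹ ∈ H := QuotientGroup.rightRel_apply.1 this
  exact ⟨_, H.inv_mem h2, by group⟩

open scoped Pointwise in
/-- A double coset consists of finitely many right cosets. -/
lemma finite_rightCosets [hΔ : IsHeckeTriple Δ H H] (g : Δ) :
    {y : RightCoset H | ∃ h ∈ H, ∃ k ∈ H, y.out = h * g * k}.Finite := by
  have hg : (g : G) ∈ Subgroup.Commensurable.commensurator H := hΔ.le_commensurator_right g.2
  have hg' : (g : G)⁻¹ ∈ Subgroup.Commensurable.commensurator H := inv_mem hg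
  rw [Subgroup.Commensurable.commensurator_mem_iff] at hg'
  have hfin : (ConjAct.toConjAct (g : G)⁻¹ • H).relIndex H ≠ 0 := hg'.1
  set K := ConjAct.toConjAct (g : G)⁻¹ • H with hK
  have : (K.subgroupOf H).FiniteIndex := ⟨hfin⟩
  have hfq : Finite (H ⧸ K.subgroupOf H) := inferInstance
  let φ : H ⧸ K.subgroupOf H → RightCoset H := fun k => Quotient.mk _ ((g : G) * (k.out : G)⁻¹)
  refine (Set.finite_range φ).subset ?_
  rintro y ⟨h, hh, k, hk, hy⟩
  refine ⟨(QuotientGroup.mk (⟨k, hk⟩⁻¹ : H)), ?_⟩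
  obtain ⟨l, hl⟩ := QuotientGroup.mk_out_eq_mul (K.subgroupOf H) (⟨k, hk⟩⁻¹ : H)
  rw [← Quotient.out_eq y]
  apply Quotient.sound
  apply QuotientGroup.rightRel_apply.2
  rw [hl, hy]
  have hlK : ((l : H) : G) ∈ ConjAct.toConjAct (g : G)⁻¹ • H := l.2
  rw [Subgroup.mem_pointwise_smul_iff_inv_smul_mem, ← map_inv, ConjAct.toConjAct_smul] at hlK
  simp only [inv_inv] at hlK
  have e : h * ↑g * k * (↑g * ((((⟨k, hk⟩ : H)⁻¹ * (l : H) : H) : G))⁻¹)⁻¹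
      = h * (↑g * ((l : H) : G) * (↑g)⁻¹) := by
    simp [mul_assoc]
  rw [e]
  exact H.mul_mem hh hlK

lemma finite_support [IsHeckeTriple Δ H H] (f : 𝕋 Δ H ℤ) :
    {y : RightCoset H | coeffAt f y.out ≠ 0}.Finite := by
  classical
  have hs : (Function.support f).Finite :=
    Finsupp.hasFiniteSupport (HeckeCosetModule.of.symm f)
  have : {y : RightCoset H | coeffAt f y.out ≠ 0} ⊆
      ⋃ D ∈ Function.support f,
        {y : RightCoset H | ∃ h ∈ H, ∃ k ∈ H, y.out = h * (Quotient.out D : Δ) * k} := by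
    intro y hy
    simp only [Set.mem_ofPred_eq] at hy
    unfold coeffAt at hy
    split_ifs at hy with hx
    · simp only [Set.mem_iUnion]
      refine ⟨_, hy, ?_⟩
      set D := HeckeCoset.mk H H ⟨y.out, hx⟩
      have : HeckeCoset.mk H H (Quotient.out D) = HeckeCoset.mk H H ⟨y.out, hx⟩ :=
        Quotient.out_eq D
      exact mk_eq_mk.1 this
    · exact absurd rfl hy
  exact (hs.biUnion fun D _ => finite_rightCosets _).subset this

lemma finite_support_conv [IsHeckeTriple Δ H H] (f g : 𝕋 Δ H ℤ) (x : G) :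
    (Function.support fun y : RightCoset H =>
      coeffAt f (x * y.out⁻¹) * coeffAt g y.out).Finite :=
  (finite_support g).subset fun _ hy => right_ne_zero_of_mul hy

lemma conv_mul_left [IsHeckeTriple Δ H H] (f g : 𝕋 Δ H ℤ) {h : G} (hh : h ∈ H) (x : G) :
    conv f g (h * x) = conv f g x := by
  unfold conv
  simp only [mul_assoc, coeffAt_mul_left f hh]

/-- Right multiplication by `z` on right cosets. -/
def mulRight (H : Subgroup G) (z : G) : RightCoset H ≃ RightCoset H :=
  Quotient.congr (Equiv.mulRight z) fun a b => by
    change QuotientGroup.rightRel H a b ↔ QuotientGroup.rightRel H (a * z) (b * z)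
    rw [QuotientGroup.rightRel_apply, QuotientGroup.rightRel_apply]
    simp [mul_assoc]

lemma mulRight_out (z : G) (y : RightCoset H) : ∃ h ∈ H, (mulRight H z y).out = h * (y.out * z) := by
  have : mulRight H z y = Quotient.mk _ (y.out * z) := by
    conv_lhs => rw [← Quotient.out_eq y]
    rfl
  rw [this]
  exact out_mk _

/-- Translation of the summation variable. -/
lemma conv_translate [IsHeckeTriple Δ H H] (f g : 𝕋 Δ H ℤ) (x z : G) :
    ∑ᶠ y : RightCoset H, coeffAt f (x * y.out⁻¹) * coeffAt g (y.out * z⁻¹)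
      = conv f g (x * z⁻¹) := by
  unfold conv
  rw [← finsum_comp_equiv (mulRight H z)]
  refine finsum_congr fun y => ?_
  obtain ⟨h, hh, e⟩ := mulRight_out (H := H) z y
  rw [e]
  have e1 : x * (h * (y.out * z))⁻¹ = x * z⁻¹ * y.out⁻¹ * h⁻¹ := by group
  have e2 : h * (y.out * z) * z⁻¹ = h * y.out := by group
  rw [e1, e2, coeffAt_mul_right f (H.inv_mem hh), coeffAt_mul_left g hh]

lemma conv_mul_right [IsHeckeTriple Δ H H] (f g : 𝕋 Δ H ℤ) {h : G} (hh : h ∈ H) (x : G) :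
    conv f g (x * h) = conv f g x := by
  have := conv_translate f g x h⁻¹
  rw [inv_inv] at this
  rw [← this]
  unfold conv
  simp only [coeffAt_mul_right g hh]

lemma exists_of_conv_ne_zero {f g : 𝕋 Δ H ℤ} {x : G} (hx : conv f g x ≠ 0) :
    ∃ y : RightCoset H, coeffAt f (x * y.out⁻¹) * coeffAt g y.out ≠ 0 := by
  by_contra! h
  exact hx (by unfold conv; simp only [h, finsum_zero])

lemma mem_of_conv_ne_zero {f g : 𝕋 Δ H ℤ} {x : G} (hx : conv f g x ≠ 0) : x ∈ Δ := by
  obtain ⟨y, hy⟩ := exists_of_conv_ne_zero hx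
  have h1 := left_ne_zero_of_mul hy
  have h2 := right_ne_zero_of_mul hy
  unfold coeffAt at h1 h2
  split_ifs at h1 with h3
  · split_ifs at h2 with h4
    · simpa using Δ.mul_mem h3 h4
    · exact absurd rfl h2
  · exact absurd rfl h1

lemma finite_conv [IsHeckeTriple Δ H H] (f g : 𝕋 Δ H ℤ) :
    (Function.support fun D : HeckeCoset Δ H H => conv f g (Quotient.out D : Δ)).Finite := by
  classical
  let ψ : RightCoset H × RightCoset H → HeckeCoset Δ H H := fun p =>
    if hp : p.1.out * p.2.out ∈ Δ then HeckeCoset.mk H H ⟨_, hp⟩ else default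
  refine (((finite_support f).prod (finite_support g)).image ψ).subset ?_
  intro D hD
  obtain ⟨y, hy⟩ := exists_of_conv_ne_zero (Function.mem_support.1 hD)
  have h1 := left_ne_zero_of_mul hy
  have h2 := right_ne_zero_of_mul hy
  set x : Δ := Quotient.out D with hx
  obtain ⟨h, hh, e⟩ := out_mk (H := H) ((x : G) * y.out⁻¹)
  refine ⟨⟨Quotient.mk _ ((x : G) * y.out⁻¹), y⟩, ⟨?_, h2⟩, ?_⟩
  · simpa only [Set.mem_ofPred_eq, e, coeffAt_mul_left f hh] using h1
  · have e2 : (Quotient.mk _ ((x : G) * y.out⁻¹) : RightCoset H).out * y.out = h * x := by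
      rw [e]; group
    have hm : (Quotient.mk _ ((x : G) * y.out⁻¹) : RightCoset H).out * y.out ∈ Δ := by
      rw [e2]; exact Δ.mul_mem (mem_of_mem hh) x.2
    have hD2 : HeckeCoset.mk H H x = D := Quotient.out_eq D
    simp only [ψ, dif_pos hm]
    rw [← hD2]
    exact (mk_eq_mk.2 ⟨h, hh, 1, H.one_mem, by simpa using e2⟩).symm

/-- The product of the Hecke ring. -/
instance [IsHeckeTriple Δ H H] : Mul (𝕋 Δ H ℤ) where
  mul f g := HeckeCosetModule.of
    (Finsupp.ofSupportFinite (fun D => conv f g (Quotient.out D : Δ)) (finite_conv f g))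

/-- The double coset `H g H` as an element of the Hecke ring. -/
def single (H : Subgroup G) (g : Δ) : 𝕋 Δ H ℤ :=
  HeckeCosetModule.of (Finsupp.single (HeckeCoset.mk H H g) 1)

/-- The identity element is the trivial double coset `H`. -/
instance : One (𝕋 Δ H ℤ) := ⟨single H 1⟩

lemma coeffAt_mul [IsHeckeTriple Δ H H] (f g : 𝕋 Δ H ℤ) (x : G) :
    coeffAt (f * g) x = conv f g x := by
  by_cases hx : x ∈ Δ
  · rw [coeffAt, dif_pos hx]
    change conv f g _ = _
    have : HeckeCoset.mk H H (Quotient.out (HeckeCoset.mk H H ⟨x, hx⟩)) =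
      HeckeCoset.mk H H ⟨x, hx⟩ := Quotient.out_eq _
    obtain ⟨h, hh, k, hk, e⟩ := mk_eq_mk.1 this
    simp only at e
    conv_rhs => rw [e, conv_mul_right f g hk, conv_mul_left f g hh]
  · rw [coeffAt, dif_neg hx]
    by_contra hne
    exact hx (mem_of_conv_ne_zero (Ne.symm hne))

lemma ext_coeffAt {f g : 𝕋 Δ H ℤ} (h : ∀ x, coeffAt f x = coeffAt g x) : f = g := by
  refine HeckeCosetModule.ext fun D => ?_
  induction D using Quotient.inductionOn with
  | h a =>
    have := h a
    rw [coeffAt, coeffAt, dif_pos a.2, dif_pos a.2] at this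
    exact this

lemma coeffAt_add (f g : 𝕋 Δ H ℤ) (x : G) :
    coeffAt (f + g) x = coeffAt f x + coeffAt g x := by
  unfold coeffAt
  split_ifs
  · rfl
  · rfl

lemma coeffAt_zero (x : G) : coeffAt (0 : 𝕋 Δ H ℤ) x = 0 := by
  unfold coeffAt
  split_ifs
  · rfl
  · rfl

open Classical in
lemma coeffAt_one [IsHeckeTriple Δ H H] (x : G) :
    coeffAt (1 : 𝕋 Δ H ℤ) x = if x ∈ H then 1 else 0 := by
  by_cases hx : x ∈ Δ
  · rw [coeffAt, dif_pos hx]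
    change Finsupp.single (HeckeCoset.mk H H (1 : Δ)) (1 : ℤ) (HeckeCoset.mk H H ⟨x, hx⟩) = _
    rw [Finsupp.single_apply]
    congr 1
    rw [mk_eq_mk, eq_iff_iff]
    constructor
    · rintro ⟨h, hh, k, hk, e⟩
      simp only [OneMemClass.coe_one, mul_one] at e
      rw [e]
      exact H.mul_mem hh hk
    · intro h
      exact ⟨x, h, 1, H.one_mem, by simp⟩
  · rw [coeffAt, dif_neg hx, if_neg fun h => hx (mem_of_mem h)]

lemma mul_assoc' [IsHeckeTriple Δ H H] (f g k : 𝕋 Δ H ℤ) : f * g * k = f * (g * k) := by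
  refine ext_coeffAt fun x => ?_
  rw [coeffAt_mul, coeffAt_mul]
  unfold conv
  simp only [coeffAt_mul]
  set S := (finite_support k).toFinset with hS
  have hk : ∀ (F : RightCoset H → ℤ), (∑ᶠ y : RightCoset H, F y * coeffAt k y.out)
      = ∑ y ∈ S, F y * coeffAt k y.out := fun F =>
    finsum_eq_sum_of_support_subset _ fun y hy => by
      simpa [hS] using right_ne_zero_of_mul hy
  rw [hk]
  have h1 : ∀ y : RightCoset H, conv g k y.out
      = ∑ z ∈ S, coeffAt g (y.out * z.out⁻¹) * coeffAt k z.out := fun y => hk _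
  simp only [h1, Finset.mul_sum]
  have hsupp : ∀ z : RightCoset H, (Function.support fun y : RightCoset H =>
      coeffAt f (x * y.out⁻¹) * coeffAt g (y.out * z.out⁻¹)).Finite := by
    intro z
    have := finite_support_conv f g (x * z.out⁻¹)
    refine ((this.image (mulRight H z.out))).subset ?_
    intro y hy
    refine ⟨(mulRight H z.out).symm y, ?_, by simp⟩
    obtain ⟨h, hh, e⟩ := mulRight_out (H := H) z.out ((mulRight H z.out).symm y)
    rw [Equiv.apply_symm_apply] at e
    rw [Function.mem_support, e] at hy
    set w := ((mulRight H z.out).symm y).out with hw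
    have e1 : x * (h * (w * z.out))⁻¹ = x * z.out⁻¹ * w⁻¹ * h⁻¹ := by group
    have e2 : h * (w * z.out) * z.out⁻¹ = h * w := by group
    rw [e1, e2, coeffAt_mul_right f (H.inv_mem hh), coeffAt_mul_left g hh] at hy
    exact hy
  rw [finsum_sum_comm]
  · refine Finset.sum_congr rfl fun z _ => ?_
    rw [← conv_translate f g x z.out, finsum_mul' _ _ (hsupp z)]
    exact finsum_congr fun y => by ring
  · intro z _
    refine (hsupp z).subset fun y hy => ?_
    rw [Function.mem_support, ← mul_assoc] at hy
    exact left_ne_zero_of_mul hy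

lemma one_mul' [IsHeckeTriple Δ H H] (f : 𝕋 Δ H ℤ) : 1 * f = f := by
  classical
  refine ext_coeffAt fun x => ?_
  rw [coeffAt_mul]
  unfold conv
  obtain ⟨h, hh, e⟩ := out_mk (H := H) x
  rw [finsum_eq_single _ (Quotient.mk _ x : RightCoset H)]
  · rw [e, coeffAt_one, if_pos (by simpa using hh), coeffAt_mul_left f hh, one_mul]
  · intro y hy
    rw [coeffAt_one, if_neg, zero_mul]
    intro hm
    apply hy
    rw [← Quotient.out_eq y]
    exact Quotient.sound (QuotientGroup.rightRel_apply.2 hm)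

lemma mul_one' [IsHeckeTriple Δ H H] (f : 𝕋 Δ H ℤ) : f * 1 = f := by
  classical
  refine ext_coeffAt fun x => ?_
  rw [coeffAt_mul]
  unfold conv
  obtain ⟨h, hh, e⟩ := out_mk (H := H) (1 : G)
  rw [finsum_eq_single _ (Quotient.mk _ 1 : RightCoset H)]
  · rw [e, mul_one, coeffAt_one, if_pos hh, coeffAt_mul_right f (H.inv_mem hh), mul_one]
  · intro y hy
    rw [coeffAt_one, if_neg, mul_zero]
    intro hm
    apply hy
    rw [← Quotient.out_eq y]
    exact Quotient.sound (QuotientGroup.rightRel_apply.2 (by simpa using hm))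

lemma mul_add' [IsHeckeTriple Δ H H] (f g k : 𝕋 Δ H ℤ) : f * (g + k) = f * g + f * k := by
  refine ext_coeffAt fun x => ?_
  rw [coeffAt_add, coeffAt_mul, coeffAt_mul, coeffAt_mul]
  unfold conv
  rw [← finsum_add_distrib (finite_support_conv f g x) (finite_support_conv f k x)]
  exact finsum_congr fun y => by rw [coeffAt_add, mul_add]

lemma add_mul' [IsHeckeTriple Δ H H] (f g k : 𝕋 Δ H ℤ) : (f + g) * k = f * k + g * k := by
  refine ext_coeffAt fun x => ?_
  rw [coeffAt_add, coeffAt_mul, coeffAt_mul, coeffAt_mul]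
  unfold conv
  rw [← finsum_add_distrib (finite_support_conv f k x) (finite_support_conv g k x)]
  exact finsum_congr fun y => by rw [coeffAt_add, add_mul]

/-- The Hecke ring `ℋ(H, Δ)` over `ℤ`. -/
instance [IsHeckeTriple Δ H H] : Ring (𝕋 Δ H ℤ) :=
  { (inferInstance : AddCommGroup (𝕋 Δ H ℤ)), (inferInstance : Mul (𝕋 Δ H ℤ)),
    (inferInstance : One (𝕋 Δ H ℤ)) with
    mul_assoc := mul_assoc'
    one_mul := one_mul'
    mul_one := mul_one'
    left_distrib := mul_add'
    right_distrib := add_mul'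
    zero_mul := fun f => by
      have := add_mul' 0 0 f
      rw [add_zero] at this
      exact left_eq_add.1 this
    mul_zero := fun f => by
      have := mul_add' f 0 0
      rw [add_zero] at this
      exact left_eq_add.1 this }

end HeckeProduct

/-! ### The paramodular group of degree 2 -/

namespace Paramodular

open Matrix

/-- The real symplectic group of degree 2 (real `4 × 4` matrices). -/
abbrev Sp2 : Type := symplecticGroup (Fin 2) ℝ

/-- Real `4 × 4` matrices, as `2 × 2` block matrices with `2 × 2` blocks. -/
abbrev Mat4 : Type := Matrix (Fin 2 ⊕ Fin 2) (Fin 2 ⊕ Fin 2) ℝ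

/-- The shape of the elements of the paramodular group of level `N`. -/
def IsParamodular (N : ℕ) (M : Mat4) : Prop :=
  ∃ a₁ a₂ a₃ a₄ b₁ b₂ b₃ b₄ c₁ c₂ c₃ c₄ d₁ d₂ d₃ d₄ : ℤ,
    M = fromBlocks
      !![(a₁ : ℝ), a₂ * N; a₃, a₄] !![(b₁ : ℝ), b₂; b₃, b₄ / N]
      !![(c₁ : ℝ), c₂ * N; c₃ * N, c₄ * N] !![(d₁ : ℝ), d₂; d₃ * N, d₄]

lemma IsParamodular.mul {N : ℕ} [NeZero N] {M M' : Mat4} (h : IsParamodular N M)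
    (h' : IsParamodular N M') : IsParamodular N (M * M') := by
  have hN : (N : ℝ) ≠ 0 := NeZero.ne _
  obtain ⟨a₁, a₂, a₃, a₄, b₁, b₂, b₃, b₄, c₁, c₂, c₃, c₄, d₁, d₂, d₃, d₄, rfl⟩ := h
  obtain ⟨e₁, e₂, e₃, e₄, f₁, f₂, f₃, f₄, g₁, g₂, g₃, g₄, h₁, h₂, h₃, h₄, rfl⟩ := h'
  refine ⟨a₁ * e₁ + a₂ * N * e₃ + b₁ * g₁ + b₂ * (g₃ * N),
    a₁ * e₂ + a₂ * e₄ + b₁ * g₂ + b₂ * g₄,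
    a₃ * e₁ + a₄ * e₃ + b₃ * g₁ + b₄ * g₃,
    a₃ * (e₂ * N) + a₄ * e₄ + b₃ * (g₂ * N) + b₄ * g₄,
    a₁ * f₁ + a₂ * N * f₃ + b₁ * h₁ + b₂ * (h₃ * N),
    a₁ * f₂ + a₂ * f₄ + b₁ * h₂ + b₂ * h₄,
    a₃ * f₁ + a₄ * f₃ + b₃ * h₁ + b₄ * h₃,
    a₃ * f₂ * N + a₄ * f₄ + b₃ * h₂ * N + b₄ * h₄,
    c₁ * e₁ + c₂ * N * e₃ + d₁ * g₁ + d₂ * (g₃ * N),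
    c₁ * e₂ + c₂ * e₄ + d₁ * g₂ + d₂ * g₄,
    c₃ * e₁ + c₄ * e₃ + d₃ * g₁ + d₄ * g₃,
    c₃ * (e₂ * N) + c₄ * e₄ + d₃ * (g₂ * N) + d₄ * g₄,
    c₁ * f₁ + c₂ * N * f₃ + d₁ * h₁ + d₂ * (h₃ * N),
    c₁ * f₂ + c₂ * f₄ + d₁ * h₂ + d₂ * h₄,
    c₃ * f₁ + c₄ * f₃ + d₃ * h₁ + d₄ * h₃,
    c₃ * f₂ * N + c₄ * f₄ + d₃ * h₂ * N + d₄ * h₄, ?_⟩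
  rw [fromBlocks_multiply]
  congr 1 <;> ext i j <;> fin_cases i <;> fin_cases j <;>
    simp <;> field_simp <;> ring

/-- The block form of the inverse of a symplectic matrix. -/
lemma coe_inv_fromBlocks {M : Sp2} {A B C D : Matrix (Fin 2) (Fin 2) ℝ}
    (h : (M : Mat4) = fromBlocks A B C D) :
    ((M⁻¹ : Sp2) : Mat4) = fromBlocks Dᵀ (-Bᵀ) (-Cᵀ) Aᵀ := by
  rw [SymplecticGroup.coe_inv, h, Matrix.J]
  simp [fromBlocks_multiply, fromBlocks_transpose, fromBlocks_neg]

lemma IsParamodular.inv {N : ℕ} {M : Sp2} (h : IsParamodular N (M : Mat4)) :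
    IsParamodular N ((M⁻¹ : Sp2) : Mat4) := by
  obtain ⟨a₁, a₂, a₃, a₄, b₁, b₂, b₃, b₄, c₁, c₂, c₃, c₄, d₁, d₂, d₃, d₄, h⟩ := h
  refine ⟨d₁, d₃, d₂, d₄, -b₁, -b₃, -b₂, -b₄, -c₁, -c₃, -c₂, -c₄, a₁, a₃, a₂, a₄, ?_⟩
  rw [coe_inv_fromBlocks h]
  congr 1 <;> ext i j <;> fin_cases i <;> fin_cases j <;> simp [neg_div]

lemma isParamodular_one_add {N : ℕ} [NeZero N]
    (Z : Matrix (Fin 2 ⊕ Fin 2) (Fin 2 ⊕ Fin 2) ℤ) :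
    IsParamodular N (1 + (N : ℝ) • Z.map (Int.cast : ℤ → ℝ)) := by
  have hN : (N : ℝ) ≠ 0 := NeZero.ne _
  let z (i j : Fin 2 ⊕ Fin 2) : ℤ := Z i j
  refine ⟨1 + N * z (.inl 0) (.inl 0), z (.inl 0) (.inl 1),
    N * z (.inl 1) (.inl 0), 1 + N * z (.inl 1) (.inl 1),
    N * z (.inl 0) (.inr 0), N * z (.inl 0) (.inr 1),
    N * z (.inl 1) (.inr 0), N * N * z (.inl 1) (.inr 1),
    N * z (.inr 0) (.inl 0), z (.inr 0) (.inl 1),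
    z (.inr 1) (.inl 0), z (.inr 1) (.inl 1),
    1 + N * z (.inr 0) (.inr 0), N * z (.inr 0) (.inr 1),
    z (.inr 1) (.inr 0), 1 + N * z (.inr 1) (.inr 1), ?_⟩
  ext i j
  rcases i with i | i <;> rcases j with j | j <;> fin_cases i <;> fin_cases j <;>
    simp [z] <;> field_simp

/-- The paramodular group `Σ_N` of degree 2 and level `N`. -/
def paramodularGroup (N : ℕ) [NeZero N] : Subgroup Sp2 where
  carrier := {M | IsParamodular N (M : Mat4)}
  one_mem' := by simpa using isParamodular_one_add (N := N) 0
  mul_mem' h h' := IsParamodular.mul h h'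
  inv_mem' h := IsParamodular.inv h

lemma map_add_int (A B : Matrix (Fin 2 ⊕ Fin 2) (Fin 2 ⊕ Fin 2) ℤ) :
    (A + B).map (Int.cast : ℤ → ℝ) = A.map Int.cast + B.map Int.cast := by
  ext i j; simp

lemma map_mul_int (A B : Matrix (Fin 2 ⊕ Fin 2) (Fin 2 ⊕ Fin 2) ℤ) :
    (A * B).map (Int.cast : ℤ → ℝ) = A.map Int.cast * B.map Int.cast :=
  Matrix.map_mul (f := Int.castRingHom ℝ)

lemma exists_int_inv {g : Sp2} {m : ℕ} {M : Matrix (Fin 2 ⊕ Fin 2) (Fin 2 ⊕ Fin 2) ℤ}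
    (h : (g : Mat4) = (1 / √(m : ℝ)) • M.map (Int.cast : ℤ → ℝ)) :
    ∃ M' : Matrix (Fin 2 ⊕ Fin 2) (Fin 2 ⊕ Fin 2) ℤ,
      ((g⁻¹ : Sp2) : Mat4) = (1 / √(m : ℝ)) • M'.map (Int.cast : ℤ → ℝ) := by
  refine ⟨(-J (Fin 2) ℤ) * Mᵀ * J (Fin 2) ℤ, ?_⟩
  have hJ : (J (Fin 2) ℤ).map (Int.cast : ℤ → ℝ) = J (Fin 2) ℝ := map_J _ (Int.castRingHom ℝ)
  have h3 : (-J (Fin 2) ℤ).map (Int.cast : ℤ → ℝ) = -J (Fin 2) ℝ := by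
    rw [← hJ]; ext i j; simp
  rw [SymplecticGroup.coe_inv, h, map_mul_int, map_mul_int, hJ, h3, Matrix.transpose_map]
  simp only [Matrix.transpose_smul, smul_mul_assoc, mul_smul_comm]

/-- The group `𝔾` of all real symplectic matrices `(1/√m) M` with `M` integral and `m` a positive
integer. -/
def rationalGroup : Subgroup Sp2 where
  carrier := {g | ∃ m : ℕ, 0 < m ∧ ∃ M : Matrix (Fin 2 ⊕ Fin 2) (Fin 2 ⊕ Fin 2) ℤ,
    (g : Mat4) = (1 / √(m : ℝ)) • M.map (Int.cast : ℤ → ℝ)}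
  one_mem' := ⟨1, one_pos, 1, by simp⟩
  mul_mem' := by
    rintro g g' ⟨m, hm, M, h⟩ ⟨m', hm', M', h'⟩
    refine ⟨m * m', Nat.mul_pos hm hm', M * M', ?_⟩
    rw [Submonoid.coe_mul, h, h', map_mul_int, Nat.cast_mul, Real.sqrt_mul (Nat.cast_nonneg m)]
    simp only [smul_mul_assoc, mul_smul_comm, smul_smul]
    congr 1
    rw [one_div_mul_one_div, mul_comm]
  inv_mem' := by
    rintro g ⟨m, hm, M, h⟩
    exact ⟨m, hm, exists_int_inv h⟩

lemma IsParamodular.exists_int {N : ℕ} [NeZero N] {M : Mat4} (h : IsParamodular N M) :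
    ∃ A : Matrix (Fin 2 ⊕ Fin 2) (Fin 2 ⊕ Fin 2) ℤ, (N : ℝ) • M = A.map (Int.cast : ℤ → ℝ) := by
  have hN : (N : ℝ) ≠ 0 := NeZero.ne _
  obtain ⟨a₁, a₂, a₃, a₄, b₁, b₂, b₃, b₄, c₁, c₂, c₃, c₄, d₁, d₂, d₃, d₄, rfl⟩ := h
  refine ⟨fromBlocks
      !![N * a₁, N * (a₂ * N); N * a₃, N * a₄] !![N * b₁, N * b₂; N * b₃, b₄]
      !![N * c₁, N * (c₂ * N); N * (c₃ * N), N * (c₄ * N)]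
      !![N * d₁, N * d₂; N * (d₃ * N), N * d₄], ?_⟩
  ext i j
  rcases i with i | i <;> rcases j with j | j <;> fin_cases i <;> fin_cases j <;>
    simp <;> field_simp

lemma coe_inv_mul (g : Sp2) : ((g⁻¹ : Sp2) : Mat4) * (g : Mat4) = 1 := by
  rw [← Submonoid.coe_mul, inv_mul_cancel, Submonoid.coe_one]

open scoped Pointwise in
lemma relIndex_conj_ne_zero (N : ℕ) [NeZero N] {g : Sp2} (hg : g ∈ rationalGroup) :
    (ConjAct.toConjAct g • paramodularGroup N).relIndex (paramodularGroup N) ≠ 0 := by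
  classical
  have hN : (N : ℝ) ≠ 0 := NeZero.ne _
  set H := paramodularGroup N with hH
  obtain ⟨m, hm, M, hM⟩ := hg
  obtain ⟨M', hM'⟩ := exists_int_inv hM
  have hint : ∀ a : H, ∃ A : Matrix (Fin 2 ⊕ Fin 2) (Fin 2 ⊕ Fin 2) ℤ,
      (N : ℝ) • ((a : Sp2) : Mat4) = A.map (Int.cast : ℤ → ℝ) := fun a =>
    IsParamodular.exists_int a.2
  choose F hF using hint
  set L : ℕ := N ^ 3 * m with hL
  have hL0 : L ≠ 0 := by
    have := NeZero.ne N
    positivity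
  have : NeZero L := ⟨hL0⟩
  let f : H → Matrix (Fin 2 ⊕ Fin 2) (Fin 2 ⊕ Fin 2) (ZMod L) := fun a =>
    (F a).map (Int.cast : ℤ → ZMod L)
  have key : ∀ a b : H, f a = f b → ((a⁻¹ * b : H) : Sp2) ∈ ConjAct.toConjAct g • H := by
    intro a b hab
    have hX : ∃ X : Matrix (Fin 2 ⊕ Fin 2) (Fin 2 ⊕ Fin 2) ℤ,
        F b = F a + (L : ℤ) • X := by
      have : ∀ i j, ∃ x : ℤ, F b i j = F a i j + L * x := by
        intro i j
        have h1 : ((F a i j : ℤ) : ZMod L) = (F b i j : ℤ) := congrFun (congrFun hab i) j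
        obtain ⟨x, hx⟩ := ((ZMod.intCast_eq_intCast_iff_dvd_sub _ _ _).1 h1)
        exact ⟨x, by linarith⟩
      choose X hX using this
      exact ⟨X, by
        ext i j
        rw [Matrix.add_apply, hX]
        rfl⟩
    obtain ⟨X, hX⟩ := hX
    have hb : (((b : H) : Sp2) : Mat4)
        = ((a : H) : Sp2) + ((L : ℝ) / N) • X.map (Int.cast : ℤ → ℝ) := by
      have h1 := hF b
      rw [hX, map_add_int, ← hF a] at h1
      have h2 : ((L : ℤ) • X).map (Int.cast : ℤ → ℝ) = (L : ℝ) • X.map (Int.cast : ℤ → ℝ) := by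
        ext i j
        simp only [Matrix.map_apply, Matrix.smul_apply, smul_eq_mul]
        push_cast
        rfl
      rw [h2] at h1
      have h3 := congrArg (fun Y : Mat4 => (N : ℝ)⁻¹ • Y) h1
      simp only [smul_add, smul_smul, inv_mul_cancel₀ hN, one_smul] at h3
      rw [h3]
      congr 2
      field_simp
    have ha := hF a⁻¹
    have ha' : (((a⁻¹ : H) : Sp2) : Mat4) = (1 / (N : ℝ)) • (F a⁻¹).map (Int.cast : ℤ → ℝ) := by
      rw [← ha, smul_smul, one_div_mul_cancel hN, one_smul]
    have hc : (((a⁻¹ * b : H) : Sp2) : Mat4)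
        = 1 + ((N : ℝ) * m) • (F a⁻¹ * X).map (Int.cast : ℤ → ℝ) := by
      have h0 : (((a⁻¹ * b : H) : Sp2) : Mat4)
        = (((a⁻¹ : H) : Sp2) : Mat4) * (((b : H) : Sp2) : Mat4) := rfl
      have h4 : (((a⁻¹ : H) : Sp2) : Mat4) * (((a : H) : Sp2) : Mat4) = 1 :=
        coe_inv_mul _
      rw [h0, hb, mul_add, h4, ha', map_mul_int]
      simp only [smul_mul_assoc, mul_smul_comm, smul_smul]
      congr 2
      rw [hL]; push_cast; field_simp
    rw [Subgroup.mem_pointwise_smul_iff_inv_smul_mem, ← map_inv, ConjAct.toConjAct_smul]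
    change IsParamodular N _
    have hm0 : (m : ℝ) ≠ 0 := by positivity
    have hcg : ((((g⁻¹ : Sp2) * ((a⁻¹ * b : H) : Sp2) * (g⁻¹)⁻¹ : Sp2)) : Mat4)
        = 1 + (N : ℝ) • (M' * (F a⁻¹ * X) * M).map (Int.cast : ℤ → ℝ) := by
      rw [inv_inv, Submonoid.coe_mul, Submonoid.coe_mul, hc, mul_add, add_mul, mul_one,
        coe_inv_mul, hM', hM, map_mul_int (M' * _), map_mul_int M']
      simp only [smul_mul_assoc, mul_smul_comm, smul_smul]
      congr 2
      have h1 : √(m : ℝ) ≠ 0 := by positivity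
      have h3 : √(m : ℝ) ^ 2 = m := Real.sq_sqrt (Nat.cast_nonneg m)
      field_simp
      rw [h3]
    have := isParamodular_one_add (N := N) (M' * (F a⁻¹ * X) * M)
    rw [← hcg] at this
    exact this
  have hfin : Finite (H ⧸ (ConjAct.toConjAct g • H).subgroupOf H) := by
    refine Finite.of_injective (fun q => f q.out) fun q r hqr => ?_
    rw [← Quotient.out_eq q, ← Quotient.out_eq r]
    apply Quotient.sound
    apply QuotientGroup.leftRel_apply.2
    exact key _ _ hqr
  exact (Subgroup.finiteIndex_of_finite_quotient
    (H := (ConjAct.toConjAct g • H).subgroupOf H)).index_ne_zero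

lemma paramodularGroup_le (N : ℕ) [NeZero N] : paramodularGroup N ≤ rationalGroup := by
  intro g hg
  obtain ⟨A, hA⟩ := IsParamodular.exists_int hg
  have hN : (N : ℝ) ≠ 0 := NeZero.ne _
  refine ⟨N ^ 2, pow_pos (NeZero.pos N) 2, A, ?_⟩
  rw [← hA, smul_smul, Nat.cast_pow, Real.sqrt_sq (Nat.cast_nonneg N), one_div_mul_cancel hN,
    one_smul]

open scoped Pointwise in
/-- `(Σ_N, 𝔾)` is a Hecke pair. -/
instance (N : ℕ) [NeZero N] :
    IsHeckeTriple rationalGroup.toSubmonoid (paramodularGroup N) (paramodularGroup N) := by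
  refine IsHeckeTriple.of_diagonal (paramodularGroup_le N) fun g hg => ?_
  change g ∈ Subgroup.Commensurable.commensurator _
  rw [Subgroup.Commensurable.commensurator_mem_iff]
  refine ⟨relIndex_conj_ne_zero N hg, ?_⟩
  have h := relIndex_conj_ne_zero N (rationalGroup.inv_mem hg)
  rwa [← Subgroup.relIndex_pointwise_smul (ConjAct.toConjAct g), smul_smul, ← map_mul,
    mul_inv_cancel, map_one, one_smul] at h

/-- The Hecke algebra `ℋ(Σ_N, 𝔾)` over `ℤ`. -/
abbrev HeckeAlgebra (N : ℕ) [NeZero N] : Type :=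
  𝕋 rationalGroup.toSubmonoid (paramodularGroup N) ℤ

/-- The double coset `Σ_N g Σ_N` as an element of the Hecke algebra. -/
def doubleCoset (N : ℕ) [NeZero N] (g : rationalGroup) : HeckeAlgebra N :=
  HeckeProduct.single (Δ := rationalGroup.toSubmonoid) (paramodularGroup N) ⟨g.1, g.2⟩

lemma levi_mem {A D : Matrix (Fin 2) (Fin 2) ℝ} (h : Aᵀ * D = 1) :
    fromBlocks A 0 0 D ∈ symplecticGroup (Fin 2) ℝ := by
  rw [SymplecticGroup.fromBlocks_mem_iff]
  simp [h]

/-- The matrix `(1/√m) diag(a, b, c, d)` with `a c = b d = m`, as an element of `𝔾`. -/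
def diagElement (m a b c d : ℕ) (hm : 0 < m) (hac : a * c = m) (hbd : b * d = m) :
    rationalGroup :=
  ⟨⟨(1 / √(m : ℝ)) • fromBlocks !![(a : ℝ), 0; 0, b] 0 0 !![(c : ℝ), 0; 0, d], by
    have h1 : √(m : ℝ) ≠ 0 := by positivity
    have h2 : √(m : ℝ) * √(m : ℝ) = m := Real.mul_self_sqrt (Nat.cast_nonneg m)
    have h3 : (a : ℝ) * c = m := by exact_mod_cast hac
    have h4 : (b : ℝ) * d = m := by exact_mod_cast hbd
    rw [fromBlocks_smul, smul_zero]
    apply levi_mem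
    ext i j
    fin_cases i <;> fin_cases j <;> simp [Matrix.mul_apply] <;> field_simp <;> nlinarith⟩,
   ⟨m, hm, fromBlocks !![(a : ℤ), 0; 0, b] 0 0 !![(c : ℤ), 0; 0, d], by
    ext i j
    rcases i with i | i <;> rcases j with j | j <;> fin_cases i <;> fin_cases j <;> simp⟩⟩

/-- `𝒯_{N,1}(q)`, the double coset of `(1/√q) diag(1, 1, q, q)`. -/
def heckeT₁ (N : ℕ) [NeZero N] (q : ℕ) (hq : q.Prime) : HeckeAlgebra N :=
  doubleCoset N (diagElement q 1 1 q q hq.pos (one_mul q) (one_mul q))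

/-- `𝒯_{N,2}(q)`, the double coset of `(1/q) diag(1, q, q², q)`. -/
def heckeT₂ (N : ℕ) [NeZero N] (q : ℕ) (hq : q.Prime) : HeckeAlgebra N :=
  doubleCoset N (diagElement (q ^ 2) 1 q (q ^ 2) q (pow_pos hq.pos 2) (one_mul _) (sq q).symm)

/-- `W` is an admissible choice of the matrix `W_d = diag(V_d, (V_d')⁻¹)`, where
`V_d = (1/√d) (α d, β N; γ, δ d)` has determinant `1` and `α, β, γ, δ` are integers. -/
def IsAtkinLehner (N d : ℕ) (W : rationalGroup) : Prop :=
  ∃ α β γ δ : ℤ, ∃ V : Matrix (Fin 2) (Fin 2) ℝ,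
    V = (1 / √(d : ℝ)) • !![(α : ℝ) * d, β * N; γ, δ * d] ∧ V.det = 1 ∧
    ((W : Sp2) : Mat4) = fromBlocks V 0 0 (Vᵀ)⁻¹

/-- A matrix `W_p` exists for every prime divisor `p` of a squarefree `N`. -/
lemma exists_isAtkinLehner {N p : ℕ} (hN : Squarefree N) (hp : p.Prime) (hpN : p ∣ N) :
    ∃ W : rationalGroup, IsAtkinLehner N p W := by
  obtain ⟨r, rfl⟩ := hpN
  have hcop : Nat.Coprime p r := Nat.coprime_of_squarefree_mul hN
  obtain ⟨a, b, hab⟩ : ∃ a b : ℤ, a * p + b * r = 1 := by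
    have := Nat.isCoprime_iff_coprime.2 hcop
    obtain ⟨a, b, h⟩ := this
    exact ⟨a, b, h⟩
  have hab' : (a : ℝ) * p + b * r = 1 := by exact_mod_cast hab
  have hp0 : (p : ℝ) ≠ 0 := by exact_mod_cast hp.ne_zero
  have h1 : √(p : ℝ) ≠ 0 := by
    have := hp.pos
    positivity
  have h2 : √(p : ℝ) ^ 2 = p := Real.sq_sqrt (Nat.cast_nonneg p)
  set V : Matrix (Fin 2) (Fin 2) ℝ :=
    (1 / √(p : ℝ)) • !![((a : ℤ) : ℝ) * p, ((-b : ℤ) : ℝ) * ((p * r : ℕ) : ℝ);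
      ((1 : ℤ) : ℝ), ((1 : ℤ) : ℝ) * p] with hV
  have hdet : V.det = 1 := by
    rw [hV, Matrix.det_smul, Matrix.det_fin_two]
    simp
    field_simp
    linear_combination hab'
  have hu : IsUnit (Vᵀ).det := by rw [Matrix.det_transpose, hdet]; exact isUnit_one
  have hinv : (Vᵀ)⁻¹ = (1 / √(p : ℝ)) • !![(p : ℝ), -1; (b : ℝ) * (p * r), a * p] := by
    apply Matrix.inv_eq_right_inv
    ext i j
    fin_cases i <;> fin_cases j <;> simp [hV, Matrix.mul_apply] <;> field_simp <;>
      simp only [h2] <;> first | ring1 | linear_combination (p : ℝ) * hab'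
  refine ⟨⟨⟨fromBlocks V 0 0 (Vᵀ)⁻¹, levi_mem (Matrix.mul_nonsing_inv _ hu)⟩,
    p, hp.pos, fromBlocks !![a * p, -b * (p * r); 1, p] 0 0 !![(p : ℤ), -1; b * (p * r), a * p],
    ?_⟩, a, -b, 1, 1, V, hV, hdet, rfl⟩
  change fromBlocks V 0 0 (Vᵀ)⁻¹ = _
  rw [hinv, hV]
  ext i j
  rcases i with i | i <;> rcases j with j | j <;> fin_cases i <;> fin_cases j <;> simp

end Paramodular

end

open scoped HeckeCosetModule

noncomputable section

/-! ### Leading terms in products of double cosets -/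

namespace HeckeProduct

variable {G : Type*} [Group G] {Δ : Submonoid G} {H : Subgroup G}

/-! Conjugation by P = diag(1, 1, 1, N) turns Σ_N into the group of integral isometries of the
alternating form of type (1, N), and 𝔾 into the integral similitudes M with multiplier m > 0, up to
the scaling (M, m) ~ (cM, c²m); see `mem_paramodularGroup_iff`, `mem_rationalGroup_iff`,
`rep_smul_iff`. Generation then means that a subring containing the generators contains every
`simCoset N m M`.

Strong approximation (`IsSim.approximable`) implies that double cosets with coprime multipliers
multiply like their representatives, so the primes can be treated one at a time. As p² ∤ N, a
similitude that is dominant at p is equivalent to diag(1, p^f, p^v, p^(v-f)), 2f ≤ v, times a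
similitude with multiplier prime to p (`IsDominant.exists_equivalent_stdMat`). If p ∤ N, every
similitude primitive at p is equivalent to a dominant one. If p ∣ N, isometries are block triangular
modulo p and cannot exchange the coordinate planes (0, 2) and (1, 3), but U = √p W_p can: one of M,
UM/p, UMU/p, MU is dominant (`IsAtkinMat.exists_isDominant`). Since W_p normalizes Σ_N and W_p² lies
in Σ_N, its double coset w satisfies w² = 1, and translation by W_p does not affect membership in
the subring.

The diagonal cosets are reached in `simCoset_stdMat_mem`. Multiplication by T₁(p) raises (v, f) by
(1, 0), by T₂(p) by (2, 1). The leading coset occurs with coefficient one, so no division is needed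
over ℤ, and up to w the other terms have a smaller v or a larger f: induct upwards on v and
downwards on f.

For p ∣ N, w does not commute with T₂(p) (`IsAtkinMat.not_commute`). Hence w ≠ ±1, and (1 - w)(1 +
w) = 0 gives zero divisors. -/

/-- The double coset relation `x ∈ H g H`. -/
def InDoubleCoset (H : Subgroup G) (g x : G) : Prop := ∃ h ∈ H, ∃ k ∈ H, x = h * g * k

lemma InDoubleCoset.refl (g : G) : InDoubleCoset H g g :=
  ⟨1, H.one_mem, 1, H.one_mem, by simp⟩

lemma InDoubleCoset.mul_mul {g x h k : G} (hx : InDoubleCoset H g x) (hh : h ∈ H) (hk : k ∈ H) :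
    InDoubleCoset H g (h * x * k) := by
  obtain ⟨a, ha, b, hb, rfl⟩ := hx
  exact ⟨h * a, H.mul_mem hh ha, b * k, H.mul_mem hb hk, by group⟩

lemma single_eq_single {a b : Δ} (h : InDoubleCoset H (a : G) b) : single H a = single H b := by
  unfold single
  rw [mk_eq_mk.2 h]

open Classical in
lemma coeffAt_single [IsHeckeTriple Δ H H] (a : Δ) (x : G) :
    coeffAt (single H a) x = if InDoubleCoset H (a : G) x then 1 else 0 := by
  by_cases hx : x ∈ Δ
  · rw [coeffAt, dif_pos hx]
    change Finsupp.single (HeckeCoset.mk H H a) (1 : ℤ) (HeckeCoset.mk H H ⟨x, hx⟩) = _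
    rw [Finsupp.single_apply]
    congr 1
    rw [mk_eq_mk, eq_iff_iff]
    rfl
  · rw [coeffAt, dif_neg hx, if_neg]
    rintro ⟨h, hh, k, hk, rfl⟩
    exact hx (Δ.mul_mem (Δ.mul_mem (mem_of_mem hh) a.2) (mem_of_mem hk))

/-- `HeckeCosetModule.of` as an additive map. -/
def ofHom : (HeckeCoset Δ H H →₀ ℤ) →+ 𝕋 Δ H ℤ where
  toFun := HeckeCosetModule.of
  map_zero' := rfl
  map_add' _ _ := rfl

lemma mem_of_forall_single_mem (A : AddSubgroup (𝕋 Δ H ℤ)) (f : 𝕋 Δ H ℤ)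
    (h : ∀ z : Δ, coeffAt f z ≠ 0 → single H z ∈ A) : f ∈ A := by
  have e : f = ofHom (HeckeCosetModule.of.symm f) := rfl
  rw [e, ← Finsupp.sum_single (HeckeCosetModule.of.symm f), map_finsuppSum]
  refine A.sum_mem fun D hD => ?_
  have e2 : (Finsupp.single D ((HeckeCosetModule.of.symm f) D) : HeckeCoset Δ H H →₀ ℤ)
      = ((HeckeCosetModule.of.symm f) D) • Finsupp.single D 1 := by simp
  change ofHom (Finsupp.single D _) ∈ A
  rw [e2, map_zsmul]
  refine A.zsmul_mem ?_ _
  induction D using Quotient.inductionOn with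
  | h a =>
    refine h a ?_
    rw [coeffAt, dif_pos a.2]
    exact Finsupp.mem_support_iff.1 hD

/-- Subtract all the other terms of f. The coefficient one at x is essential: over ℤ a larger
coefficient could not be divided out. -/
lemma single_mem_of_mem (A : AddSubgroup (𝕋 Δ H ℤ)) [IsHeckeTriple Δ H H] {f : 𝕋 Δ H ℤ}
    (hf : f ∈ A) (x : Δ) (hx : coeffAt f x = 1)
    (h : ∀ z : Δ, coeffAt f z ≠ 0 → InDoubleCoset H (x : G) z ∨ single H z ∈ A) :
    single H x ∈ A := by
  classical
  have key : f - single H x ∈ A := by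
    refine mem_of_forall_single_mem A _ fun z hz => ?_
    have e : coeffAt (f - single H x) z = coeffAt f z - coeffAt (single H x) (z : G) := by
      have := coeffAt_add (f - single H x) (single H x) (z : G)
      rw [sub_add_cancel] at this
      rw [this]; ring
    rw [e, coeffAt_single] at hz
    by_cases hxz : InDoubleCoset H (x : G) z
    · obtain ⟨a, ha, b, hb, e2⟩ := hxz
      rw [if_pos ⟨a, ha, b, hb, e2⟩, e2, coeffAt_mul_mul f ha hb, hx] at hz
      exact absurd (sub_self _) hz
    · rw [if_neg hxz, sub_zero] at hz
      exact (h z hz).resolve_left hxz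
  have := A.sub_mem hf key
  rwa [sub_sub_cancel] at this

/-- The product is supported on the set H g H y H, which is the union of the H (g k y) H with k in
H. -/
lemma exists_of_coeffAt_mul_ne_zero [IsHeckeTriple Δ H H] {g y : Δ} {z : G}
    (hz : coeffAt (single H g * single H y) z ≠ 0) :
    ∃ k ∈ H, InDoubleCoset H ((g : G) * k * y) z := by
  classical
  rw [coeffAt_mul] at hz
  obtain ⟨w, hw⟩ := exists_of_conv_ne_zero hz
  have h1 := left_ne_zero_of_mul hw
  have h2 := right_ne_zero_of_mul hw
  rw [coeffAt_single] at h1 h2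
  simp only [ne_eq, ite_eq_right_iff, one_ne_zero, imp_false, not_not] at h1 h2
  obtain ⟨a, ha, b, hb, e1⟩ := h1
  obtain ⟨c, hc, d, hd, e2⟩ := h2
  refine ⟨b * c, H.mul_mem hb hc, a, ha, d, hd, ?_⟩
  calc z = z * w.out⁻¹ * w.out := by group
    _ = _ := by rw [e1, e2]; group

/-- The coefficient counts the right cosets H y' in H y H with g y y'⁻¹ in H g H; by `huniq` the
only one is H y. -/
lemma coeffAt_mul_eq_one [IsHeckeTriple Δ H H] (g y : Δ)
    (huniq : ∀ g' y' : G, InDoubleCoset H (g : G) g' → InDoubleCoset H (y : G) y' →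
      g' * y' = g * y → y' * (y : G)⁻¹ ∈ H) :
    coeffAt (single H g * single H y) ((g : G) * y) = 1 := by
  classical
  rw [coeffAt_mul]
  unfold conv
  obtain ⟨h, hh, e⟩ := out_mk (H := H) (y : G)
  rw [finsum_eq_single _ (Quotient.mk _ (y : G) : RightCoset H)]
  · rw [e, coeffAt_mul_left _ hh, coeffAt_single, coeffAt_single, if_pos, if_pos (.refl _), one_mul]
    exact ⟨1, H.one_mem, h⁻¹, H.inv_mem hh, by group⟩
  · intro w hw
    rw [coeffAt_single, coeffAt_single]
    by_cases h1 : InDoubleCoset H (g : G) (g * y * w.out⁻¹)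
    · by_cases h2 : InDoubleCoset H (y : G) w.out
      · refine absurd ?_ hw
        rw [← Quotient.out_eq w]
        refine Quotient.sound (QuotientGroup.rightRel_apply.2 ?_)
        have := huniq _ _ h1 h2 (by group)
        simpa using H.inv_mem this
      · rw [if_neg h2, mul_zero]
    · rw [if_neg h1, zero_mul]

/-- The double coset of `g y` lies in a subring containing those of `g` and `y`, if the other
double cosets in the product do and the one of `g y` occurs with multiplicity one. -/
theorem single_mul_mem [IsHeckeTriple Δ H H] (S : Subring (𝕋 Δ H ℤ)) {g y : Δ}
    (hg : single H g ∈ S) (hy : single H y ∈ S)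
    (hother : ∀ k : Δ, (k : G) ∈ H →
      InDoubleCoset H ((g : G) * y) (g * k * y) ∨ single H (g * k * y) ∈ S)
    (huniq : ∀ g' y' : G, InDoubleCoset H (g : G) g' → InDoubleCoset H (y : G) y' →
      g' * y' = g * y → y' * (y : G)⁻¹ ∈ H) :
    single H (g * y) ∈ S := by
  refine single_mem_of_mem S.toAddSubgroup (S.mul_mem hg hy) (g * y)
    (coeffAt_mul_eq_one g y huniq) fun z hz => ?_
  obtain ⟨k, hk, hkz⟩ := exists_of_coeffAt_mul_ne_zero hz
  obtain ⟨a, ha, b, hb, e⟩ := hkz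
  rcases hother ⟨k, mem_of_mem hk⟩ hk with h1 | h1
  · left
    rw [e]
    exact h1.mul_mul ha hb
  · right
    have : single H (g * ⟨k, mem_of_mem hk⟩ * y) = single H z :=
      single_eq_single ⟨a, ha, b, hb, e⟩
    rw [← this]
    exact h1

/-- If the product of two double cosets is one double coset, with multiplicity one. -/
theorem single_mul_single [IsHeckeTriple Δ H H] {g y : Δ}
    (hother : ∀ k ∈ H, InDoubleCoset H ((g : G) * y) (g * k * y))
    (huniq : ∀ g' y' : G, InDoubleCoset H (g : G) g' → InDoubleCoset H (y : G) y' →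
      g' * y' = g * y → y' * (y : G)⁻¹ ∈ H) :
    single H g * single H y = single H (g * y) := by
  classical
  refine ext_coeffAt fun x => ?_
  rw [coeffAt_single]
  split_ifs with hx
  · obtain ⟨a, ha, b, hb, rfl⟩ := hx
    rw [coeffAt_mul_mul _ ha hb]
    exact coeffAt_mul_eq_one g y huniq
  · by_contra hne
    obtain ⟨k, hk, a, ha, b, hb, e⟩ := exists_of_coeffAt_mul_ne_zero hne
    exact hx (e ▸ (hother k hk).mul_mul ha hb)

end HeckeProduct

namespace Paramodular

open Matrix HeckeProduct

/-! ### Integral similitudes -/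

/-- Integral `4 × 4` matrices. -/
abbrev IMat : Type := Matrix (Fin 4) (Fin 4) ℤ

/-- The alternating form of type `(1, N)`. -/
def form (N : ℕ) : IMat := !![0, 0, -1, 0; 0, 0, 0, -N; 1, 0, 0, 0; 0, N, 0, 0]

/-- The form dual to `form N`, of type `(N, 1)`. -/
def dualForm (N : ℕ) : IMat := !![0, 0, -N, 0; 0, 0, 0, -1; N, 0, 0, 0; 0, 1, 0, 0]

/-- Integral similitudes of `form N` with multiplier `m`. -/
def IsSim (N m : ℕ) (M : IMat) : Prop := Mᵀ * form N * M = (m : ℤ) • form N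

/-- Both sides of the defining identity are alternating, so six entries suffice. They are relations
between pairs of columns of M. -/
lemma isSim_iff {N m : ℕ} {M : IMat} : IsSim N m M ↔
    (M 0 0 * M 2 2 - M 2 0 * M 0 2 + N * (M 1 0 * M 3 2 - M 3 0 * M 1 2) = m ∧
    M 0 1 * M 2 3 - M 2 1 * M 0 3 + N * (M 1 1 * M 3 3 - M 3 1 * M 1 3) = m * N ∧
    M 0 0 * M 2 1 - M 2 0 * M 0 1 + N * (M 1 0 * M 3 1 - M 3 0 * M 1 1) = 0 ∧
    M 0 0 * M 2 3 - M 2 0 * M 0 3 + N * (M 1 0 * M 3 3 - M 3 0 * M 1 3) = 0 ∧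
    M 0 2 * M 2 1 - M 2 2 * M 0 1 + N * (M 1 2 * M 3 1 - M 3 2 * M 1 1) = 0 ∧
    M 0 2 * M 2 3 - M 2 2 * M 0 3 + N * (M 1 2 * M 3 3 - M 3 2 * M 1 3) = 0) := by
  unfold IsSim
  constructor
  · intro h
    have e : ∀ i j, (Mᵀ * form N * M) i j = ((m : ℤ) • form N) i j := fun i j => by rw [h]
    simp only [Matrix.mul_apply, Fin.sum_univ_four, form, transpose_apply, of_apply,
      Matrix.smul_apply] at e
    have e02 := e 0 2
    have e13 := e 1 3
    have e01 := e 0 1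
    have e03 := e 0 3
    have e21 := e 2 1
    have e23 := e 2 3
    simp at e02 e13 e01 e03 e21 e23
    refine ⟨?_, ?_, ?_, ?_, ?_, ?_⟩ <;> linarith
  · rintro ⟨h1, h2, h3, h4, h5, h6⟩
    ext i j
    fin_cases i <;> fin_cases j <;>
      simp [Matrix.mul_apply, Fin.sum_univ_four, form] <;> linarith

lemma dualForm_mul_form (N : ℕ) : dualForm N * form N = (-(N : ℤ)) • (1 : IMat) := by
  ext i j
  fin_cases i <;> fin_cases j <;> simp [Matrix.mul_apply, Fin.sum_univ_four, form, dualForm]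

lemma mul_left_cancel_of_det_ne_zero {M X Y : IMat} (hM : M.det ≠ 0) (h : M * X = M * Y) :
    X = Y := by
  have h2 : M.adjugate * (M * X) = M.adjugate * (M * Y) := by rw [h]
  rw [← mul_assoc, ← mul_assoc, adjugate_mul, smul_mul_assoc, smul_mul_assoc, one_mul,
    one_mul] at h2
  exact smul_right_injective _ hM h2

lemma mul_right_cancel_of_det_ne_zero {M X Y : IMat} (hM : M.det ≠ 0) (h : X * M = Y * M) :
    X = Y := by
  have h2 : X * M * M.adjugate = Y * M * M.adjugate := by rw [h]
  rw [mul_assoc, mul_assoc, mul_adjugate, mul_smul_comm, mul_smul_comm, mul_one,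
    mul_one] at h2
  exact smul_right_injective _ hM h2

lemma det_form (N : ℕ) : (form N).det = (N : ℤ) ^ 2 := by
  simp [form, det_succ_row_zero, Fin.sum_univ_succ, Fin.succAbove, submatrix]
  ring

section

variable {N m m' : ℕ} {M M' : IMat}

lemma isSim_one : IsSim N 1 1 := by simp [IsSim]

lemma IsSim.mul (h : IsSim N m M) (h' : IsSim N m' M') : IsSim N (m * m') (M * M') := by
  unfold IsSim at *
  calc (M * M')ᵀ * form N * (M * M') = M'ᵀ * (Mᵀ * form N * M) * M' := by
        rw [transpose_mul]; simp only [mul_assoc]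
    _ = _ := by
        rw [h, mul_smul_comm, smul_mul_assoc, h', smul_smul]; push_cast; rfl

lemma IsSim.of_mul_left (h : IsSim N m M) (hm : 0 < m) {K : IMat} {k : ℕ}
    (hK : IsSim N (m * k) (M * K)) : IsSim N k K := by
  have hm0 : (m : ℤ) ≠ 0 := by exact_mod_cast hm.ne'
  unfold IsSim at *
  have e : (M * K)ᵀ * form N * (M * K) = Kᵀ * (Mᵀ * form N * M) * K := by
    rw [transpose_mul]; simp only [mul_assoc]
  rw [e, h, mul_smul_comm, smul_mul_assoc, Nat.cast_mul, mul_smul] at hK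
  exact smul_right_injective _ hm0 hK

/-- The multiplier is quadratic in M. This is how a non-primitive similitude is replaced by one with
smaller multiplier. -/
lemma IsSim.of_smul {c : ℕ} (hc : 0 < c) (h : IsSim N m ((c : ℤ) • M)) (hm : 0 < m) :
    ∃ m', 0 < m' ∧ m = c ^ 2 * m' ∧ IsSim N m' M := by
  have hc0 : (c : ℤ) ^ 2 ≠ 0 := by positivity
  have h1 := (isSim_iff.1 h).1
  simp only [Matrix.smul_apply, smul_eq_mul] at h1
  obtain ⟨m', rfl⟩ : c ^ 2 ∣ m := by
    have : ((c ^ 2 : ℕ) : ℤ) ∣ m := by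
      rw [← h1]
      refine ⟨M 0 0 * M 2 2 - M 2 0 * M 0 2 + N * (M 1 0 * M 3 2 - M 3 0 * M 1 2), ?_⟩
      push_cast
      ring
    exact_mod_cast this
  refine ⟨m', Nat.pos_of_mul_pos_left hm, rfl, ?_⟩
  unfold IsSim at *
  rw [transpose_smul, smul_mul_assoc, smul_mul_assoc, mul_smul_comm, smul_smul, ← sq,
    Nat.cast_mul, mul_smul, Nat.cast_pow] at h
  exact smul_right_injective _ hc0 h

variable [NeZero N]

/-- Comparing determinants in the defining identity loses the sign; only the absolute value is
needed, for coprimality and cancellation. -/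
lemma IsSim.det_sq (h : IsSim N m M) : M.det ^ 2 = ((m : ℤ) ^ 2) ^ 2 := by
  have hN : (N : ℤ) ≠ 0 := by exact_mod_cast NeZero.ne N
  have := congrArg Matrix.det h
  rw [det_mul, det_mul, det_transpose, det_smul, det_form, Fintype.card_fin] at this
  have h2 : (N : ℤ) ^ 2 ≠ 0 := pow_ne_zero _ hN
  apply mul_right_cancel₀ h2
  linarith

lemma IsSim.det_natAbs (h : IsSim N m M) : M.det.natAbs = m ^ 2 := by
  have := Int.natAbs_eq_natAbs_iff.2 (sq_eq_sq_iff_eq_or_eq_neg.1 h.det_sq)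
  rw [this, Int.natAbs_pow, Int.natAbs_natCast]

lemma IsSim.det_ne_zero (h : IsSim N m M) (hm : 0 < m) : M.det ≠ 0 := by
  rw [← Int.natAbs_ne_zero, h.det_natAbs]
  positivity

lemma IsSim.of_mul_right (h : IsSim N m M) (hm : 0 < m) {K : IMat} {k : ℕ}
    (hK : IsSim N (k * m) (K * M)) : IsSim N k K := by
  unfold IsSim at *
  have e : (K * M)ᵀ * form N * (K * M) = Mᵀ * (Kᵀ * form N * K) * M := by
    rw [transpose_mul]; simp only [mul_assoc]
  rw [e, Nat.cast_mul, mul_smul, ← h] at hK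
  have hd := IsSim.det_ne_zero h hm
  apply mul_left_cancel_of_det_ne_zero (M := Mᵀ) (by rwa [det_transpose])
  apply mul_right_cancel_of_det_ne_zero hd
  rw [hK, mul_smul_comm, smul_mul_assoc]

/-- The rows of a similitude are compatible with the dual form. -/
lemma IsSim.dual (h : IsSim N m M) (hm : 0 < m) : M * dualForm N * Mᵀ = (m : ℤ) • dualForm N := by
  have hN : (N : ℤ) ≠ 0 := by exact_mod_cast NeZero.ne N
  -- The dual form is -N times the inverse of the form, so after multiplication by `form N * M` both
  -- sides become -mN M.
  apply mul_right_cancel_of_det_ne_zero (M := form N * M)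
    (by rw [det_mul, det_form]; exact mul_ne_zero (pow_ne_zero _ hN) (h.det_ne_zero hm))
  have : M * dualForm N * Mᵀ * (form N * M) = M * dualForm N * (Mᵀ * form N * M) := by
    simp only [mul_assoc]
  rw [this, h, mul_smul_comm, mul_assoc, dualForm_mul_form, smul_mul_assoc, ← mul_assoc,
    dualForm_mul_form]
  simp only [mul_smul_comm, smul_mul_assoc, one_mul, mul_one]

/-- The dual identity in coordinates: relations between rows, complementing the column relations of
`isSim_iff`. -/
lemma IsSim.row_eqs (h : IsSim N m M) (hm : 0 < m) :
    (N * (M 0 0 * M 2 2 - M 0 2 * M 2 0) + (M 0 1 * M 2 3 - M 0 3 * M 2 1) = m * N ∧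
    N * (M 1 0 * M 3 2 - M 1 2 * M 3 0) + (M 1 1 * M 3 3 - M 1 3 * M 3 1) = m ∧
    N * (M 0 0 * M 1 2 - M 0 2 * M 1 0) + (M 0 1 * M 1 3 - M 0 3 * M 1 1) = 0 ∧
    N * (M 0 0 * M 3 2 - M 0 2 * M 3 0) + (M 0 1 * M 3 3 - M 0 3 * M 3 1) = 0) := by
  have h := h.dual hm
  have e : ∀ i j, (M * dualForm N * Mᵀ) i j = ((m : ℤ) • dualForm N) i j := fun i j => by rw [h]
  simp only [Matrix.mul_apply, Fin.sum_univ_four, dualForm, transpose_apply, of_apply,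
    Matrix.smul_apply] at e
  have e02 := e 0 2
  have e13 := e 1 3
  have e01 := e 0 1
  have e03 := e 0 3
  simp at e02 e13 e01 e03
  refine ⟨?_, ?_, ?_, ?_⟩ <;> linarith

/-- The upper right blocks of integral isometries are divisible by `N`. -/
lemma IsSim.dvd {N : ℕ} {M : IMat} (h : IsSim N 1 M) :
    (N : ℤ) ∣ M 0 1 ∧ (N : ℤ) ∣ M 0 3 ∧ (N : ℤ) ∣ M 2 1 ∧ (N : ℤ) ∣ M 2 3 := by
  obtain ⟨h1, h2, h3, h4, h5, h6⟩ := isSim_iff.1 h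
  push_cast at h1
  set Y := M 1 0 * M 3 2 - M 3 0 * M 1 2
  set X3 := M 1 0 * M 3 1 - M 3 0 * M 1 1
  set X4 := M 1 0 * M 3 3 - M 3 0 * M 1 3
  set X5 := M 1 2 * M 3 1 - M 3 2 * M 1 1
  set X6 := M 1 2 * M 3 3 - M 3 2 * M 1 3
  -- Cramer's rule: rows 0, 2 and columns 0, 2 have minor 1 - N Y, and the other relations are
  -- linear equations for the entries in rows 0, 2 of columns 1 and 3 with right-hand sides
  -- divisible by N.
  refine ⟨⟨M 0 0 * X5 - M 0 2 * X3 + Y * M 0 1, ?_⟩, ⟨M 0 0 * X6 - M 0 2 * X4 + Y * M 0 3, ?_⟩,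
    ⟨M 2 0 * X5 - M 2 2 * X3 + Y * M 2 1, ?_⟩, ⟨M 2 0 * X6 - M 2 2 * X4 + Y * M 2 3, ?_⟩⟩
  · linear_combination -M 0 1 * h1 - M 0 0 * h5 + M 0 2 * h3
  · linear_combination -M 0 3 * h1 - M 0 0 * h6 + M 0 2 * h4
  · linear_combination -M 2 1 * h1 - M 2 0 * h5 + M 2 2 * h3
  · linear_combination -M 2 3 * h1 - M 2 0 * h6 + M 2 2 * h4

/-- The inverse of an integral isometry. -/
lemma IsSim.exists_inv (h : IsSim N 1 M) : ∃ M', M * M' = 1 ∧ M' * M = 1 ∧ IsSim N 1 M' := by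
  have hu : IsUnit M.det := by
    rw [Int.isUnit_iff_natAbs_eq, h.det_natAbs, one_pow]
  refine ⟨M⁻¹, mul_nonsing_inv _ hu, nonsing_inv_mul _ hu, ?_⟩
  refine h.of_mul_left one_pos ?_
  rw [mul_nonsing_inv _ hu]
  exact isSim_one

end

/-! ### Symplectic matrices and integral similitudes -/

/-- The real `4 × 4` block matrix `P M P⁻¹` with `P = diag(1, 1, 1, N)`. -/
def toReal (N : ℕ) (M : IMat) : Mat4 :=
  fromBlocks !![(M 0 0 : ℝ), M 0 1; M 1 0, M 1 1] !![(M 0 2 : ℝ), M 0 3 / N; M 1 2, M 1 3 / N]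
    !![(M 2 0 : ℝ), M 2 1; N * M 3 0, N * M 3 1] !![(M 2 2 : ℝ), M 2 3 / N; N * M 3 2, M 3 3]

section

variable {N : ℕ} [NeZero N] {m m' : ℕ} {M M' : IMat} {g g' : Sp2}

lemma toReal_mul (M M' : IMat) : toReal N (M * M') = toReal N M * toReal N M' := by
  have hN : (N : ℝ) ≠ 0 := NeZero.ne _
  unfold toReal
  rw [fromBlocks_multiply]
  congr 1 <;> ext i j <;> fin_cases i <;> fin_cases j <;>
    simp [Matrix.mul_apply, Fin.sum_univ_four] <;> field_simp <;> ring

omit [NeZero N] in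
lemma toReal_smul (c : ℤ) (M : IMat) : toReal N (c • M) = (c : ℝ) • toReal N M := by
  unfold toReal
  rw [fromBlocks_smul]
  congr 1 <;> ext i j <;> fin_cases i <;> fin_cases j <;> simp <;> ring

lemma toReal_injective : Function.Injective (toReal N) := by
  have hN : (N : ℝ) ≠ 0 := NeZero.ne _
  intro M M' h
  obtain ⟨h1, h2, h3, h4⟩ := fromBlocks_inj.1 h
  have e1 := fun i j => congrFun (congrFun h1 i) j
  have e2 := fun i j => congrFun (congrFun h2 i) j
  have e3 := fun i j => congrFun (congrFun h3 i) j
  have e4 := fun i j => congrFun (congrFun h4 i) j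
  simp [Fin.forall_fin_two, hN, div_left_inj'] at e1 e2 e3 e4
  ext i j
  fin_cases i <;> fin_cases j <;> simp [e1, e2, e3, e4]

omit [NeZero N] in
/-- The real matrix `P⁻¹ X P⁻¹` with `P = diag(1, 1, 1, N)`. -/
def formToReal (N : ℕ) (X : IMat) : Mat4 :=
  fromBlocks !![(X 0 0 : ℝ), X 0 1; X 1 0, X 1 1] !![(X 0 2 : ℝ), X 0 3 / N; X 1 2, X 1 3 / N]
    !![(X 2 0 : ℝ), X 2 1; X 3 0 / N, X 3 1 / N] !![(X 2 2 : ℝ), X 2 3 / N; X 3 2 / N, X 3 3 / N ^ 2]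

lemma formToReal_injective : Function.Injective (formToReal N) := by
  have hN : (N : ℝ) ≠ 0 := NeZero.ne _
  intro M M' h
  obtain ⟨h1, h2, h3, h4⟩ := fromBlocks_inj.1 h
  have e1 := fun i j => congrFun (congrFun h1 i) j
  have e2 := fun i j => congrFun (congrFun h2 i) j
  have e3 := fun i j => congrFun (congrFun h3 i) j
  have e4 := fun i j => congrFun (congrFun h4 i) j
  simp [Fin.forall_fin_two, hN, div_left_inj'] at e1 e2 e3 e4
  ext i j
  fin_cases i <;> fin_cases j <;> simp [e1, e2, e3, e4]

lemma formToReal_smul_form (m : ℕ) :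
    formToReal N ((m : ℤ) • form N) = (m : ℝ) • J (Fin 2) ℝ := by
  have hN : (N : ℝ) ≠ 0 := NeZero.ne _
  unfold formToReal J
  rw [fromBlocks_smul]
  congr 1 <;> ext i j <;> fin_cases i <;> fin_cases j <;> simp [form] <;> field_simp

/-- With P = diag(1, 1, 1, N) one has P J P = `form N`, so the P inside `toReal` changes J into the
form of type (1, N). -/
lemma toReal_transpose_mul_J_mul (M : IMat) :
    (toReal N M)ᵀ * J (Fin 2) ℝ * toReal N M = formToReal N (Mᵀ * form N * M) := by
  have hN : (N : ℝ) ≠ 0 := NeZero.ne _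
  unfold toReal formToReal J
  rw [fromBlocks_transpose, fromBlocks_multiply, fromBlocks_multiply]
  congr 1 <;> ext i j <;> fin_cases i <;> fin_cases j <;>
    simp [Matrix.mul_apply, Fin.sum_univ_four, form] <;> field_simp <;> ring

lemma toReal_mem_symplecticGroup_iff {c : ℝ} (hc : c ^ 2 * m = 1) (M : IMat) :
    c • toReal N M ∈ symplecticGroup (Fin 2) ℝ ↔ IsSim N m M := by
  have hc0 : c ^ 2 ≠ 0 := left_ne_zero_of_mul_eq_one hc
  have key : ((c • toReal N M)ᵀ * J (Fin 2) ℝ * (c • toReal N M)) =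
      c ^ 2 • formToReal N (Mᵀ * form N * M) := by
    rw [transpose_smul, smul_mul_assoc, smul_mul_assoc, mul_smul_comm, smul_smul, sq,
      toReal_transpose_mul_J_mul]
  have hJ : J (Fin 2) ℝ = c ^ 2 • formToReal N ((m : ℤ) • form N) := by
    rw [formToReal_smul_form, smul_smul, hc, one_smul]
  rw [SymplecticGroup.mem_iff', key]
  conv_lhs => rw [hJ]
  constructor
  · intro h
    exact formToReal_injective (smul_right_injective _ hc0 h)
  · intro h
    rw [h]

/-- `M` is an integral matrix representing the symplectic matrix `g = (1/√m) P M P⁻¹`. -/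
def Rep (N : ℕ) (g : Sp2) (M : IMat) (m : ℕ) : Prop :=
  0 < m ∧ (g : Mat4) = (1 / √(m : ℝ)) • toReal N M

omit [NeZero N] in
lemma one_div_sqrt_sq (hm : 0 < m) : (1 / √(m : ℝ)) ^ 2 * m = 1 := by
  have h1 : √(m : ℝ) ≠ 0 := by positivity
  have h2 : √(m : ℝ) ^ 2 = m := Real.sq_sqrt (Nat.cast_nonneg m)
  rw [div_pow, h2, one_pow]
  field_simp

lemma Rep.isSim (h : Rep N g M m) : IsSim N m M := by
  refine (toReal_mem_symplecticGroup_iff (one_div_sqrt_sq h.1) M).1 ?_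
  rw [← h.2]
  exact g.2

lemma exists_rep (hm : 0 < m) (h : IsSim N m M) : ∃ g, Rep N g M m :=
  ⟨⟨_, (toReal_mem_symplecticGroup_iff (one_div_sqrt_sq hm) M).2 h⟩, hm, rfl⟩

lemma Rep.mul (h : Rep N g M m) (h' : Rep N g' M' m') : Rep N (g * g') (M * M') (m * m') := by
  refine ⟨Nat.mul_pos h.1 h'.1, ?_⟩
  rw [Submonoid.coe_mul, h.2, h'.2, toReal_mul, Nat.cast_mul, Real.sqrt_mul (Nat.cast_nonneg m)]
  simp only [smul_mul_assoc, mul_smul_comm, smul_smul]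
  congr 1
  rw [one_div_mul_one_div, mul_comm]

omit [NeZero N] in
lemma Rep.eq (h : Rep N g M m) (h' : Rep N g' M m) : g = g' :=
  Subtype.ext (h.2.trans h'.2.symm)

lemma Rep.unique (h : Rep N g M m) (h' : Rep N g M' m) : M = M' := by
  have hm : (m : ℝ) ≠ 0 := by exact_mod_cast h.1.ne'
  have h1 : 1 / √(m : ℝ) ≠ 0 := by
    have := h.1
    positivity
  exact toReal_injective (smul_right_injective _ h1 (h.2.symm.trans h'.2))

omit [NeZero N] in
lemma rep_smul_iff {c : ℕ} (hc : 0 < c) : Rep N g ((c : ℤ) • M) (c ^ 2 * m) ↔ Rep N g M m := by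
  have e : (1 / √((c ^ 2 * m : ℕ) : ℝ)) • toReal N ((c : ℤ) • M)
      = (1 / √(m : ℝ)) • toReal N M := by
    have hc0 : (c : ℝ) ≠ 0 := by positivity
    rw [toReal_smul, smul_smul]
    congr 1
    push_cast
    rw [Real.sqrt_mul (by positivity), Real.sqrt_sq (by positivity)]
    rw [one_div, mul_inv, mul_comm (c : ℝ)⁻¹, mul_assoc, inv_mul_cancel₀ hc0]
    ring
  unfold Rep
  rw [e]
  exact and_congr_left fun _ => ⟨fun h => Nat.pos_of_mul_pos_left h, fun h => by positivity⟩

lemma rep_one : Rep N 1 1 1 := by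
  refine ⟨one_pos, ?_⟩
  have hN : (N : ℝ) ≠ 0 := NeZero.ne _
  have : toReal N 1 = 1 := by
    unfold toReal
    rw [← fromBlocks_one]
    congr 1 <;> ext i j <;> fin_cases i <;> fin_cases j <;> simp [hN]
  simp [this]

/-- After conjugation the prescribed shape is just integrality: the divisibilities by N in the
second and fourth columns hold for every integral isometry by `IsSim.dvd`. -/
lemma mem_paramodularGroup_iff : g ∈ paramodularGroup N ↔ ∃ K, Rep N g K 1 := by
  have hN : (N : ℝ) ≠ 0 := NeZero.ne _
  constructor
  · rintro ⟨a₁, a₂, a₃, a₄, b₁, b₂, b₃, b₄, c₁, c₂, c₃, c₄, d₁, d₂, d₃, d₄, h⟩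
    refine ⟨!![a₁, a₂ * N, b₁, b₂ * N; a₃, a₄, b₃, b₄; c₁, c₂ * N, d₁, d₂ * N; c₃, c₄, d₃, d₄],
      one_pos, ?_⟩
    rw [h]
    simp only [Nat.cast_one, Real.sqrt_one, div_one, one_smul, toReal]
    congr 1 <;> ext i j <;> fin_cases i <;> fin_cases j <;> simp <;> field_simp
  · rintro ⟨K, h⟩
    obtain ⟨⟨x, hx⟩, ⟨y, hy⟩, ⟨z, hz⟩, ⟨w, hw⟩⟩ := h.isSim.dvd
    refine ⟨K 0 0, x, K 1 0, K 1 1, K 0 2, y, K 1 2, K 1 3, K 2 0, z, K 3 0, K 3 1, K 2 2, w,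
      K 3 2, K 3 3, ?_⟩
    rw [h.2]
    simp only [Nat.cast_one, Real.sqrt_one, div_one, one_smul, toReal]
    congr 1 <;> ext i j <;> fin_cases i <;> fin_cases j <;> simp [hx, hy, hz, hw] <;>
      field_simp

/-- The multiplier is arbitrary, so the denominators introduced by P and P⁻¹ are cleared by a factor
N, and N² is absorbed in m. -/
lemma mem_rationalGroup_iff : g ∈ rationalGroup ↔ ∃ M m, Rep N g M m := by
  have hN : (N : ℝ) ≠ 0 := NeZero.ne _
  have hNpos : 0 < N := NeZero.pos N
  constructor
  · rintro ⟨m, hm, X, h⟩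
    refine ⟨!![N * X (.inl 0) (.inl 0), N * X (.inl 0) (.inl 1), N * X (.inl 0) (.inr 0),
        N * N * X (.inl 0) (.inr 1);
      N * X (.inl 1) (.inl 0), N * X (.inl 1) (.inl 1), N * X (.inl 1) (.inr 0),
        N * N * X (.inl 1) (.inr 1);
      N * X (.inr 0) (.inl 0), N * X (.inr 0) (.inl 1), N * X (.inr 0) (.inr 0),
        N * N * X (.inr 0) (.inr 1);
      X (.inr 1) (.inl 0), X (.inr 1) (.inl 1), X (.inr 1) (.inr 0), N * X (.inr 1) (.inr 1)],
      N ^ 2 * m, by positivity, ?_⟩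
    rw [h]
    push_cast
    rw [Real.sqrt_mul (by positivity), Real.sqrt_sq (by positivity)]
    have h1 : √(m : ℝ) ≠ 0 := by positivity
    ext i j
    rcases i with i | i <;> rcases j with j | j <;> fin_cases i <;> fin_cases j <;>
      simp [toReal] <;> field_simp
  · rintro ⟨M, m, hm, h⟩
    refine ⟨N ^ 2 * m, by positivity, fromBlocks !![N * M 0 0, N * M 0 1; N * M 1 0, N * M 1 1]
      !![N * M 0 2, M 0 3; N * M 1 2, M 1 3]
      !![N * M 2 0, N * M 2 1; N * N * M 3 0, N * N * M 3 1]
      !![N * M 2 2, M 2 3; N * N * M 3 2, N * M 3 3], ?_⟩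
    rw [h]
    push_cast
    rw [Real.sqrt_mul (by positivity), Real.sqrt_sq (by positivity)]
    have h1 : √(m : ℝ) ≠ 0 := by positivity
    ext i j
    rcases i with i | i <;> rcases j with j | j <;> fin_cases i <;> fin_cases j <;>
      simp [toReal] <;> field_simp

/-! ### Double cosets of integral similitudes -/

open Classical in
/-- The double coset of the symplectic matrix represented by an integral similitude `M` with
multiplier `m` (and `0` if there is none). -/
def simCoset (N : ℕ) [NeZero N] (m : ℕ) (M : IMat) : HeckeAlgebra N :=
  if h : ∃ g, Rep N g M m then doubleCoset N ⟨h.choose, mem_rationalGroup_iff.2 ⟨M, m, h.choose_spec⟩⟩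
  else 0

lemma simCoset_eq {g : rationalGroup} (h : Rep N (g : Sp2) M m) :
    simCoset N m M = doubleCoset N g := by
  have hex : ∃ g, Rep N g M m := ⟨_, h⟩
  rw [simCoset, dif_pos hex]
  congr 1
  exact Subtype.ext (hex.choose_spec.eq h)

end

/-- Two matrices are equivalent if they differ by integral isometries on both sides. -/
def Equivalent (N : ℕ) (M X : IMat) : Prop :=
  ∃ K K' : IMat, IsSim N 1 K ∧ IsSim N 1 K' ∧ X = K * M * K'

section

variable {N : ℕ} [NeZero N] {m m' m₁ m₂ : ℕ} {M M' M₁ M₂ X Y K K' : IMat} {g g' : Sp2}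

omit [NeZero N] in
lemma Equivalent.refl (M : IMat) : Equivalent N M M :=
  ⟨1, 1, isSim_one, isSim_one, by simp⟩

lemma Equivalent.symm (h : Equivalent N M X) : Equivalent N X M := by
  obtain ⟨K, K', hK, hK', rfl⟩ := h
  obtain ⟨L, h1, h2, h3⟩ := hK.exists_inv
  obtain ⟨L', h1', h2', h3'⟩ := hK'.exists_inv
  refine ⟨L, L', h3, h3', ?_⟩
  calc M = (L * K) * M * (K' * L') := by rw [h2, h1']; simp
    _ = _ := by simp only [mul_assoc]

omit [NeZero N] in
lemma IsSim.mul_isometry (hM : IsSim N m M) (hK : IsSim N 1 K) : IsSim N m (M * K) := by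
  simpa using hM.mul hK

omit [NeZero N] in
lemma IsSim.isometry_mul (hM : IsSim N m M) (hK : IsSim N 1 K) : IsSim N m (K * M) := by
  simpa using hK.mul hM

omit [NeZero N] in
lemma Equivalent.trans (h : Equivalent N M X) (h' : Equivalent N X Y) : Equivalent N M Y := by
  obtain ⟨K, K', hK, hK', rfl⟩ := h
  obtain ⟨L, L', hL, hL', rfl⟩ := h'
  exact ⟨L * K, K' * L', hK.isometry_mul hL, hK'.mul_isometry hL', by simp only [mul_assoc]⟩

omit [NeZero N] in
lemma Equivalent.isSim (h : Equivalent N M X) (hM : IsSim N m M) : IsSim N m X := by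
  obtain ⟨K, K', hK, hK', rfl⟩ := h
  exact (hM.isometry_mul hK).mul_isometry hK'

omit [NeZero N] in
lemma equivalent_mul_left (hK : IsSim N 1 K) (M : IMat) : Equivalent N M (K * M) :=
  ⟨K, 1, hK, isSim_one, by simp⟩

omit [NeZero N] in
lemma equivalent_mul_right (hK : IsSim N 1 K) (M : IMat) : Equivalent N M (M * K) :=
  ⟨1, K, isSim_one, hK, by simp⟩

lemma Rep.inDoubleCoset_iff (h : Rep N g M m) (h' : Rep N g' M' m) :
    InDoubleCoset (paramodularGroup N) g g' ↔ Equivalent N M M' := by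
  constructor
  · rintro ⟨a, ha, b, hb, rfl⟩
    obtain ⟨K, hK⟩ := mem_paramodularGroup_iff.1 ha
    obtain ⟨L, hL⟩ := mem_paramodularGroup_iff.1 hb
    refine ⟨K, L, hK.isSim, hL.isSim, h'.unique ?_⟩
    simpa using (hK.mul h).mul hL
  · rintro ⟨K, L, hK, hL, rfl⟩
    obtain ⟨a, ha⟩ := exists_rep one_pos hK
    obtain ⟨b, hb⟩ := exists_rep one_pos hL
    refine ⟨a, mem_paramodularGroup_iff.2 ⟨K, ha⟩, b, mem_paramodularGroup_iff.2 ⟨L, hb⟩, ?_⟩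
    refine h'.eq ?_
    simpa using (ha.mul h).mul hb

lemma InDoubleCoset.exists_rep (h : Rep N g M m)
    (h' : InDoubleCoset (paramodularGroup N) g g') : ∃ M', Equivalent N M M' ∧ Rep N g' M' m := by
  obtain ⟨a, ha, b, hb, rfl⟩ := h'
  obtain ⟨K, hK⟩ := mem_paramodularGroup_iff.1 ha
  obtain ⟨L, hL⟩ := mem_paramodularGroup_iff.1 hb
  exact ⟨_, ⟨K, L, hK.isSim, hL.isSim, rfl⟩, by simpa using (hK.mul h).mul hL⟩

lemma exists_rational_rep (hm : 0 < m) (h : IsSim N m M) :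
    ∃ g : rationalGroup, Rep N (g : Sp2) M m := by
  obtain ⟨g, hg⟩ := exists_rep hm h
  exact ⟨⟨g, mem_rationalGroup_iff.2 ⟨M, m, hg⟩⟩, hg⟩

lemma simCoset_eq_of_equivalent (hm : 0 < m) (hM : IsSim N m M) (h : Equivalent N M M') :
    simCoset N m M = simCoset N m M' := by
  obtain ⟨g, hg⟩ := exists_rational_rep hm hM
  obtain ⟨g', hg'⟩ := exists_rational_rep hm (h.isSim hM)
  rw [simCoset_eq hg, simCoset_eq hg']
  exact single_eq_single ((hg.inDoubleCoset_iff hg').2 h)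

lemma simCoset_smul (hm : 0 < m) (hM : IsSim N m M) {c : ℕ} (hc : 0 < c) :
    simCoset N (c ^ 2 * m) ((c : ℤ) • M) = simCoset N m M := by
  obtain ⟨g, hg⟩ := exists_rational_rep hm hM
  rw [simCoset_eq hg, simCoset_eq ((rep_smul_iff hc).2 hg)]

lemma exists_isometry_of_mul_inv_mem (h : Rep N g M m) (h' : Rep N g' M' m)
    (hK : IsSim N 1 K) (e : M' = K * M) : g' * g⁻¹ ∈ paramodularGroup N := by
  obtain ⟨k, hk⟩ := Paramodular.exists_rep one_pos hK
  have : g' = k * g := by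
    refine h'.eq ?_
    rw [e]
    simpa using hk.mul h
  rw [this, mul_inv_cancel_right]
  exact mem_paramodularGroup_iff.2 ⟨K, hk⟩

/-- The double coset of `M₁ M₂` lies in a subring containing those of `M₁` and `M₂`, if the other
double cosets in the product do and the one of `M₁ M₂` occurs with multiplicity one. -/
theorem simCoset_mul_mem (S : Subring (HeckeAlgebra N)) (h₁ : 0 < m₁) (h₂ : 0 < m₂)
    (hM₁ : IsSim N m₁ M₁) (hM₂ : IsSim N m₂ M₂)
    (hS₁ : simCoset N m₁ M₁ ∈ S) (hS₂ : simCoset N m₂ M₂ ∈ S)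
    (hother : ∀ K, IsSim N 1 K → Equivalent N (M₁ * M₂) (M₁ * K * M₂) ∨
      simCoset N (m₁ * m₂) (M₁ * K * M₂) ∈ S)
    (huniq : ∀ X Y, Equivalent N M₁ X → Equivalent N M₂ Y → X * Y = M₁ * M₂ →
      ∃ K, IsSim N 1 K ∧ Y = K * M₂) :
    simCoset N (m₁ * m₂) (M₁ * M₂) ∈ S := by
  obtain ⟨g, hg⟩ := exists_rational_rep h₁ hM₁
  obtain ⟨y, hy⟩ := exists_rational_rep h₂ hM₂
  have hgy : Rep N ((g * y : rationalGroup) : Sp2) (M₁ * M₂) (m₁ * m₂) := hg.mul hy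
  rw [simCoset_eq hg] at hS₁
  rw [simCoset_eq hy] at hS₂
  rw [simCoset_eq hgy]
  refine single_mul_mem S (g := ⟨g.1, g.2⟩) (y := ⟨y.1, y.2⟩) hS₁ hS₂ ?_ ?_
  · intro k hk
    obtain ⟨K, hK⟩ := mem_paramodularGroup_iff.1 hk
    have hgky : Rep N ((g * ⟨k.1, k.2⟩ * y : rationalGroup) : Sp2) (M₁ * K * M₂) (m₁ * m₂) := by
      simpa using (hg.mul hK).mul hy
    rcases hother K hK.isSim with h | h
    · exact Or.inl ((hgy.inDoubleCoset_iff hgky).2 h)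
    · right
      rw [simCoset_eq hgky] at h
      exact h
  · intro g' y' hg' hy' e
    obtain ⟨X, hX, hX'⟩ := InDoubleCoset.exists_rep hg hg'
    obtain ⟨Y, hY, hY'⟩ := InDoubleCoset.exists_rep hy hy'
    have hXY := hX'.mul hY'
    rw [e] at hXY
    obtain ⟨K, hK, e2⟩ := huniq X Y hX hY (hXY.unique hgy)
    exact exists_isometry_of_mul_inv_mem hy hY' hK e2

/-- If the product of two double cosets is one double coset, with multiplicity one. -/
theorem simCoset_mul_simCoset (h₁ : 0 < m₁) (h₂ : 0 < m₂)
    (hM₁ : IsSim N m₁ M₁) (hM₂ : IsSim N m₂ M₂)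
    (hother : ∀ K, IsSim N 1 K → Equivalent N (M₁ * M₂) (M₁ * K * M₂))
    (huniq : ∀ X Y, Equivalent N M₁ X → Equivalent N M₂ Y → X * Y = M₁ * M₂ →
      ∃ K, IsSim N 1 K ∧ Y = K * M₂) :
    simCoset N m₁ M₁ * simCoset N m₂ M₂ = simCoset N (m₁ * m₂) (M₁ * M₂) := by
  obtain ⟨g, hg⟩ := exists_rational_rep h₁ hM₁
  obtain ⟨y, hy⟩ := exists_rational_rep h₂ hM₂
  have hgy : Rep N ((g * y : rationalGroup) : Sp2) (M₁ * M₂) (m₁ * m₂) := hg.mul hy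
  rw [simCoset_eq hg, simCoset_eq hy, simCoset_eq hgy]
  refine single_mul_single (g := ⟨g.1, g.2⟩) (y := ⟨y.1, y.2⟩) ?_ ?_
  · intro k hk
    obtain ⟨K, hK⟩ := mem_paramodularGroup_iff.1 hk
    have hgky : Rep N ((g : Sp2) * k * y) (M₁ * K * M₂) (m₁ * m₂) := by
      simpa using (hg.mul hK).mul hy
    exact (hgy.inDoubleCoset_iff hgky).2 (hother K hK.isSim)
  · intro g' y' hg' hy' e
    obtain ⟨X, hX, hX'⟩ := InDoubleCoset.exists_rep hg hg'
    obtain ⟨Y, hY, hY'⟩ := InDoubleCoset.exists_rep hy hy'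
    have hXY := hX'.mul hY'
    rw [e] at hXY
    obtain ⟨K, hK, e2⟩ := huniq X Y hX hY (hXY.unique hgy)
    exact exists_isometry_of_mul_inv_mem hy hY' hK e2

lemma simCoset_eq_one (hK : IsSim N 1 K) : simCoset N 1 K = 1 := by
  rw [simCoset_eq_of_equivalent one_pos hK (M' := 1) (Equivalent.symm ?_),
    simCoset_eq (g := 1) rep_one]
  · rfl
  · simpa using equivalent_mul_left hK 1

/-! ### Coprime multipliers -/

/-- The matrix K = Y M₂⁻¹ = X⁻¹ M₁ has denominators dividing both det M₂ and det X. These are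
coprime, so K is integral. -/
lemma exists_isometry_mul_of_coprime (h₂ : 0 < m₂) (hco : m₁.Coprime m₂)
    (hX : IsSim N m₁ X) (hY : IsSim N m₂ Y) (hM₂ : IsSim N m₂ M₂)
    (e : X * Y = M₁ * M₂) : ∃ K, IsSim N 1 K ∧ Y = K * M₂ := by
  have hd : IsCoprime X.det M₂.det := by
    rw [Int.isCoprime_iff_gcd_eq_one, Int.gcd, hX.det_natAbs, hM₂.det_natAbs]
    exact Nat.Coprime.pow 2 2 hco
  have e2 : X.det • (Y * M₂.adjugate) = M₂.det • (X.adjugate * M₁) := by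
    have : X.adjugate * (X * Y) * M₂.adjugate = X.adjugate * (M₁ * M₂) * M₂.adjugate := by rw [e]
    rw [← mul_assoc, adjugate_mul, mul_assoc X.adjugate, mul_assoc M₁, mul_adjugate] at this
    simpa only [smul_mul_assoc, one_mul, mul_smul_comm, mul_one] using this
  have hdvd : ∀ i j, ∃ k, (Y * M₂.adjugate) i j = M₂.det * k := fun i j => by
    have := congrFun (congrFun e2 i) j
    simp only [Matrix.smul_apply, smul_eq_mul] at this
    exact hd.symm.dvd_of_dvd_mul_left ⟨_, this⟩
  choose k hk using hdvd
  have hK : Y * M₂.adjugate = M₂.det • Matrix.of k := by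
    ext i j
    simp [hk]
  have hY2 : Y = Matrix.of k * M₂ := by
    have h3 : Y * M₂.adjugate * M₂ = M₂.det • (Matrix.of k * M₂) := by rw [hK, smul_mul_assoc]
    rw [mul_assoc, adjugate_mul, mul_smul_comm, mul_one] at h3
    exact smul_right_injective _ (hM₂.det_ne_zero h₂) h3
  refine ⟨_, hM₂.of_mul_right h₂ ?_, hY2⟩
  rwa [one_mul, ← hY2]

end

/-! ### Elementary isometries and strong approximation -/

/-- The embedding of `2 × 2` matrices in the coordinate plane `(0, 2)`. -/
def planeEven (A : Matrix (Fin 2) (Fin 2) ℤ) : IMat :=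
  !![A 0 0, 0, A 0 1, 0; 0, 1, 0, 0; A 1 0, 0, A 1 1, 0; 0, 0, 0, 1]

/-- The embedding of `2 × 2` matrices in the coordinate plane `(1, 3)`. -/
def planeOdd (A : Matrix (Fin 2) (Fin 2) ℤ) : IMat :=
  !![1, 0, 0, 0; 0, A 0 0, 0, A 0 1; 0, 0, 1, 0; 0, A 1 0, 0, A 1 1]

/-- Elementary isometry mixing the two coordinate planes: `e₀ ↦ e₀ + r e₁`. -/
def lowerLevi (N : ℕ) (r : ℤ) : IMat :=
  !![1, 0, 0, 0; r, 1, 0, 0; 0, 0, 1, -(N * r); 0, 0, 0, 1]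

/-- Elementary isometry mixing the two coordinate planes: `e₀ ↦ e₀ + r e₃`. -/
def lowerMixed (N : ℕ) (r : ℤ) : IMat :=
  !![1, 0, 0, 0; 0, 1, 0, 0; 0, N * r, 1, 0; r, 0, 0, 1]

/-- Elementary isometry mixing the two coordinate planes: `e₂ ↦ e₂ + r e₁`. -/
def upperMixed (N : ℕ) (r : ℤ) : IMat :=
  !![1, 0, 0, N * r; 0, 1, r, 0; 0, 0, 1, 0; 0, 0, 0, 1]

/-- Elementary isometry mixing the two coordinate planes: `e₂ ↦ e₂ + r e₃`. -/
def upperLevi (N : ℕ) (r : ℤ) : IMat :=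
  !![1, -(N * r), 0, 0; 0, 1, 0, 0; 0, 0, 1, 0; 0, 0, r, 1]

section

variable {N : ℕ} {K L L' : IMat}

lemma planeEven_mul (A B : Matrix (Fin 2) (Fin 2) ℤ) :
    planeEven (A * B) = planeEven A * planeEven B := by
  ext i j
  fin_cases i <;> fin_cases j <;> simp [planeEven, Matrix.mul_apply, Fin.sum_univ_four]

lemma planeOdd_mul (A B : Matrix (Fin 2) (Fin 2) ℤ) :
    planeOdd (A * B) = planeOdd A * planeOdd B := by
  ext i j
  fin_cases i <;> fin_cases j <;> simp [planeOdd, Matrix.mul_apply, Fin.sum_univ_four]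

lemma planeEven_one : planeEven 1 = 1 := by
  ext i j
  fin_cases i <;> fin_cases j <;> simp [planeEven]

lemma planeOdd_one : planeOdd 1 = 1 := by
  ext i j
  fin_cases i <;> fin_cases j <;> simp [planeOdd]

lemma isSim_planeEven {A : Matrix (Fin 2) (Fin 2) ℤ} (h : A.det = 1) :
    IsSim N 1 (planeEven A) := by
  rw [det_fin_two] at h
  rw [isSim_iff]
  simp [planeEven]
  linarith

lemma isSim_planeOdd {A : Matrix (Fin 2) (Fin 2) ℤ} (h : A.det = 1) :
    IsSim N 1 (planeOdd A) := by
  rw [det_fin_two] at h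
  rw [isSim_iff]
  simp [planeOdd]
  linear_combination (N : ℤ) * h

lemma isSim_lowerLevi (r : ℤ) : IsSim N 1 (lowerLevi N r) := by
  rw [isSim_iff]
  simp [lowerLevi]

lemma isSim_lowerMixed (r : ℤ) : IsSim N 1 (lowerMixed N r) := by
  rw [isSim_iff]
  simp [lowerMixed]

lemma isSim_upperMixed (r : ℤ) : IsSim N 1 (upperMixed N r) := by
  rw [isSim_iff]
  simp [upperMixed]

lemma isSim_upperLevi (r : ℤ) : IsSim N 1 (upperLevi N r) := by
  rw [isSim_iff]
  simp [upperLevi]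

/-- Isometries that can be approximated modulo `a` by isometries trivial modulo a coprime `b`. -/
def Approximable (N : ℕ) (K : IMat) : Prop :=
  ∀ a b : ℤ, IsCoprime a b →
    ∃ H X Y : IMat, IsSim N 1 H ∧ H = K + a • X ∧ H = 1 + b • Y

lemma Approximable.mul (hK : Approximable N K) (hL : Approximable N L) :
    Approximable N (K * L) := by
  intro a b hab
  obtain ⟨H, X, Y, hH, h1, h2⟩ := hK a b hab
  obtain ⟨H', X', Y', hH', h1', h2'⟩ := hL a b hab
  refine ⟨H * H', X * L + K * X' + a • (X * X'), Y + Y' + b • (Y * Y'), hH'.isometry_mul hH,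
    ?_, ?_⟩
  · rw [h1, h1']
    simp only [mul_add, add_mul, smul_mul_assoc, mul_smul_comm, smul_add]
    abel
  · rw [h2, h2']
    simp only [mul_add, add_mul, smul_mul_assoc, mul_smul_comm, smul_add, mul_one, one_mul]
    abel

lemma approximable_of_isSim {E : ℤ → IMat} (hE : ∀ r i j, E r i j = (1 : IMat) i j
    + r * (E 1 i j - (1 : IMat) i j)) (h : ∀ r : ℤ, IsSim N 1 (E r)) (r : ℤ) :
    Approximable N (E r) := by
  rintro a b ⟨u, v, huv⟩
  -- Chinese remainder for the parameter: from u a + v b = 1, the number b v r is r modulo a and 0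
  -- modulo b. As E is affine in r, the congruences pass to matrices.
  refine ⟨E (b * (v * r)), (-u * r) • (E 1 - 1), (v * r) • (E 1 - 1), h _, ?_, ?_⟩
  · ext i j
    simp only [Matrix.add_apply, Matrix.smul_apply, Matrix.sub_apply, smul_eq_mul]
    rw [hE, hE r i j]
    linear_combination r * (E 1 i j - (1 : IMat) i j) * huv
  · ext i j
    simp only [Matrix.add_apply, Matrix.smul_apply, Matrix.sub_apply, smul_eq_mul]
    rw [hE]
    ring

lemma approximable_planeEven_upper (r : ℤ) : Approximable N (planeEven !![1, r; 0, 1]) := by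
  refine approximable_of_isSim (E := fun r => planeEven !![1, r; 0, 1]) (fun r i j => ?_) (fun s => ?_) r
  · fin_cases i <;> fin_cases j <;> simp [planeEven]
  · exact isSim_planeEven (by simp [det_fin_two])

lemma approximable_planeEven_lower (r : ℤ) : Approximable N (planeEven !![1, 0; r, 1]) := by
  refine approximable_of_isSim (E := fun r => planeEven !![1, 0; r, 1]) (fun r i j => ?_) (fun s => ?_) r
  · fin_cases i <;> fin_cases j <;> simp [planeEven]
  · exact isSim_planeEven (by simp [det_fin_two])

lemma approximable_planeOdd_upper (r : ℤ) : Approximable N (planeOdd !![1, r; 0, 1]) := by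
  refine approximable_of_isSim (E := fun r => planeOdd !![1, r; 0, 1]) (fun r i j => ?_) (fun s => ?_) r
  · fin_cases i <;> fin_cases j <;> simp [planeOdd]
  · exact isSim_planeOdd (by simp [det_fin_two])

lemma approximable_planeOdd_lower (r : ℤ) : Approximable N (planeOdd !![1, 0; r, 1]) := by
  refine approximable_of_isSim (E := fun r => planeOdd !![1, 0; r, 1]) (fun r i j => ?_) (fun s => ?_) r
  · fin_cases i <;> fin_cases j <;> simp [planeOdd]
  · exact isSim_planeOdd (by simp [det_fin_two])

lemma approximable_lowerLevi (r : ℤ) : Approximable N (lowerLevi N r) := by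
  refine approximable_of_isSim (E := fun r => lowerLevi N r) (fun r i j => ?_) (fun s => ?_) r
  · fin_cases i <;> fin_cases j <;> simp [lowerLevi, mul_comm]
  · exact isSim_lowerLevi _

lemma approximable_lowerMixed (r : ℤ) : Approximable N (lowerMixed N r) := by
  refine approximable_of_isSim (E := fun r => lowerMixed N r) (fun r i j => ?_) (fun s => ?_) r
  · fin_cases i <;> fin_cases j <;> simp [lowerMixed, mul_comm]
  · exact isSim_lowerMixed _

lemma approximable_upperLevi (r : ℤ) : Approximable N (upperLevi N r) := by
  refine approximable_of_isSim (E := fun r => upperLevi N r) (fun r i j => ?_) (fun s => ?_) r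
  · fin_cases i <;> fin_cases j <;> simp [upperLevi, mul_comm]
  · exact isSim_upperLevi _

lemma approximable_upperMixed (r : ℤ) : Approximable N (upperMixed N r) := by
  refine approximable_of_isSim (E := fun r => upperMixed N r) (fun r i j => ?_) (fun s => ?_) r
  · fin_cases i <;> fin_cases j <;> simp [upperMixed, mul_comm]
  · exact isSim_upperMixed _

open ModularGroup in
/-- A multiplicative property of the elementary matrices holds on `SL(2, ℤ)`. -/
lemma SL2_induction {p : Matrix (Fin 2) (Fin 2) ℤ → Prop} (hmul : ∀ A B, p A → p B → p (A * B))
    (hupper : ∀ r : ℤ, p !![1, r; 0, 1]) (hlower : ∀ r : ℤ, p !![1, 0; r, 1])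
    {A : Matrix (Fin 2) (Fin 2) ℤ} (hA : A.det = 1) : p A := by
  have hS : p !![0, -1; 1, 0] := by
    have := hmul _ _ (hmul _ _ (hupper (-1)) (hlower 1)) (hupper (-1))
    simpa [Matrix.mul_fin_two] using this
  have hS' : p !![0, 1; -1, 0] := by
    have := hmul _ _ (hmul _ _ (hupper 1) (hlower (-1))) (hupper 1)
    simpa [Matrix.mul_fin_two] using this
  -- Stability of `p` under inverses is not assumed, so the induction carries B and its inverse
  -- together.
  suffices h : ∀ B : SpecialLinearGroup (Fin 2) ℤ, p B.1 ∧ p (B⁻¹).1 from (h ⟨A, hA⟩).1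
  intro B
  have hB : B ∈ Subgroup.closure {S, T} := by rw [SpecialLinearGroup.SL2Z_generators]; trivial
  induction hB using Subgroup.closure_induction with
  | mem x hx =>
    rcases hx with rfl | rfl
    · refine ⟨hS, ?_⟩
      rw [SpecialLinearGroup.SL2_inv_expl]
      convert hS' using 1
      ext i j
      fin_cases i <;> fin_cases j <;> simp [S]
    · refine ⟨hupper 1, ?_⟩
      rw [SpecialLinearGroup.SL2_inv_expl]
      convert hupper (-1) using 1
      ext i j
      fin_cases i <;> fin_cases j <;> simp [T]
  | one =>
    have := hupper 0
    have e : (!![1, 0; 0, 1] : Matrix (Fin 2) (Fin 2) ℤ) = 1 := by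
      rw [one_fin_two]
    rw [e] at this
    simpa using this
  | mul x y _ _ hx hy =>
    rw [_root_.mul_inv_rev]
    exact ⟨hmul _ _ hx.1 hy.1, hmul _ _ hy.2 hx.2⟩
  | inv x _ hx =>
    rw [inv_inv]
    exact hx.symm

lemma approximable_planeEven {A : Matrix (Fin 2) (Fin 2) ℤ} (h : A.det = 1) :
    Approximable N (planeEven A) :=
  SL2_induction (p := fun A => Approximable N (planeEven A))
    (fun A B hA hB => by rw [planeEven_mul]; exact hA.mul hB)
    approximable_planeEven_upper approximable_planeEven_lower h

lemma approximable_planeOdd {A : Matrix (Fin 2) (Fin 2) ℤ} (h : A.det = 1) :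
    Approximable N (planeOdd A) :=
  SL2_induction (p := fun A => Approximable N (planeOdd A))
    (fun A B hA hB => by rw [planeOdd_mul]; exact hA.mul hB)
    approximable_planeOdd_upper approximable_planeOdd_lower h

lemma Approximable.of_mul (hL : Approximable N L') (e : L' * L = 1)
    (h : Approximable N (L * K)) : Approximable N K := by
  have := hL.mul h
  rwa [← mul_assoc, e, one_mul] at this

/-- Bézout coefficients of the primitive vector (a, c)/gcd form the first row of A, and the vector
orthogonal to it the second. The pair (0, 0) needs only the identity. -/
lemma exists_SL2_zero (a c : ℤ) : ∃ A B : Matrix (Fin 2) (Fin 2) ℤ, A.det = 1 ∧ B.det = 1 ∧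
    B * A = 1 ∧ A 1 0 * a + A 1 1 * c = 0 ∧ (IsCoprime a c → A 0 0 * a + A 0 1 * c = 1) := by
  by_cases h : a = 0 ∧ c = 0
  · obtain ⟨rfl, rfl⟩ := h
    refine ⟨1, 1, det_one, det_one, one_mul 1, by simp, fun h => ?_⟩
    exact absurd h not_isCoprime_zero_zero
  · have hg : Int.gcd a c ≠ 0 := by
      rw [ne_eq, Int.gcd_eq_zero_iff]
      exact h
    have hg' : 0 < Int.gcd a c := Nat.pos_of_ne_zero hg
    obtain ⟨a', c', hco, ha, hc⟩ := Int.exists_gcd_one hg'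
    obtain ⟨u, w, huw⟩ := Int.isCoprime_iff_gcd_eq_one.2 hco
    refine ⟨!![u, w; -c', a'], !![a', -w; c', u], ?_, ?_, ?_, ?_, ?_⟩
    · rw [det_fin_two_of]; linarith
    · rw [det_fin_two_of]; linarith
    · rw [Matrix.mul_fin_two, one_fin_two]
      congr 1
      ext i j
      fin_cases i <;> fin_cases j <;> simp <;> linarith
    · change -c' * a + a' * c = 0
      linear_combination -c' * ha + a' * hc
    · intro h1
      have h2 := Int.isCoprime_iff_gcd_eq_one.1 h1
      rw [h2] at ha hc
      change u * a + w * c = 1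
      push_cast at ha hc
      linear_combination u * ha + w * hc + huw

end

/-! ### Row reduction of isometries -/

section

variable {N : ℕ}

lemma planeEven_mul_planeEven {A B : Matrix (Fin 2) (Fin 2) ℤ} (h : A * B = 1) :
    planeEven A * planeEven B = 1 := by
  rw [← planeEven_mul, h, planeEven_one]

lemma planeOdd_mul_planeOdd {A B : Matrix (Fin 2) (Fin 2) ℤ} (h : A * B = 1) :
    planeOdd A * planeOdd B = 1 := by
  rw [← planeOdd_mul, h, planeOdd_one]

lemma lowerLevi_mul_neg (r : ℤ) : lowerLevi N r * lowerLevi N (-r) = 1 := by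
  ext i j
  fin_cases i <;> fin_cases j <;> simp [lowerLevi, Matrix.mul_apply, Fin.sum_univ_four]

lemma lowerMixed_mul_neg (r : ℤ) : lowerMixed N r * lowerMixed N (-r) = 1 := by
  ext i j
  fin_cases i <;> fin_cases j <;> simp [lowerMixed, Matrix.mul_apply, Fin.sum_univ_four]

lemma upperLevi_mul_neg (r : ℤ) : upperLevi N r * upperLevi N (-r) = 1 := by
  ext i j
  fin_cases i <;> fin_cases j <;> simp [upperLevi, Matrix.mul_apply, Fin.sum_univ_four]

lemma upperMixed_mul_neg (r : ℤ) : upperMixed N r * upperMixed N (-r) = 1 := by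
  ext i j
  fin_cases i <;> fin_cases j <;> simp [upperMixed, Matrix.mul_apply, Fin.sum_univ_four]

lemma planeEven_mul_apply (A : Matrix (Fin 2) (Fin 2) ℤ) (K : IMat) (j : Fin 4) :
    (planeEven A * K) 0 j = A 0 0 * K 0 j + A 0 1 * K 2 j ∧
    (planeEven A * K) 1 j = K 1 j ∧
    (planeEven A * K) 2 j = A 1 0 * K 0 j + A 1 1 * K 2 j ∧
    (planeEven A * K) 3 j = K 3 j := by
  simp only [planeEven, Matrix.mul_apply, Fin.sum_univ_four, of_apply, cons_val', cons_val_zero,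
    cons_val_one, cons_val]
  refine ⟨?_, ?_, ?_, ?_⟩ <;> ring

lemma planeOdd_mul_apply (A : Matrix (Fin 2) (Fin 2) ℤ) (K : IMat) (j : Fin 4) :
    (planeOdd A * K) 0 j = K 0 j ∧
    (planeOdd A * K) 1 j = A 0 0 * K 1 j + A 0 1 * K 3 j ∧
    (planeOdd A * K) 2 j = K 2 j ∧
    (planeOdd A * K) 3 j = A 1 0 * K 1 j + A 1 1 * K 3 j := by
  simp only [planeOdd, Matrix.mul_apply, Fin.sum_univ_four, of_apply, cons_val', cons_val_zero,
    cons_val_one, cons_val]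
  refine ⟨?_, ?_, ?_, ?_⟩ <;> ring

lemma lowerLevi_mul_apply (r : ℤ) (K : IMat) (j : Fin 4) :
    (lowerLevi N r * K) 0 j = K 0 j ∧
    (lowerLevi N r * K) 1 j = r * K 0 j + K 1 j ∧
    (lowerLevi N r * K) 2 j = K 2 j - N * r * K 3 j ∧
    (lowerLevi N r * K) 3 j = K 3 j := by
  simp only [lowerLevi, Matrix.mul_apply, Fin.sum_univ_four, of_apply, cons_val', cons_val_zero,
    cons_val_one, cons_val]
  refine ⟨?_, ?_, ?_, ?_⟩ <;> ring

lemma lowerMixed_mul_apply (r : ℤ) (K : IMat) (j : Fin 4) :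
    (lowerMixed N r * K) 0 j = K 0 j ∧
    (lowerMixed N r * K) 1 j = K 1 j ∧
    (lowerMixed N r * K) 2 j = N * r * K 1 j + K 2 j ∧
    (lowerMixed N r * K) 3 j = r * K 0 j + K 3 j := by
  simp only [lowerMixed, Matrix.mul_apply, Fin.sum_univ_four, of_apply, cons_val', cons_val_zero,
    cons_val_one, cons_val]
  refine ⟨?_, ?_, ?_, ?_⟩ <;> ring

lemma upperMixed_mul_apply (r : ℤ) (K : IMat) (j : Fin 4) :
    (upperMixed N r * K) 0 j = K 0 j + N * r * K 3 j ∧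
    (upperMixed N r * K) 1 j = K 1 j + r * K 2 j ∧
    (upperMixed N r * K) 2 j = K 2 j ∧
    (upperMixed N r * K) 3 j = K 3 j := by
  simp only [upperMixed, Matrix.mul_apply, Fin.sum_univ_four, of_apply, cons_val', cons_val_zero,
    cons_val_one, cons_val]
  refine ⟨?_, ?_, ?_, ?_⟩ <;> ring

lemma upperLevi_mul_apply (r : ℤ) (K : IMat) (j : Fin 4) :
    (upperLevi N r * K) 0 j = K 0 j - N * r * K 1 j ∧
    (upperLevi N r * K) 1 j = K 1 j ∧
    (upperLevi N r * K) 2 j = K 2 j ∧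
    (upperLevi N r * K) 3 j = r * K 2 j + K 3 j := by
  simp only [upperLevi, Matrix.mul_apply, Fin.sum_univ_four, of_apply, cons_val', cons_val_zero,
    cons_val_one, cons_val]
  refine ⟨?_, ?_, ?_, ?_⟩ <;> ring

variable [NeZero N] {m m₁ m₂ : ℕ} {K L L' M M₁ M₂ X Y : IMat}

/-- An isometry fixing e₀ and e₂ preserves the orthogonal complement of their span, the plane (1,
3), and acts on it with determinant one. -/
lemma approximable_of_fixes_plane (hK : IsSim N 1 K) (h0 : ∀ i, K i 0 = (1 : IMat) i 0)
    (h2 : ∀ i, K i 2 = (1 : IMat) i 2) : Approximable N K := by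
  have hN : (N : ℤ) ≠ 0 := by exact_mod_cast NeZero.ne N
  have e := isSim_iff.1 hK
  have h00 : K 0 0 = 1 := by simpa using h0 0
  have h10 : K 1 0 = 0 := by simpa using h0 1
  have h20 : K 2 0 = 0 := by simpa using h0 2
  have h30 : K 3 0 = 0 := by simpa using h0 3
  have h02 : K 0 2 = 0 := by simpa using h2 0
  have h12 : K 1 2 = 0 := by simpa using h2 1
  have h22 : K 2 2 = 1 := by simpa using h2 2
  have h32 : K 3 2 = 0 := by simpa using h2 3
  simp only [h00, h10, h20, h30, h02, h12, h22, h32] at e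
  obtain ⟨e1, e2, e3, e4, e5, e6⟩ := e
  have h21 : K 2 1 = 0 := by linarith
  have h23 : K 2 3 = 0 := by linarith
  have h01 : K 0 1 = 0 := by linarith
  have h03 : K 0 3 = 0 := by linarith
  have hdet : K 1 1 * K 3 3 - K 1 3 * K 3 1 = 1 := by
    apply mul_left_cancel₀ hN
    rw [h01, h21] at e2
    push_cast at e2
    linarith
  have : K = planeOdd !![K 1 1, K 1 3; K 3 1, K 3 3] := by
    ext i j
    fin_cases i <;> fin_cases j <;> simp [planeOdd, *]
  rw [this]
  exact approximable_planeOdd (by rw [det_fin_two_of]; exact hdet)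

/-- Pairing with the fixed vector e₀ forces the e₂-coordinate of K e₂ to be 1. Elementary isometries
fixing e₀ then remove the coordinates along e₁, e₃ and e₀, in this order. -/
lemma approximable_of_fixes_vector (hK : IsSim N 1 K) (h0 : ∀ i, K i 0 = (1 : IMat) i 0) :
    Approximable N K := by
  have h00 : K 0 0 = 1 := by simpa using h0 0
  have h10 : K 1 0 = 0 := by simpa using h0 1
  have h20 : K 2 0 = 0 := by simpa using h0 2
  have h30 : K 3 0 = 0 := by simpa using h0 3
  obtain ⟨e1, e2, e3, e4, e5, e6⟩ := isSim_iff.1 hK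
  have h22 : K 2 2 = 1 := by
    rw [h00, h10, h20, h30] at e1
    push_cast at e1
    linarith
  refine (approximable_upperMixed (K 1 2)).of_mul (L := upperMixed N (-K 1 2))
    (upperMixed_mul_neg _) ?_
  set K₁ := upperMixed N (-K 1 2) * K with hK₁
  have s₁ : IsSim N 1 K₁ := hK.isometry_mul (isSim_upperMixed _)
  refine (approximable_upperLevi (K₁ 3 2)).of_mul (L := upperLevi N (-K₁ 3 2))
    (upperLevi_mul_neg _) ?_
  set K₂ := upperLevi N (-K₁ 3 2) * K₁ with hK₂
  have s₂ : IsSim N 1 K₂ := s₁.isometry_mul (isSim_upperLevi _)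
  refine (approximable_planeEven (A := !![1, K₂ 0 2; 0, 1]) (by simp [det_fin_two])).of_mul
    (L := planeEven !![1, -K₂ 0 2; 0, 1])
    (planeEven_mul_planeEven (by simp [one_fin_two])) ?_
  refine approximable_of_fixes_plane
    (s₂.isometry_mul (isSim_planeEven (by simp [det_fin_two]))) ?_ ?_
  · intro i
    fin_cases i <;> simp [hK₂, hK₁, planeEven_mul_apply, upperLevi_mul_apply,
      upperMixed_mul_apply, h00, h10, h20, h30] <;> rfl
  · intro i
    fin_cases i <;> simp [hK₂, hK₁, planeEven_mul_apply, upperLevi_mul_apply,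
      upperMixed_mul_apply, h22] <;> rfl

/-- Coprimality lets SL₂ of the plane (0, 2) create the pivot 1 in the first column; the rest of
that column is then cleared. -/
lemma approximable_of_isCoprime (hK : IsSim N 1 K) (hco : IsCoprime (K 0 0) (K 2 0)) :
    Approximable N K := by
  obtain ⟨A, B, hA, hB, hBA, hA1, hA2⟩ := exists_SL2_zero (K 0 0) (K 2 0)
  refine (approximable_planeEven hB).of_mul (L := planeEven A) (planeEven_mul_planeEven hBA) ?_
  set K₁ := planeEven A * K with hK₁
  have s₁ : IsSim N 1 K₁ := hK.isometry_mul (isSim_planeEven hA)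
  have a0 : K₁ 0 0 = 1 := by
    rw [← hA2 hco]; simp [hK₁, planeEven_mul_apply]
  have a2 : K₁ 2 0 = 0 := by
    rw [← hA1]; simp [hK₁, planeEven_mul_apply]
  obtain ⟨A', B', hA', hB', hBA', hA1', -⟩ := exists_SL2_zero (K₁ 1 0) (K₁ 3 0)
  refine (approximable_planeOdd hB').of_mul (L := planeOdd A') (planeOdd_mul_planeOdd hBA') ?_
  set K₂ := planeOdd A' * K₁ with hK₂
  have s₂ : IsSim N 1 K₂ := s₁.isometry_mul (isSim_planeOdd hA')
  have b0 : K₂ 0 0 = 1 := by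
    rw [← a0]; simp [hK₂, planeOdd_mul_apply]
  have b2 : K₂ 2 0 = 0 := by
    rw [← a2]; simp [hK₂, planeOdd_mul_apply]
  have b3 : K₂ 3 0 = 0 := by
    rw [← hA1']; simp [hK₂, planeOdd_mul_apply]
  refine (approximable_lowerLevi (K₂ 1 0)).of_mul (L := lowerLevi N (-K₂ 1 0))
    (lowerLevi_mul_neg _) ?_
  refine approximable_of_fixes_vector (s₂.isometry_mul (isSim_lowerLevi _)) ?_
  intro i
  fin_cases i <;> simp [lowerLevi_mul_apply, b0, b2, b3] <;> rfl

/-- Strong approximation for the group of integral isometries. -/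
theorem IsSim.approximable (hK : IsSim N 1 K) : Approximable N K := by
  obtain ⟨A, B, hA, hB, hBA, hA1, -⟩ := exists_SL2_zero (K 0 0) (K 2 0)
  refine (approximable_planeEven hB).of_mul (L := planeEven A) (planeEven_mul_planeEven hBA) ?_
  set K₁ := planeEven A * K with hK₁
  have s₁ : IsSim N 1 K₁ := hK.isometry_mul (isSim_planeEven hA)
  have a2 : K₁ 2 0 = 0 := by
    rw [← hA1]; simp [hK₁, planeEven_mul_apply]
  obtain ⟨A', B', hA', hB', hBA', hA1', -⟩ := exists_SL2_zero (K₁ 1 0) (K₁ 3 0)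
  refine (approximable_planeOdd hB').of_mul (L := planeOdd A') (planeOdd_mul_planeOdd hBA') ?_
  set K₂ := planeOdd A' * K₁ with hK₂
  have s₂ : IsSim N 1 K₂ := s₁.isometry_mul (isSim_planeOdd hA')
  have b2 : K₂ 2 0 = 0 := by
    rw [← a2]; simp [hK₂, planeOdd_mul_apply]
  have b3 : K₂ 3 0 = 0 := by
    rw [← hA1']; simp [hK₂, planeOdd_mul_apply]
  -- With the entries (2,0) and (3,0) cleared, the first column relation reads K₀₀ K₂₂ + N K₁₀ K₃₂ =
  -- 1. The operation puts N K₁₀ into position (2,0), making it coprime to K₀₀.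
  refine (approximable_lowerMixed (-1)).of_mul (L := lowerMixed N (- -1))
    (lowerMixed_mul_neg _) ?_
  refine approximable_of_isCoprime (s₂.isometry_mul (isSim_lowerMixed _)) ?_
  have e := (isSim_iff.1 s₂).1
  rw [b2, b3] at e
  refine ⟨K₂ 2 2, K₂ 3 2, ?_⟩
  simp only [lowerMixed_mul_apply, b2]
  push_cast at e
  linarith

/-- If H is 1 modulo det M, then M H M⁻¹ = 1 + M X adj(M) is still integral, and likewise M⁻¹ H M.
-/
lemma exists_isometry_mul_eq_mul (hm : 0 < m) (hM : IsSim N m M) {H X : IMat}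
    (hH : IsSim N 1 H) (e : H = 1 + M.det • X) :
    (∃ K, IsSim N 1 K ∧ M * H = K * M) ∧ ∃ K, IsSim N 1 K ∧ H * M = M * K := by
  constructor
  · refine ⟨1 + M * X * M.adjugate, ?_, ?_⟩
    · refine hM.of_mul_right hm ?_
      have : (1 + M * X * M.adjugate) * M = M * H := by
        rw [e, add_mul, mul_assoc, adjugate_mul]
        simp only [mul_add, mul_one, one_mul, mul_smul_comm]
      rw [this, one_mul]
      exact hM.mul_isometry hH
    · rw [e, add_mul, mul_assoc (M * X), adjugate_mul]
      simp only [mul_add, mul_one, one_mul, mul_smul_comm]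
  · refine ⟨1 + M.adjugate * X * M, ?_, ?_⟩
    · refine hM.of_mul_left hm ?_
      have : M * (1 + M.adjugate * X * M) = H * M := by
        rw [e, mul_add, ← mul_assoc, ← mul_assoc, mul_adjugate]
        simp only [add_mul, mul_one, one_mul, smul_mul_assoc]
      rw [this, mul_one]
      exact hM.isometry_mul hH
    · rw [e, mul_add, ← mul_assoc, ← mul_assoc, mul_adjugate]
      simp only [add_mul, mul_one, one_mul, smul_mul_assoc]

/-- Choose H congruent to K modulo det M₁ and to 1 modulo det M₂, and write K = (K H⁻¹) H. The first
factor moves to the left of M₁ and the second to the right of M₂. -/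
lemma equivalent_mul_mul_of_coprime (h₁ : 0 < m₁) (h₂ : 0 < m₂) (hco : m₁.Coprime m₂)
    (hM₁ : IsSim N m₁ M₁) (hM₂ : IsSim N m₂ M₂) (hK : IsSim N 1 K) :
    Equivalent N (M₁ * M₂) (M₁ * K * M₂) := by
  have hd : IsCoprime M₁.det M₂.det := by
    rw [Int.isCoprime_iff_gcd_eq_one, Int.gcd, hM₁.det_natAbs, hM₂.det_natAbs]
    exact Nat.Coprime.pow 2 2 hco
  obtain ⟨H, X, Y, hH, e1, e2⟩ := hK.approximable M₁.det M₂.det hd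
  obtain ⟨H', hHH', hH'H, hH'⟩ := hH.exists_inv
  obtain ⟨L, hL, e3⟩ := (exists_isometry_mul_eq_mul h₂ hM₂ hH e2).2
  have e4 : K * H' = 1 + M₁.det • (-(X * H')) := by
    have : K = H - M₁.det • X := by rw [e1]; abel
    rw [this, sub_mul, hHH', smul_mul_assoc, smul_neg, sub_eq_add_neg]
  obtain ⟨L', hL', e5⟩ := (exists_isometry_mul_eq_mul h₁ hM₁ (hH'.isometry_mul hK) e4).1
  refine ⟨L', L, hL', hL, ?_⟩
  calc M₁ * K * M₂ = M₁ * (K * H') * (H * M₂) := by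
        rw [mul_assoc M₁ (K * H'), mul_assoc K H', ← mul_assoc H' H, hH'H, one_mul, mul_assoc]
    _ = _ := by rw [e5, e3]; simp only [mul_assoc]

/-- Double cosets with coprime multipliers multiply like their representatives. -/
theorem simCoset_mul_simCoset_of_coprime (h₁ : 0 < m₁) (h₂ : 0 < m₂) (hco : m₁.Coprime m₂)
    (hM₁ : IsSim N m₁ M₁) (hM₂ : IsSim N m₂ M₂) :
    simCoset N m₁ M₁ * simCoset N m₂ M₂ = simCoset N (m₁ * m₂) (M₁ * M₂) :=
  simCoset_mul_simCoset h₁ h₂ hM₁ hM₂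
    (fun _ hK => equivalent_mul_mul_of_coprime h₁ h₂ hco hM₁ hM₂ hK)
    fun _ _ hX hY e => exists_isometry_mul_of_coprime h₂ hco (hX.isSim hM₁) (hY.isSim hM₂) hM₂ e

end

/-! ### Elementary divisors at a prime -/

/-- The diagonal matrix `diag(1, p ^ f, p ^ v, p ^ (v - f))`. -/
def stdMat (p v f : ℕ) : IMat := diagonal ![1, (p : ℤ) ^ f, (p : ℤ) ^ v, (p : ℤ) ^ (v - f)]

/-- The matrix `M` has an entry in the coordinate plane `(0, 2)` prime to `p`, and, if `p` divides
`N`, the entries from the plane `(1, 3)` to the plane `(0, 2)` are divisible by `p`. -/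
def IsDominant (N p : ℕ) (M : IMat) : Prop :=
  (¬ (p : ℤ) ∣ M 0 0 ∨ ¬ (p : ℤ) ∣ M 0 2 ∨ ¬ (p : ℤ) ∣ M 2 0 ∨ ¬ (p : ℤ) ∣ M 2 2) ∧
  (p ∣ N → (p : ℤ) ∣ M 0 1 ∧ (p : ℤ) ∣ M 0 3 ∧ (p : ℤ) ∣ M 2 1 ∧ (p : ℤ) ∣ M 2 3)

section

variable {N : ℕ}

lemma isSim_stdMat (p : ℕ) {v f : ℕ} (h : 2 * f ≤ v) : IsSim N (p ^ v) (stdMat p v f) := by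
  have e : (p : ℤ) ^ f * (p : ℤ) ^ (v - f) = (p : ℤ) ^ v := by
    rw [← pow_add]
    congr 1
    omega
  rw [isSim_iff]
  simp [stdMat]
  linear_combination (N : ℤ) * e

lemma mul_planeEven_apply (A : Matrix (Fin 2) (Fin 2) ℤ) (K : IMat) (i : Fin 4) :
    (K * planeEven A) i 0 = K i 0 * A 0 0 + K i 2 * A 1 0 ∧
    (K * planeEven A) i 1 = K i 1 ∧
    (K * planeEven A) i 2 = K i 0 * A 0 1 + K i 2 * A 1 1 ∧
    (K * planeEven A) i 3 = K i 3 := by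
  simp only [planeEven, Matrix.mul_apply, Fin.sum_univ_four, of_apply, cons_val', cons_val_zero,
    cons_val_one, cons_val]
  refine ⟨?_, ?_, ?_, ?_⟩ <;> ring

lemma mul_planeOdd_apply (A : Matrix (Fin 2) (Fin 2) ℤ) (K : IMat) (i : Fin 4) :
    (K * planeOdd A) i 0 = K i 0 ∧
    (K * planeOdd A) i 1 = K i 1 * A 0 0 + K i 3 * A 1 0 ∧
    (K * planeOdd A) i 2 = K i 2 ∧
    (K * planeOdd A) i 3 = K i 1 * A 0 1 + K i 3 * A 1 1 := by
  simp only [planeOdd, Matrix.mul_apply, Fin.sum_univ_four, of_apply, cons_val', cons_val_zero,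
    cons_val_one, cons_val]
  refine ⟨?_, ?_, ?_, ?_⟩ <;> ring

lemma det_rotation : (!![0, -1; 1, 0] : Matrix (Fin 2) (Fin 2) ℤ).det = 1 := by
  simp [det_fin_two]

lemma exists_dvd_add_mul {p : ℕ} (hp : p.Prime) {c : ℤ} (hc : ¬ (p : ℤ) ∣ c) (k : ℕ) (x : ℤ) :
    ∃ s : ℤ, (p : ℤ) ^ k ∣ x + s * c := by
  have hco : IsCoprime c ((p : ℤ) ^ k) :=
    (((Nat.prime_iff_prime_int.1 hp).coprime_iff_not_dvd.2 hc).symm).pow_right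
  obtain ⟨u, w, huw⟩ := hco
  exact ⟨-x * u, x * w, by linear_combination -x * huw⟩

/-- Here squarefreeness enters: p divides N at most once, so cancelling N costs at most one factor
p. -/
lemma pow_dvd_of_level_mul {p : ℕ} (hp : p.Prime) (hN : ¬ p ^ 2 ∣ N) {k : ℕ} {x : ℤ}
    (h : (p : ℤ) ^ (k + 1) ∣ N * x) : (p : ℤ) ^ k ∣ x := by
  have hp' := Nat.prime_iff_prime_int.1 hp
  by_cases hpN : p ∣ N
  · obtain ⟨n, rfl⟩ := hpN
    have hn : ¬ (p : ℤ) ∣ n := by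
      intro h
      rw [Int.natCast_dvd_natCast] at h
      exact hN (by rw [sq]; exact mul_dvd_mul_left p h)
    push_cast at h
    rw [pow_succ', mul_assoc] at h
    have h2 := (mul_dvd_mul_iff_left hp'.ne_zero).1 h
    exact hp'.pow_dvd_of_dvd_mul_left _ hn h2
  · have hn : ¬ (p : ℤ) ∣ N := by rwa [Int.natCast_dvd_natCast]
    exact (pow_dvd_pow _ k.le_succ).trans (hp'.pow_dvd_of_dvd_mul_left _ hn h)

/-- Solve the orthogonality of two rows for x, the pivot c being a unit at p. When p ∣ N, the factor
lost with N is recovered from a and a'. -/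
lemma pow_dvd_of_row_eq {p : ℕ} (hp : p.Prime) (hN : ¬ p ^ 2 ∣ N) {c x b q a a' d d' : ℤ} {k : ℕ}
    (hc : ¬ (p : ℤ) ∣ c) (e : N * (c * x - b * q) + (a * d - a' * d') = 0)
    (hd : (p : ℤ) ^ k ∣ d) (hd' : (p : ℤ) ^ k ∣ d') (hq : (p : ℤ) ^ k ∣ q)
    (ha : p ∣ N → (p : ℤ) ∣ a ∧ (p : ℤ) ∣ a') : (p : ℤ) ^ k ∣ x := by
  have hp' := Nat.prime_iff_prime_int.1 hp
  have h1 : (p : ℤ) ^ k ∣ c * x - b * q := by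
    by_cases hpN : p ∣ N
    · refine pow_dvd_of_level_mul hp hN ?_
      have : (N : ℤ) * (c * x - b * q) = a' * d' - a * d := by linarith
      rw [this, pow_succ']
      exact dvd_sub (mul_dvd_mul (ha hpN).2 hd') (mul_dvd_mul (ha hpN).1 hd)
    · have hn : ¬ (p : ℤ) ∣ N := by rwa [Int.natCast_dvd_natCast]
      refine hp'.pow_dvd_of_dvd_mul_left k hn ?_
      have : (N : ℤ) * (c * x - b * q) = a' * d' - a * d := by linarith
      rw [this]
      exact dvd_sub (hd'.mul_left _) (hd.mul_left _)
  have h2 : (p : ℤ) ^ k ∣ c * x := by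
    have := dvd_add h1 (hq.mul_left b)
    rwa [sub_add_cancel] at this
  exact hp'.pow_dvd_of_dvd_mul_left k hc h2

variable {p v f m : ℕ} {M X : IMat}

/-- A similitude whose rows are divisible by the entries of `stdMat p v f`. -/
lemma exists_eq_stdMat_mul (hp : p.Prime) (hf : 2 * f ≤ v) (hM : IsSim N (p ^ v * m) M)
    (h1 : ∀ j, (p : ℤ) ^ f ∣ M 1 j) (h2 : ∀ j, (p : ℤ) ^ v ∣ M 2 j)
    (h3 : ∀ j, (p : ℤ) ^ (v - f) ∣ M 3 j) : ∃ M₁, IsSim N m M₁ ∧ M = stdMat p v f * M₁ := by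
  choose k1 hk1 using h1
  choose k2 hk2 using h2
  choose k3 hk3 using h3
  have e : M = stdMat p v f * Matrix.of ![fun j => M 0 j, k1, k2, k3] := by
    ext i j
    fin_cases i <;> simp [stdMat, diagonal_mul, hk1, hk2, hk3]
  refine ⟨_, (isSim_stdMat p hf).of_mul_left (pow_pos hp.pos v) ?_, e⟩
  rwa [← e]

/-- Column 0 is a unit multiple of e₀ modulo p^(v+2), so the column relations control row 2 and give
the minor on the plane (1, 3) valuation exactly v. The excess 2 in the exponent leaves v + 1 after N
is cancelled, which suffices to exclude a larger valuation. -/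
lemma IsSim.plane_minor (hp : p.Prime) (hN : ¬ p ^ 2 ∣ N) (hm : ¬ p ∣ m)
    (hM : IsSim N (p ^ v * m) M) (h00 : ¬ (p : ℤ) ∣ M 0 0)
    (h10 : (p : ℤ) ^ (v + 2) ∣ M 1 0) (h20 : (p : ℤ) ^ (v + 2) ∣ M 2 0)
    (h30 : (p : ℤ) ^ (v + 2) ∣ M 3 0) :
    (p : ℤ) ^ v ∣ M 2 1 ∧ (p : ℤ) ^ v ∣ M 2 2 ∧ (p : ℤ) ^ v ∣ M 2 3 ∧
    (p : ℤ) ^ v ∣ M 1 1 * M 3 3 - M 3 1 * M 1 3 ∧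
    ¬ (p : ℤ) ^ (v + 1) ∣ M 1 1 * M 3 3 - M 3 1 * M 1 3 := by
  have hp' := Nat.prime_iff_prime_int.1 hp
  obtain ⟨e1, e2, e3, e4, -, -⟩ := isSim_iff.1 hM
  push_cast at e1 e2
  have hle : (p : ℤ) ^ v ∣ (p : ℤ) ^ (v + 2) := pow_dvd_pow _ (by omega)
  have h21 : (p : ℤ) ^ (v + 2) ∣ M 2 1 := by
    refine hp'.pow_dvd_of_dvd_mul_left _ h00 ?_
    have : M 0 0 * M 2 1 = M 2 0 * M 0 1 - N * (M 1 0 * M 3 1 - M 3 0 * M 1 1) := by linarith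
    rw [this]
    exact dvd_sub (h20.mul_right _) ((dvd_sub (h10.mul_right _) (h30.mul_right _)).mul_left _)
  have h23 : (p : ℤ) ^ (v + 2) ∣ M 2 3 := by
    refine hp'.pow_dvd_of_dvd_mul_left _ h00 ?_
    have : M 0 0 * M 2 3 = M 2 0 * M 0 3 - N * (M 1 0 * M 3 3 - M 3 0 * M 1 3) := by linarith
    rw [this]
    exact dvd_sub (h20.mul_right _) ((dvd_sub (h10.mul_right _) (h30.mul_right _)).mul_left _)
  have h22 : (p : ℤ) ^ v ∣ M 2 2 := by
    refine hp'.pow_dvd_of_dvd_mul_left _ h00 ?_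
    have : M 0 0 * M 2 2 = p ^ v * m + (M 2 0 * M 0 2 - N * (M 1 0 * M 3 2 - M 3 0 * M 1 2)) := by
      linarith
    rw [this]
    exact dvd_add (dvd_mul_right _ _) (hle.trans
      (dvd_sub (h20.mul_right _) ((dvd_sub (h10.mul_right _) (h30.mul_right _)).mul_left _)))
  have hD : (p : ℤ) ^ (v + 1) ∣ M 1 1 * M 3 3 - M 3 1 * M 1 3 - p ^ v * m := by
    refine pow_dvd_of_level_mul hp hN ?_
    have : N * (M 1 1 * M 3 3 - M 3 1 * M 1 3 - p ^ v * m) =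
        M 2 1 * M 0 3 - M 0 1 * M 2 3 := by linarith
    rw [this]
    exact dvd_sub (h21.mul_right _) (h23.mul_left _)
  refine ⟨hle.trans h21, h22, hle.trans h23, ?_, fun h => hm ?_⟩
  · have := dvd_add ((pow_dvd_pow _ v.le_succ).trans hD) (dvd_mul_right ((p : ℤ) ^ v) m)
    rwa [sub_add_cancel] at this
  · have h2 := dvd_sub h hD
    rw [sub_sub_cancel, pow_succ, mul_dvd_mul_iff_left (pow_ne_zero _ hp'.ne_zero),
      Int.natCast_dvd_natCast] at h2
    exact h2

variable [NeZero N]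

/-- The entry (1,1) has the least valuation f in the block on the plane (1, 3), whose determinant
has valuation v. Clearing below it makes the rows divisible by 1, p^f, p^v, p^(v-f), and the
diagonal matrix splits off on the left. -/
lemma exists_equivalent_stdMat_of_entry (hp : p.Prime) (hN : ¬ p ^ 2 ∣ N) (hm : ¬ p ∣ m)
    (hM : IsSim N (p ^ v * m) M) (h00 : ¬ (p : ℤ) ∣ M 0 0)
    (hB : p ∣ N → (p : ℤ) ∣ M 0 1 ∧ (p : ℤ) ∣ M 0 3)
    (h10 : (p : ℤ) ^ (v + 2) ∣ M 1 0) (h20 : (p : ℤ) ^ (v + 2) ∣ M 2 0)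
    (h30 : (p : ℤ) ^ (v + 2) ∣ M 3 0)
    (hD : (p : ℤ) ^ f ∣ M 1 1 ∧ (p : ℤ) ^ f ∣ M 1 3 ∧ (p : ℤ) ^ f ∣ M 3 1 ∧ (p : ℤ) ^ f ∣ M 3 3)
    (hf : ¬ (p : ℤ) ^ (f + 1) ∣ M 1 1) :
    ∃ M₁, 2 * f ≤ v ∧ IsSim N m M₁ ∧ Equivalent N (stdMat p v f * M₁) M := by
  have hp' := Nat.prime_iff_prime_int.1 hp
  obtain ⟨h21, h22, h23, hDv, hDv'⟩ := hM.plane_minor hp hN hm h00 h10 h20 h30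
  obtain ⟨h11, h13, h31, h33⟩ := hD
  have hfv : 2 * f ≤ v := by
    by_contra hlt
    refine hDv' ((pow_dvd_pow _ (show v + 1 ≤ f + f by omega)).trans ?_)
    rw [pow_add]
    exact dvd_sub (mul_dvd_mul h11 h33) (mul_dvd_mul h31 h13)
  obtain ⟨d, hd⟩ := h11
  obtain ⟨t, ht⟩ := h31
  have hdp : ¬ (p : ℤ) ∣ d := by
    intro h
    rw [hd, pow_succ] at hf
    exact hf (mul_dvd_mul_left _ h)
  obtain ⟨s, hs⟩ := exists_dvd_add_mul hp hdp v t
  have hdet : (!![1, 0; s, 1] : Matrix (Fin 2) (Fin 2) ℤ).det = 1 := by simp [det_fin_two]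
  have hL : IsSim N 1 (planeOdd !![1, 0; s, 1]) := isSim_planeOdd hdet
  set M' := planeOdd !![1, 0; s, 1] * M with hM'
  have sM' : IsSim N (p ^ v * m) M' := hM.isometry_mul hL
  have r0 : ∀ j, M' 0 j = M 0 j := fun j => by simp [hM', planeOdd_mul_apply]
  have r1 : ∀ j, M' 1 j = M 1 j := fun j => by simp [hM', planeOdd_mul_apply]
  have r2 : ∀ j, M' 2 j = M 2 j := fun j => by simp [hM', planeOdd_mul_apply]
  have r3 : ∀ j, M' 3 j = s * M 1 j + M 3 j := fun j => by simp [hM', planeOdd_mul_apply]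
  have hle : ∀ {k}, k ≤ v → (p : ℤ) ^ k ∣ (p : ℤ) ^ (v + 2) := fun h => pow_dvd_pow _ (by omega)
  have g31 : (p : ℤ) ^ v ∣ M' 3 1 := by
    have : M' 3 1 = p ^ f * (t + s * d) := by rw [r3, hd, ht]; ring
    rw [this]
    exact hs.mul_left _
  -- The row operation preserves the block determinant. Its off-diagonal term is now divisible by
  -- p^v, and the pivot accounts for exactly p^f.
  have g33 : (p : ℤ) ^ (v - f) ∣ M' 3 3 := by
    have h1 : M 1 1 * M' 3 3 = (M 1 1 * M 3 3 - M 3 1 * M 1 3) + M' 3 1 * M 1 3 := by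
      rw [r3, r3]; ring
    have h2 : (p : ℤ) ^ v ∣ M 1 1 * M' 3 3 := by
      rw [h1]
      exact dvd_add hDv (g31.mul_right _)
    have e : (p : ℤ) ^ v = p ^ f * p ^ (v - f) := by
      rw [← pow_add]; congr 1; omega
    rw [hd, e, mul_assoc, mul_dvd_mul_iff_left (pow_ne_zero _ hp'.ne_zero)] at h2
    exact hp'.pow_dvd_of_dvd_mul_left _ hdp h2
  have g30 : (p : ℤ) ^ (v + 2) ∣ M' 3 0 := by
    rw [r3]
    exact dvd_add (h10.mul_left _) h30
  obtain ⟨-, -, e1, e3⟩ := sM'.row_eqs (Nat.mul_pos (pow_pos hp.pos v)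
    (Nat.pos_of_ne_zero fun h => hm (h ▸ dvd_zero p)))
  rw [r0, r0, r0, r0, r1, r1, r1, r1] at e1
  rw [r0, r0, r0, r0] at e3
  have g12 : (p : ℤ) ^ f ∣ M 1 2 :=
    pow_dvd_of_row_eq hp hN h00 e1 h13 (hd ▸ dvd_mul_right _ _)
      ((hle (by omega)).trans h10) hB
  have g32 : (p : ℤ) ^ (v - f) ∣ M' 3 2 :=
    pow_dvd_of_row_eq hp hN h00 e3 g33 ((pow_dvd_pow _ (by omega)).trans g31)
      ((hle (by omega)).trans g30) hB
  obtain ⟨M₁, hM₁, e⟩ := exists_eq_stdMat_mul hp hfv sM' (f := f) (fun j => by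
      rw [r1]
      fin_cases j
      · exact (hle (by omega)).trans h10
      · exact hd ▸ dvd_mul_right _ _
      · exact g12
      · exact h13) (fun j => by
      rw [r2]
      fin_cases j
      · exact (hle le_rfl).trans h20
      · exact h21
      · exact h22
      · exact h23) (fun j => by
      fin_cases j
      · exact (hle (by omega)).trans g30
      · exact (pow_dvd_pow _ (by omega)).trans g31
      · exact g32
      · exact g33)
  refine ⟨M₁, hfv, hM₁, ?_⟩
  rw [← e]
  exact (equivalent_mul_left hL M).symm

/-- Take f to be the least valuation in the block on the plane (1, 3). Rotations of this plane on
either side bring an entry of that valuation to position (1,1). -/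
lemma exists_equivalent_stdMat_of_column (hp : p.Prime) (hN : ¬ p ^ 2 ∣ N) (hm : ¬ p ∣ m)
    (hM : IsSim N (p ^ v * m) M) (h00 : ¬ (p : ℤ) ∣ M 0 0)
    (hB : p ∣ N → (p : ℤ) ∣ M 0 1 ∧ (p : ℤ) ∣ M 0 3)
    (h10 : (p : ℤ) ^ (v + 2) ∣ M 1 0) (h20 : (p : ℤ) ^ (v + 2) ∣ M 2 0)
    (h30 : (p : ℤ) ^ (v + 2) ∣ M 3 0) :
    ∃ f M₁, 2 * f ≤ v ∧ IsSim N m M₁ ∧ Equivalent N (stdMat p v f * M₁) M := by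
  classical
  obtain ⟨-, -, -, -, hDv'⟩ := hM.plane_minor hp hN hm h00 h10 h20 h30
  let P : ℕ → Prop := fun f => (p : ℤ) ^ f ∣ M 1 1 ∧ (p : ℤ) ^ f ∣ M 1 3 ∧
    (p : ℤ) ^ f ∣ M 3 1 ∧ (p : ℤ) ^ f ∣ M 3 3
  have hP0 : P 0 := by simp [P]
  -- Without such an f the block would be divisible by every power of p, against the finite
  -- valuation of its determinant.
  obtain ⟨f, hPf, hPf'⟩ : ∃ f, P f ∧ ¬ P (f + 1) := by
    by_contra! h
    have hall : ∀ f, P f := fun f => Nat.rec hP0 h f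
    exact hDv' (dvd_sub ((hall _).1.mul_right _) ((hall _).2.2.1.mul_right _))
  have hw : IsSim N 1 (planeOdd !![0, -1; 1, 0]) := isSim_planeOdd det_rotation
  obtain ⟨p11, p13, p31, p33⟩ := hPf
  refine ⟨f, ?_⟩
  by_cases h11 : (p : ℤ) ^ (f + 1) ∣ M 1 1
  · by_cases h13 : (p : ℤ) ^ (f + 1) ∣ M 1 3
    · by_cases h31 : (p : ℤ) ^ (f + 1) ∣ M 3 1
      · have h33 : ¬ (p : ℤ) ^ (f + 1) ∣ M 3 3 := fun h33 => hPf' ⟨h11, h13, h31, h33⟩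
        obtain ⟨M₁, h1, h2, h3⟩ := exists_equivalent_stdMat_of_entry
          (M := planeOdd !![0, -1; 1, 0] * M * planeOdd !![0, -1; 1, 0]) (f := f) hp hN hm
          ((hM.isometry_mul hw).mul_isometry hw)
          (by simpa [planeOdd_mul_apply, mul_planeOdd_apply] using h00)
          (by simpa [planeOdd_mul_apply, mul_planeOdd_apply] using fun h => (hB h).symm)
          (by simpa [planeOdd_mul_apply, mul_planeOdd_apply] using h30)
          (by simpa [planeOdd_mul_apply, mul_planeOdd_apply] using h20)
          (by simpa [planeOdd_mul_apply, mul_planeOdd_apply] using h10)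
          (by simpa [planeOdd_mul_apply, mul_planeOdd_apply] using ⟨p33, p31, p13, p11⟩)
          (by simpa [planeOdd_mul_apply, mul_planeOdd_apply] using h33)
        exact ⟨M₁, h1, h2, h3.trans ((equivalent_mul_left hw M).trans
          (equivalent_mul_right hw _)).symm⟩
      · obtain ⟨M₁, h1, h2, h3⟩ := exists_equivalent_stdMat_of_entry
          (M := planeOdd !![0, -1; 1, 0] * M) (f := f) hp hN hm (hM.isometry_mul hw)
          (by simpa [planeOdd_mul_apply] using h00) (by simpa [planeOdd_mul_apply] using hB)
          (by simpa [planeOdd_mul_apply] using h30) (by simpa [planeOdd_mul_apply] using h20)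
          (by simpa [planeOdd_mul_apply] using h10)
          (by simpa [planeOdd_mul_apply] using ⟨p31, p33, p11, p13⟩)
          (by simpa [planeOdd_mul_apply] using h31)
        exact ⟨M₁, h1, h2, h3.trans (equivalent_mul_left hw M).symm⟩
    · obtain ⟨M₁, h1, h2, h3⟩ := exists_equivalent_stdMat_of_entry
        (M := M * planeOdd !![0, -1; 1, 0]) (f := f) hp hN hm (hM.mul_isometry hw)
        (by simpa [mul_planeOdd_apply] using h00)
        (by simpa [mul_planeOdd_apply] using fun h => (hB h).symm)
        (by simpa [mul_planeOdd_apply] using h10) (by simpa [mul_planeOdd_apply] using h20)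
        (by simpa [mul_planeOdd_apply] using h30)
        (by simpa [mul_planeOdd_apply] using ⟨p13, p11, p33, p31⟩)
        (by simpa [mul_planeOdd_apply] using h13)
      exact ⟨M₁, h1, h2, h3.trans (equivalent_mul_right hw M).symm⟩
  · exact exists_equivalent_stdMat_of_entry hp hN hm hM h00 hB h10 h20 h30
      ⟨p11, p13, p31, p33⟩ h11

lemma exists_equivalent_stdMat_of_not_dvd (hp : p.Prime) (hN : ¬ p ^ 2 ∣ N) (hm : ¬ p ∣ m)
    (hM : IsSim N (p ^ v * m) M) (h00 : ¬ (p : ℤ) ∣ M 0 0)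
    (hB : p ∣ N → (p : ℤ) ∣ M 0 1 ∧ (p : ℤ) ∣ M 0 3) :
    ∃ f M₁, 2 * f ≤ v ∧ IsSim N m M₁ ∧ Equivalent N (stdMat p v f * M₁) M := by
  -- The pivot is a unit only at p, so column 0 is cleared modulo p^(v+2) and not exactly. Entry
  -- (2,0) comes last because both mixed operations change row 2.
  obtain ⟨y, hy⟩ := exists_dvd_add_mul hp h00 (v + 2) (M 1 0)
  obtain ⟨z, hz⟩ := exists_dvd_add_mul hp h00 (v + 2) (M 3 0)
  set K₁ := lowerMixed N z * (lowerLevi N y * M) with hK₁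
  have a0 : ∀ j, K₁ 0 j = M 0 j := fun j => by
    simp [hK₁, lowerMixed_mul_apply, lowerLevi_mul_apply]
  obtain ⟨r, hr⟩ := exists_dvd_add_mul hp h00 (v + 2) (K₁ 2 0)
  have hL : IsSim N 1 (planeEven !![1, 0; r, 1]) := isSim_planeEven (by simp [det_fin_two])
  have s₁ : IsSim N (p ^ v * m) K₁ :=
    (hM.isometry_mul (isSim_lowerLevi y)).isometry_mul (isSim_lowerMixed z)
  obtain ⟨f, M₁, h1, h2, h3⟩ := exists_equivalent_stdMat_of_column
    (M := planeEven !![1, 0; r, 1] * K₁) hp hN hm (s₁.isometry_mul hL)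
    (by simpa [planeEven_mul_apply, a0] using h00) (by simpa [planeEven_mul_apply, a0] using hB)
    (by simpa [planeEven_mul_apply, hK₁, lowerMixed_mul_apply, lowerLevi_mul_apply, add_comm]
      using hy)
    (by simpa [planeEven_mul_apply, a0, add_comm] using hr)
    (by simpa [planeEven_mul_apply, hK₁, lowerMixed_mul_apply, lowerLevi_mul_apply, add_comm]
      using hz)
  refine ⟨f, M₁, h1, h2, h3.trans (Equivalent.symm ?_)⟩
  exact ((equivalent_mul_left (isSim_lowerLevi y) M).trans
    (equivalent_mul_left (isSim_lowerMixed z) _)).trans (equivalent_mul_left hL _)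

/-- The elementary divisor theorem at `p` for dominant similitudes. -/
theorem IsDominant.exists_equivalent_stdMat (hp : p.Prime) (hN : ¬ p ^ 2 ∣ N) (hm : ¬ p ∣ m)
    (hM : IsSim N (p ^ v * m) M) (h : IsDominant N p M) :
    ∃ f M₁, 2 * f ≤ v ∧ IsSim N m M₁ ∧ Equivalent N (stdMat p v f * M₁) M := by
  obtain ⟨hA, hB⟩ := h
  have hw : IsSim N 1 (planeEven !![0, -1; 1, 0]) := isSim_planeEven det_rotation
  rcases hA with h00 | h02 | h20 | h22
  · exact exists_equivalent_stdMat_of_not_dvd hp hN hm hM h00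
      fun h => ⟨(hB h).1, (hB h).2.1⟩
  · obtain ⟨f, M₁, h1, h2, h3⟩ := exists_equivalent_stdMat_of_not_dvd
      (M := M * planeEven !![0, -1; 1, 0]) hp hN hm (hM.mul_isometry hw)
      (by simpa [mul_planeEven_apply] using h02)
      (by simpa [mul_planeEven_apply] using fun h => ⟨(hB h).1, (hB h).2.1⟩)
    exact ⟨f, M₁, h1, h2, h3.trans (equivalent_mul_right hw M).symm⟩
  · obtain ⟨f, M₁, h1, h2, h3⟩ := exists_equivalent_stdMat_of_not_dvd
      (M := planeEven !![0, -1; 1, 0] * M) hp hN hm (hM.isometry_mul hw)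
      (by simpa [planeEven_mul_apply] using h20)
      (by simpa [planeEven_mul_apply] using fun h => (hB h).2.2)
    exact ⟨f, M₁, h1, h2, h3.trans (equivalent_mul_left hw M).symm⟩
  · obtain ⟨f, M₁, h1, h2, h3⟩ := exists_equivalent_stdMat_of_not_dvd
      (M := planeEven !![0, -1; 1, 0] * M * planeEven !![0, -1; 1, 0]) hp hN hm
      ((hM.isometry_mul hw).mul_isometry hw)
      (by simpa [planeEven_mul_apply, mul_planeEven_apply] using h22)
      (by simpa [planeEven_mul_apply, mul_planeEven_apply] using fun h => (hB h).2.2)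
    exact ⟨f, M₁, h1, h2, h3.trans ((equivalent_mul_left hw M).trans
      (equivalent_mul_right hw _)).symm⟩

end

/-! ### Atkin–Lehner similitudes -/

/-- The integral similitude `√p W_p`. -/
def atkinMat (N p : ℕ) (α β γ δ : ℤ) : IMat :=
  !![α * p, β * N, 0, 0; γ, δ * p, 0, 0; 0, 0, δ * p, -(γ * N); 0, 0, -β, α * p]

section

variable {N p : ℕ} {α β γ δ : ℤ}

lemma isSim_atkinMat (h : α * p * (δ * p) - β * N * γ = p) :
    IsSim N p (atkinMat N p α β γ δ) := by
  rw [isSim_iff]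
  simp [atkinMat]
  refine ⟨by linear_combination h, by linear_combination (N : ℤ) * h, by ring, by ring⟩

lemma atkinMat_mul (h : α * p * (δ * p) - β * N * γ = p) :
    atkinMat N p α β γ δ * atkinMat N p δ (-β) (-γ) α = (p : ℤ) • (1 : IMat) := by
  ext i j
  fin_cases i <;> fin_cases j <;> simp [atkinMat, Matrix.mul_apply, Fin.sum_univ_four] <;>
    first | ring1 | linear_combination h

lemma atkinMat_mul_apply (M : IMat) (j : Fin 4) :
    (atkinMat N p α β γ δ * M) 0 j = α * p * M 0 j + β * N * M 1 j ∧
    (atkinMat N p α β γ δ * M) 1 j = γ * M 0 j + δ * p * M 1 j ∧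
    (atkinMat N p α β γ δ * M) 2 j = δ * p * M 2 j - γ * N * M 3 j ∧
    (atkinMat N p α β γ δ * M) 3 j = -β * M 2 j + α * p * M 3 j := by
  simp only [atkinMat, Matrix.mul_apply, Fin.sum_univ_four, of_apply, cons_val', cons_val_zero,
    cons_val_one, cons_val]
  refine ⟨?_, ?_, ?_, ?_⟩ <;> ring

lemma mul_atkinMat_apply (M : IMat) (i : Fin 4) :
    (M * atkinMat N p α β γ δ) i 0 = M i 0 * (α * p) + M i 1 * γ ∧
    (M * atkinMat N p α β γ δ) i 1 = M i 0 * (β * N) + M i 1 * (δ * p) ∧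
    (M * atkinMat N p α β γ δ) i 2 = M i 2 * (δ * p) - M i 3 * β ∧
    (M * atkinMat N p α β γ δ) i 3 = -(M i 2 * (γ * N)) + M i 3 * (α * p) := by
  simp only [atkinMat, Matrix.mul_apply, Fin.sum_univ_four, of_apply, cons_val', cons_val_zero,
    cons_val_one, cons_val]
  refine ⟨?_, ?_, ?_, ?_⟩ <;> ring

lemma isSim_one_of_smul (hp : 0 < p) {K : IMat} (h : IsSim N (p ^ 2) ((p : ℤ) • K)) :
    IsSim N 1 K := by
  obtain ⟨m, -, e, hm⟩ := IsSim.of_smul hp h (pow_pos hp 2)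
  have : m = 1 := by
    have h2 : 0 < p ^ 2 := pow_pos hp 2
    exact Nat.eq_of_mul_eq_mul_left h2 (by rw [mul_one, ← e])
  rwa [this] at hm

/-- This is the statement that W_p normalizes Σ_N. Divisibility by p is tested modulo p, where N and
the block of K controlled by `IsSim.dvd` vanish. -/
lemma exists_conj_atkinMat (hp : 0 < p) (hpN : p ∣ N) (h : α * p * (δ * p) - β * N * γ = p)
    {K : IMat} (hK : IsSim N 1 K) : ∃ K', IsSim N 1 K' ∧
      atkinMat N p α β γ δ * K * atkinMat N p δ (-β) (-γ) α = (p : ℤ) • K' := by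
  have h' : δ * p * (α * p) - (-β) * N * (-γ) = p := by linear_combination h
  suffices hex : ∃ K', atkinMat N p α β γ δ * K * atkinMat N p δ (-β) (-γ) α = (p : ℤ) • K' by
    obtain ⟨K', e⟩ := hex
    refine ⟨K', isSim_one_of_smul hp ?_, e⟩
    rw [← e, sq]
    exact ((isSim_atkinMat h).mul_isometry hK).mul (isSim_atkinMat h')
  obtain ⟨n, hn⟩ := hpN
  have hNp : (N : ℤ) = p * n := by exact_mod_cast hn
  obtain ⟨⟨k1, hk1⟩, ⟨k2, hk2⟩, ⟨k3, hk3⟩, ⟨k4, hk4⟩⟩ := hK.dvd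
  have hdvd : ∀ i j, ∃ k, (atkinMat N p α β γ δ * K * atkinMat N p δ (-β) (-γ) α) i j = p * k := by
    intro i j
    change (p : ℤ) ∣ _
    have hN0 : (N : ZMod p) = 0 := by rw [hn]; simp
    have h1 : (K 0 1 : ZMod p) = 0 := by rw [hk1]; simp [hN0]
    have h2 : (K 0 3 : ZMod p) = 0 := by rw [hk2]; simp [hN0]
    have h3 : (K 2 1 : ZMod p) = 0 := by rw [hk3]; simp [hN0]
    have h4 : (K 2 3 : ZMod p) = 0 := by rw [hk4]; simp [hN0]
    rw [← ZMod.intCast_zmod_eq_zero_iff_dvd]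
    fin_cases i <;> fin_cases j <;>
      simp [atkinMat_mul_apply, mul_atkinMat_apply, hN0, h1, h2, h3, h4]
  choose k hk using hdvd
  exact ⟨Matrix.of k, by ext i j; simp [hk]⟩

/-- The integral similitudes `√p W_p` for the admissible choices of `W_p`. -/
def IsAtkinMat (N p : ℕ) (U : IMat) : Prop :=
  ∃ α β γ δ : ℤ, α * p * (δ * p) - β * N * γ = p ∧ U = atkinMat N p α β γ δ

variable {U M K : IMat} {m : ℕ}

lemma IsAtkinMat.isSim (hU : IsAtkinMat N p U) : IsSim N p U := by
  obtain ⟨α, β, γ, δ, h, rfl⟩ := hU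
  exact isSim_atkinMat h

lemma IsAtkinMat.exists_adjoint (hU : IsAtkinMat N p U) (hp : 0 < p) (hpN : p ∣ N) :
    ∃ U', IsAtkinMat N p U' ∧ U * U' = (p : ℤ) • (1 : IMat) ∧ U' * U = (p : ℤ) • (1 : IMat) ∧
      (∀ K, IsSim N 1 K → ∃ K', IsSim N 1 K' ∧ U * K * U' = (p : ℤ) • K') ∧
      ∀ K, IsSim N 1 K → ∃ K', IsSim N 1 K' ∧ U' * K * U = (p : ℤ) • K' := by
  obtain ⟨α, β, γ, δ, h, rfl⟩ := hU
  have h' : δ * p * (α * p) - (-β) * N * (-γ) = p := by linear_combination h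
  refine ⟨_, ⟨δ, -β, -γ, α, h', rfl⟩, atkinMat_mul h, ?_,
    fun K hK => exists_conj_atkinMat hp hpN h hK, fun K hK => ?_⟩
  · simpa using atkinMat_mul h'
  · simpa using exists_conj_atkinMat hp hpN h' hK

lemma IsAtkinMat.exists_mul_isometry (hU : IsAtkinMat N p U) (hp : 0 < p) (hpN : p ∣ N)
    (hK : IsSim N 1 K) : ∃ K', IsSim N 1 K' ∧ U * K = K' * U := by
  obtain ⟨U', -, -, h2, h3, -⟩ := hU.exists_adjoint hp hpN
  obtain ⟨K', hK', e⟩ := h3 K hK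
  have hp0 : (p : ℤ) ≠ 0 := by exact_mod_cast hp.ne'
  refine ⟨K', hK', smul_right_injective _ hp0 ?_⟩
  change (p : ℤ) • (U * K) = (p : ℤ) • (K' * U)
  calc (p : ℤ) • (U * K) = U * K * (U' * U) := by rw [h2, mul_smul_comm, mul_one]
    _ = U * K * U' * U := (mul_assoc _ _ _).symm
    _ = (p : ℤ) • (K' * U) := by rw [e, smul_mul_assoc]

lemma IsAtkinMat.exists_isometry_mul (hU : IsAtkinMat N p U) (hp : 0 < p) (hpN : p ∣ N)
    (hK : IsSim N 1 K) : ∃ K', IsSim N 1 K' ∧ K * U = U * K' := by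
  obtain ⟨U', -, h1, -, -, h3⟩ := hU.exists_adjoint hp hpN
  obtain ⟨K', hK', e⟩ := h3 K hK
  have hp0 : (p : ℤ) ≠ 0 := by exact_mod_cast hp.ne'
  refine ⟨K', hK', smul_right_injective _ hp0 ?_⟩
  change (p : ℤ) • (K * U) = (p : ℤ) • (U * K')
  calc (p : ℤ) • (K * U) = U * U' * (K * U) := by rw [h1, smul_mul_assoc, one_mul]
    _ = U * (U' * K * U) := by simp only [mul_assoc]
    _ = (p : ℤ) • (U * K') := by rw [e, mul_smul_comm]

/-- Every entry of U² contains p² or N, so p divides U² and W_p is an involution modulo Σ_N. -/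
lemma IsAtkinMat.exists_sq (hU : IsAtkinMat N p U) (hp : 0 < p) (hpN : p ∣ N) :
    ∃ K, IsSim N 1 K ∧ U * U = (p : ℤ) • K := by
  suffices h : ∃ K, U * U = (p : ℤ) • K by
    obtain ⟨K, e⟩ := h
    refine ⟨K, isSim_one_of_smul hp ?_, e⟩
    rw [← e, sq]
    exact hU.isSim.mul hU.isSim
  obtain ⟨α, β, γ, δ, h, rfl⟩ := hU
  obtain ⟨n, hn⟩ := hpN
  have hNp : (N : ℤ) = p * n := by exact_mod_cast hn
  refine ⟨!![α ^ 2 * p + β * γ * n, β * N * (α + δ), 0, 0;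
    γ * (α + δ), β * γ * n + δ ^ 2 * p, 0, 0;
    0, 0, δ ^ 2 * p + β * γ * n, -γ * N * (α + δ); 0, 0, -β * (α + δ), α ^ 2 * p + β * γ * n], ?_⟩
  ext i j
  fin_cases i <;> fin_cases j <;> simp [atkinMat, Matrix.mul_apply, Fin.sum_univ_four, hNp] <;>
    ring

lemma IsAtkinMat.rep [NeZero N] (hp : 0 < p) {W : rationalGroup} (hW : IsAtkinLehner N p W) :
    ∃ U, IsAtkinMat N p U ∧ Rep N (W : Sp2) U p := by
  obtain ⟨α, β, γ, δ, V, hV, hdet, hW⟩ := hW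
  have hp0 : (p : ℝ) ≠ 0 := by exact_mod_cast hp.ne'
  have hN : (N : ℝ) ≠ 0 := NeZero.ne _
  have h1 : √(p : ℝ) ≠ 0 := by positivity
  have h2 : √(p : ℝ) ^ 2 = p := Real.sq_sqrt (Nat.cast_nonneg p)
  have hreal : (α : ℝ) * p * (δ * p) - β * N * γ = p := by
    rw [hV, det_smul, det_fin_two_of, Fintype.card_fin, div_pow, h2, one_pow] at hdet
    field_simp at hdet
    linear_combination hdet
  have hint : α * p * (δ * p) - β * N * γ = p := by exact_mod_cast hreal
  have hinv : (Vᵀ)⁻¹ = (1 / √(p : ℝ)) • !![(δ : ℝ) * p, -γ; -(β * N), α * p] := by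
    apply Matrix.inv_eq_right_inv
    ext i j
    fin_cases i <;> fin_cases j <;> simp [hV, Matrix.mul_apply] <;> field_simp <;>
      simp only [h2] <;> first | ring1 | linear_combination hreal
  refine ⟨_, ⟨α, β, γ, δ, hint, rfl⟩, hp, ?_⟩
  rw [hW, hinv, hV, toReal, fromBlocks_smul]
  congr 1 <;> ext i j <;> fin_cases i <;> fin_cases j <;> simp [atkinMat] <;> field_simp <;> simp

section

variable [NeZero N]

/-- As W_p normalizes Σ_N, its double coset is a single coset, so multiplication by it only
translates the representative. -/
lemma IsAtkinMat.simCoset_mul (hU : IsAtkinMat N p U) (hp : 0 < p) (hpN : p ∣ N) (hm : 0 < m)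
    (hM : IsSim N m M) : simCoset N p U * simCoset N m M = simCoset N (p * m) (U * M) := by
  have hd : U.det ≠ 0 := hU.isSim.det_ne_zero hp
  refine simCoset_mul_simCoset hp hm hU.isSim hM (fun K hK => ?_) ?_
  · obtain ⟨K', hK', e⟩ := hU.exists_mul_isometry hp hpN hK
    rw [e, mul_assoc]
    exact equivalent_mul_left hK' _
  · rintro X Y ⟨K₁, K₂, hK₁, hK₂, rfl⟩ - e
    obtain ⟨K₃, hK₃, e3⟩ := hU.exists_isometry_mul hp hpN hK₁
    rw [e3, mul_assoc U, mul_assoc U] at e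
    have e4 := mul_left_cancel_of_det_ne_zero hd e
    obtain ⟨L, h1, h2, hL⟩ := (hK₂.isometry_mul hK₃).exists_inv
    refine ⟨L, hL, ?_⟩
    rw [← e4, ← mul_assoc, h2, one_mul]

lemma IsAtkinMat.mul_simCoset (hU : IsAtkinMat N p U) (hp : 0 < p) (hpN : p ∣ N) (hm : 0 < m)
    (hM : IsSim N m M) : simCoset N m M * simCoset N p U = simCoset N (m * p) (M * U) := by
  refine simCoset_mul_simCoset hm hp hM hU.isSim (fun K hK => ?_) ?_
  · obtain ⟨K', hK', e⟩ := hU.exists_isometry_mul hp hpN hK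
    rw [mul_assoc, e, ← mul_assoc]
    exact equivalent_mul_right hK' _
  · rintro X Y - ⟨K₁, K₂, hK₁, hK₂, rfl⟩ -
    obtain ⟨K₃, hK₃, e3⟩ := hU.exists_mul_isometry hp hpN hK₂
    exact ⟨K₁ * K₃, hK₃.isometry_mul hK₁, by rw [mul_assoc, e3, mul_assoc]⟩

lemma IsAtkinMat.simCoset_sq (hU : IsAtkinMat N p U) (hp : 0 < p) (hpN : p ∣ N) :
    simCoset N p U * simCoset N p U = 1 := by
  obtain ⟨K, hK, e⟩ := hU.exists_sq hp hpN
  rw [hU.simCoset_mul hp hpN hp hU.isSim, e, ← simCoset_eq_one hK, ← simCoset_smul one_pos hK hp,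
    mul_one, sq]

/-- The coset of W_p is its own inverse, so membership can be tested after translation. -/
lemma IsAtkinMat.mem_of_mul_mem (hU : IsAtkinMat N p U) (hp : 0 < p) (hpN : p ∣ N) (hm : 0 < m)
    (hM : IsSim N m M) {S : Subring (HeckeAlgebra N)} (hS : simCoset N p U ∈ S)
    (h : simCoset N (p * m) (U * M) ∈ S) : simCoset N m M ∈ S := by
  rw [← hU.simCoset_mul hp hpN hm hM] at h
  have := S.mul_mem hS h
  rwa [← mul_assoc, hU.simCoset_sq hp hpN, one_mul] at this

lemma IsAtkinMat.mem_of_mem_mul (hU : IsAtkinMat N p U) (hp : 0 < p) (hpN : p ∣ N) (hm : 0 < m)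
    (hM : IsSim N m M) {S : Subring (HeckeAlgebra N)} (hS : simCoset N p U ∈ S)
    (h : simCoset N (m * p) (M * U) ∈ S) : simCoset N m M ∈ S := by
  rw [← hU.mul_simCoset hp hpN hm hM] at h
  have := S.mul_mem h hS
  rwa [mul_assoc, hU.simCoset_sq hp hpN, mul_one] at this

end

/-! ### Reduction to dominant similitudes -/

/-- If the block on the plane (0, 2) vanishes modulo p, adding column 1 or 3 to column 0 brings the
unit into it. The second condition of dominance is empty for p ∤ N. -/
lemma exists_equivalent_isDominant_of_upper (hpN : ¬ p ∣ N) {i : Fin 4} (hi : i = 0 ∨ i = 2)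
    {j : Fin 4} (hij : ¬ (p : ℤ) ∣ M i j) : ∃ X, Equivalent N M X ∧ IsDominant N p X := by
  by_cases hA : ¬ (p : ℤ) ∣ M 0 0 ∨ ¬ (p : ℤ) ∣ M 0 2 ∨ ¬ (p : ℤ) ∣ M 2 0 ∨ ¬ (p : ℤ) ∣ M 2 2
  · exact ⟨M, .refl M, hA, fun h => absurd h hpN⟩
  · push Not at hA
    obtain ⟨h00, h02, h20, h22⟩ := hA
    have hi0 : (p : ℤ) ∣ M i 0 := by rcases hi with rfl | rfl <;> assumption
    have hi2 : (p : ℤ) ∣ M i 2 := by rcases hi with rfl | rfl <;> assumption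
    suffices h : ∃ K, IsSim N 1 K ∧ ¬ (p : ℤ) ∣ (M * K) i 0 by
      obtain ⟨K, hK, h⟩ := h
      refine ⟨M * K, equivalent_mul_right hK M, ?_, fun h => absurd h hpN⟩
      rcases hi with rfl | rfl
      · exact Or.inl h
      · exact Or.inr (Or.inr (Or.inl h))
    fin_cases j
    · exact absurd hi0 hij
    · refine ⟨lowerLevi N 1, isSim_lowerLevi 1, ?_⟩
      have : (M * lowerLevi N 1) i 0 = M i 0 + M i 1 := by
        simp [Matrix.mul_apply, Fin.sum_univ_four, lowerLevi]
      rw [this, dvd_add_right hi0]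
      exact hij
    · exact absurd hi2 hij
    · refine ⟨lowerMixed N 1, isSim_lowerMixed 1, ?_⟩
      have : (M * lowerMixed N 1) i 0 = M i 0 + M i 3 := by
        simp [Matrix.mul_apply, Fin.sum_univ_four, lowerMixed]
      rw [this, dvd_add_right hi0]
      exact hij

/-- If row 0 vanishes modulo p, a unit in row 1 or 3 is carried into row 0 by an elementary isometry
with coefficient ±N, a unit at p. -/
lemma exists_equivalent_isDominant (hp : p.Prime) (hpN : ¬ p ∣ N) {i j : Fin 4}
    (hij : ¬ (p : ℤ) ∣ M i j) : ∃ X, Equivalent N M X ∧ IsDominant N p X := by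
  have hN : ¬ (p : ℤ) ∣ N := by rwa [Int.natCast_dvd_natCast]
  by_cases h0 : ∃ j, ¬ (p : ℤ) ∣ M 0 j
  · obtain ⟨j, h⟩ := h0
    exact exists_equivalent_isDominant_of_upper hpN (Or.inl rfl) h
  · push Not at h0
    suffices h : ∃ K, IsSim N 1 K ∧ ∃ i j, (i = 0 ∨ i = 2) ∧ ¬ (p : ℤ) ∣ (K * M) i j by
      obtain ⟨K, hK, i, j, hi, h⟩ := h
      obtain ⟨X, h1, h2⟩ := exists_equivalent_isDominant_of_upper hpN hi h
      exact ⟨X, (equivalent_mul_left hK M).trans h1, h2⟩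
    fin_cases i
    · exact absurd (h0 j) hij
    · refine ⟨upperLevi N 1, isSim_upperLevi 1, 0, j, Or.inl rfl, fun h => hij ?_⟩
      rw [(upperLevi_mul_apply 1 M j).1, dvd_sub_right (h0 j), mul_one] at h
      exact ((Nat.prime_iff_prime_int.1 hp).dvd_or_dvd h).resolve_left hN
    · exact ⟨1, isSim_one, 2, j, Or.inr rfl, by rwa [one_mul]⟩
    · refine ⟨upperMixed N 1, isSim_upperMixed 1, 0, j, Or.inl rfl, fun h => hij ?_⟩
      rw [(upperMixed_mul_apply 1 M j).1, dvd_add_right (h0 j), mul_one] at h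
      exact ((Nat.prime_iff_prime_int.1 hp).dvd_or_dvd h).resolve_left hN

/-- Modulo p only the block from the plane (0, 2) to (1, 3) survives. Left multiplication by U/p
moves it into the block on (0, 2), up to units and terms divisible by p. -/
lemma IsAtkinMat.exists_isDominant_of_lowerLeft (hU : IsAtkinMat N p U) (hp : p.Prime)
    (hpN : p ∣ N)
    (hA : ∀ j, (p : ℤ) ∣ M 0 j ∧ (p : ℤ) ∣ M 2 j)
    (hD : (p : ℤ) ∣ M 1 1 ∧ (p : ℤ) ∣ M 1 3 ∧ (p : ℤ) ∣ M 3 1 ∧ (p : ℤ) ∣ M 3 3)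
    (hC : ¬ (p : ℤ) ∣ M 1 0 ∨ ¬ (p : ℤ) ∣ M 1 2 ∨ ¬ (p : ℤ) ∣ M 3 0 ∨ ¬ (p : ℤ) ∣ M 3 2) :
    ∃ X, U * M = (p : ℤ) • X ∧ IsDominant N p X := by
  obtain ⟨α, β, γ, δ, h, rfl⟩ := hU
  obtain ⟨n, hn⟩ := hpN
  have hNp : (N : ℤ) = p * n := by exact_mod_cast hn
  have hpp := Nat.prime_iff_prime_int.1 hp
  have hp0 : (p : ℤ) ≠ 0 := hpp.ne_zero
  -- The determinant condition divided by p; it makes β, n and γ units modulo p.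
  have h1 : p * (α * δ) - β * n * γ = 1 := by
    refine mul_left_cancel₀ hp0 ?_
    rw [hNp] at h
    linear_combination h
  have hunit : ∀ a : ℤ, a ∣ β * n * γ → ¬ (p : ℤ) ∣ a := fun a ha hpa =>
    hpp.not_dvd_one (h1 ▸ dvd_sub (dvd_mul_right _ _) (hpa.trans ha))
  have hbn := hunit (β * n) (dvd_mul_right _ _)
  have hgn := hunit (γ * n) ⟨β, by ring⟩
  choose k hk0 using fun j => (hA j).1
  choose l hl using fun j => (hA j).2
  refine ⟨Matrix.of ![fun j => α * M 0 j + β * n * M 1 j, fun j => γ * k j + δ * M 1 j,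
    fun j => δ * M 2 j - γ * n * M 3 j, fun j => -β * l j + α * M 3 j], ?_, ?_, ?_⟩
  · ext i j
    obtain ⟨e0, e1, e2, e3⟩ := atkinMat_mul_apply (N := N) (p := p) (α := α) (β := β) (γ := γ)
      (δ := δ) M j
    fin_cases i
    · simp [e0, hNp]; ring
    · simp [e1, hk0 j]; ring
    · simp [e2, hNp]; ring
    · simp [e3, hl j]; ring
  · have key : ∀ a c x y : ℤ, (p : ℤ) ∣ x → ¬ (p : ℤ) ∣ c → ¬ (p : ℤ) ∣ y →
        ¬ (p : ℤ) ∣ a * x + c * y := fun a c x y hx hc hy h => by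
      rw [dvd_add_right (hx.mul_left a)] at h
      exact (hpp.dvd_or_dvd h).elim hc hy
    have key' : ∀ a c x y : ℤ, (p : ℤ) ∣ x → ¬ (p : ℤ) ∣ c → ¬ (p : ℤ) ∣ y →
        ¬ (p : ℤ) ∣ a * x - c * y := fun a c x y hx hc hy h => by
      rw [dvd_sub_right (hx.mul_left a)] at h
      exact (hpp.dvd_or_dvd h).elim hc hy
    have h0 : ∀ j, (p : ℤ) ∣ M 0 j := fun j => ⟨_, hk0 j⟩
    have h2 : ∀ j, (p : ℤ) ∣ M 2 j := fun j => ⟨_, hl j⟩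
    rcases hC with hC | hC | hC | hC
    · exact Or.inl (key α _ _ _ (h0 0) hbn hC)
    · exact Or.inr (Or.inl (key α _ _ _ (h0 2) hbn hC))
    · exact Or.inr (Or.inr (Or.inl (key' δ _ _ _ (h2 0) hgn hC)))
    · exact Or.inr (Or.inr (Or.inr (key' δ _ _ _ (h2 2) hgn hC)))
  · intro _
    obtain ⟨d1, d2, d3, d4⟩ := hD
    refine ⟨?_, ?_, ?_, ?_⟩
    · exact dvd_add (Dvd.intro _ (hk0 1).symm |>.mul_left _) (d1.mul_left _)
    · exact dvd_add (Dvd.intro _ (hk0 3).symm |>.mul_left _) (d2.mul_left _)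
    · exact dvd_sub (Dvd.intro _ (hl 1).symm |>.mul_left _) (d3.mul_left _)
    · exact dvd_sub (Dvd.intro _ (hl 3).symm |>.mul_left _) (d4.mul_left _)

/-- At a prime dividing the level exactly once, a primitive matrix becomes dominant after
multiplication by Atkin–Lehner similitudes. -/
lemma IsAtkinMat.exists_isDominant (hU : IsAtkinMat N p U) (hp : p.Prime)
    (hpN : p ∣ N) {i j : Fin 4} (hij : ¬ (p : ℤ) ∣ M i j) :
    IsDominant N p M ∨ (∃ X, U * M = (p : ℤ) • X ∧ IsDominant N p X) ∨
    ((∃ X, U * M * U = (p : ℤ) • X ∧ IsDominant N p X) ∧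
      ¬ ((p : ℤ) ∣ M 1 1 ∧ (p : ℤ) ∣ M 1 3 ∧ (p : ℤ) ∣ M 3 1 ∧ (p : ℤ) ∣ M 3 3)) ∨
    (IsDominant N p (M * U) ∧
      ¬ ((p : ℤ) ∣ M 0 1 ∧ (p : ℤ) ∣ M 0 3 ∧ (p : ℤ) ∣ M 2 1 ∧ (p : ℤ) ∣ M 2 3)) := by
  have hpp := Nat.prime_iff_prime_int.1 hp
  have hNp : (p : ℤ) ∣ N := by exact_mod_cast hpN
  obtain ⟨α, β, γ, δ, h, hUe⟩ := id hU
  have hunit : ∀ a : ℤ, a = β ∨ a = γ → ¬ (p : ℤ) ∣ a := by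
    obtain ⟨n, hn⟩ := hNp
    have h1 : p * (α * δ) - β * n * γ = 1 := by
      refine mul_left_cancel₀ hpp.ne_zero ?_
      rw [hn] at h
      linear_combination h
    rintro a (rfl | rfl) ha
    · exact hpp.not_dvd_one (h1 ▸ dvd_sub (dvd_mul_right _ _) (ha.trans ⟨n * γ, by ring⟩))
    · exact hpp.not_dvd_one (h1 ▸ dvd_sub (dvd_mul_right _ _) (ha.trans ⟨β * n, by ring⟩))
  -- Modulo p, right multiplication by U moves columns 1 and 3 to columns 0 and 2 up to units, and
  -- annihilates what arrives in columns 1 and 3.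
  have hmulU : ∀ i, ((p : ℤ) ∣ (M * U) i 0 ↔ (p : ℤ) ∣ M i 1) ∧ (p : ℤ) ∣ (M * U) i 1 ∧
      ((p : ℤ) ∣ (M * U) i 2 ↔ (p : ℤ) ∣ M i 3) ∧ (p : ℤ) ∣ (M * U) i 3 := by
    intro i
    obtain ⟨e0, e1, e2, e3⟩ := mul_atkinMat_apply (N := N) (p := p) (α := α) (β := β) (γ := γ)
      (δ := δ) M i
    rw [← hUe] at e0 e1 e2 e3
    rw [e0, e1, e2, e3]
    refine ⟨?_, ?_, ?_, ?_⟩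
    · rw [dvd_add_right (by exact ⟨M i 0 * α, by ring⟩)]
      exact ⟨fun h => (hpp.dvd_or_dvd h).resolve_right (hunit _ (Or.inr rfl)),
        fun h => h.mul_right _⟩
    · exact dvd_add ((hNp.mul_left _).mul_left _) (((dvd_refl _).mul_left _).mul_left _)
    · rw [dvd_sub_right (by exact ⟨M i 2 * δ, by ring⟩)]
      exact ⟨fun h => (hpp.dvd_or_dvd h).resolve_right (hunit _ (Or.inl rfl)),
        fun h => h.mul_right _⟩
    · exact dvd_add ((hNp.mul_left _).mul_left _).neg_right
        (((dvd_refl _).mul_left _).mul_left _)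
  -- Go through the four blocks modulo p. If the upper right one survives, MU is dominant;
  -- otherwise, if the upper left one does, M is. When both vanish, UM/p works if the lower right
  -- block vanishes, and UMU/p if it does not.
  by_cases hB : (p : ℤ) ∣ M 0 1 ∧ (p : ℤ) ∣ M 0 3 ∧ (p : ℤ) ∣ M 2 1 ∧ (p : ℤ) ∣ M 2 3
  swap
  · refine Or.inr (Or.inr (Or.inr ⟨⟨?_, fun _ => ?_⟩, hB⟩))
    · simp only [hmulU]
      tauto
    · exact ⟨(hmulU 0).2.1, (hmulU 0).2.2.2, (hmulU 2).2.1, (hmulU 2).2.2.2⟩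
  by_cases hA : ¬ (p : ℤ) ∣ M 0 0 ∨ ¬ (p : ℤ) ∣ M 0 2 ∨ ¬ (p : ℤ) ∣ M 2 0 ∨ ¬ (p : ℤ) ∣ M 2 2
  · exact Or.inl ⟨hA, fun _ => hB⟩
  push Not at hA
  obtain ⟨a1, a2, a3, a4⟩ := hA
  obtain ⟨b1, b2, b3, b4⟩ := id hB
  by_cases hD : (p : ℤ) ∣ M 1 1 ∧ (p : ℤ) ∣ M 1 3 ∧ (p : ℤ) ∣ M 3 1 ∧ (p : ℤ) ∣ M 3 3
  · refine Or.inr (Or.inl (hU.exists_isDominant_of_lowerLeft hp hpN (fun j => ?_) hD ?_))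
    · fin_cases j
      exacts [⟨a1, a3⟩, ⟨b1, b3⟩, ⟨a2, a4⟩, ⟨b2, b4⟩]
    · obtain ⟨d1, d2, d3, d4⟩ := hD
      by_contra! hC
      obtain ⟨c1, c2, c3, c4⟩ := hC
      apply hij
      fin_cases i <;> fin_cases j <;> assumption
  · refine Or.inr (Or.inr (Or.inl ⟨?_, hD⟩))
    rw [mul_assoc]
    refine hU.exists_isDominant_of_lowerLeft hp hpN (fun j => ?_) ?_ ?_
    · fin_cases j
      exacts [⟨(hmulU 0).1.2 b1, (hmulU 2).1.2 b3⟩, ⟨(hmulU 0).2.1, (hmulU 2).2.1⟩,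
        ⟨(hmulU 0).2.2.1.2 b2, (hmulU 2).2.2.1.2 b4⟩, ⟨(hmulU 0).2.2.2, (hmulU 2).2.2.2⟩]
    · exact ⟨(hmulU 1).2.1, (hmulU 1).2.2.2, (hmulU 3).2.1, (hmulU 3).2.2.2⟩
    · simp only [hmulU]
      tauto

end

/-! ### Divisibility of minors and of blocks -/

/-- All `2 × 2` minors of `M` are divisible by `d`. -/
def MinorsDvd (d : ℤ) (M : IMat) : Prop := ∀ i j k l, d ∣ M i k * M j l - M i l * M j k

/-- The block of `M` from the coordinate plane `(1, 3)` to the plane `(0, 2)` is divisible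
by `p`. -/
def UpperDvd (p : ℕ) (M : IMat) : Prop :=
  (p : ℤ) ∣ M 0 1 ∧ (p : ℤ) ∣ M 0 3 ∧ (p : ℤ) ∣ M 2 1 ∧ (p : ℤ) ∣ M 2 3

section

variable {N p : ℕ} {d : ℤ} {M M' X : IMat}

lemma minorsDvd_one (M : IMat) : MinorsDvd 1 M := fun _ _ _ _ => one_dvd _

/-- Minors are linear in each row. The mixed form, with K applied to one row only, is also what
`exists_isometry_mul_stdMat_two` needs. -/
lemma MinorsDvd.mul_left_row (h : MinorsDvd d M) (K : IMat) (i j k l : Fin 4) :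
    d ∣ (K * M) i k * M j l - (K * M) i l * M j k := by
  have : (K * M) i k * M j l - (K * M) i l * M j k =
      ∑ a, K i a * (M a k * M j l - M a l * M j k) := by
    simp only [Matrix.mul_apply, Finset.sum_mul, ← Finset.sum_sub_distrib]
    exact Finset.sum_congr rfl fun a _ => by ring
  rw [this]
  exact Finset.dvd_sum fun a _ => (h a j k l).mul_left _

lemma MinorsDvd.mul_left (h : MinorsDvd d M) (K : IMat) : MinorsDvd d (K * M) := by
  intro i j k l
  have : (K * M) i k * (K * M) j l - (K * M) i l * (K * M) j k =
      ∑ a, K j a * ((K * M) i k * M a l - (K * M) i l * M a k) := by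
    rw [Matrix.mul_apply (i := j) (k := l), Matrix.mul_apply (i := j) (k := k)]
    simp only [Finset.mul_sum, ← Finset.sum_sub_distrib]
    exact Finset.sum_congr rfl fun a _ => by ring
  rw [this]
  exact Finset.dvd_sum fun a _ => (h.mul_left_row K i a k l).mul_left _

lemma MinorsDvd.transpose (h : MinorsDvd d M) : MinorsDvd d Mᵀ := by
  intro i j k l
  have := h k l i j
  simp only [transpose_apply]
  rwa [mul_comm (M l i)]

lemma MinorsDvd.mul_right (h : MinorsDvd d M) (K : IMat) : MinorsDvd d (M * K) := by
  have := (h.transpose.mul_left Kᵀ).transpose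
  rwa [transpose_mul, transpose_transpose, transpose_transpose] at this

lemma MinorsDvd.equivalent (h : MinorsDvd d M) (e : Equivalent N M X) : MinorsDvd d X := by
  obtain ⟨K, K', -, -, rfl⟩ := e
  exact (h.mul_left K).mul_right K'

lemma MinorsDvd.diagonal_mul {c : ℤ} {u : Fin 4 → ℤ} (h : MinorsDvd d M)
    (hu : ∀ i j, i ≠ j → c ∣ u i * u j) : MinorsDvd (c * d) (diagonal u * M) := by
  intro i j k l
  simp only [Matrix.diagonal_mul]
  by_cases hij : i = j
  · subst hij
    rw [mul_comm (u i * M i l), sub_self]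
    exact dvd_zero _
  · have e : u i * M i k * (u j * M j l) - u i * M i l * (u j * M j k) =
        u i * u j * (M i k * M j l - M i l * M j k) := by ring
    rw [e]
    exact mul_dvd_mul (hu i j hij) (h i j k l)

lemma MinorsDvd.mul_diagonal {c : ℤ} {u : Fin 4 → ℤ} (h : MinorsDvd d M)
    (hu : ∀ i j, i ≠ j → c ∣ u i * u j) : MinorsDvd (d * c) (M * diagonal u) := by
  have := (h.transpose.diagonal_mul hu).transpose
  rwa [transpose_mul, transpose_transpose, diagonal_transpose, mul_comm c] at this

lemma dvd_stdMat_mul {v f : ℕ} (h : 2 * f ≤ v) (i j : Fin 4) (hij : i ≠ j) :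
    (p : ℤ) ^ f ∣ ![1, (p : ℤ) ^ f, (p : ℤ) ^ v, (p : ℤ) ^ (v - f)] i *
      ![1, (p : ℤ) ^ f, (p : ℤ) ^ v, (p : ℤ) ^ (v - f)] j := by
  have h1 : (p : ℤ) ^ f ∣ (p : ℤ) ^ v := pow_dvd_pow _ (by omega)
  have h2 : (p : ℤ) ^ f ∣ (p : ℤ) ^ (v - f) := pow_dvd_pow _ (by omega)
  fin_cases i <;> fin_cases j <;> first
    | exact absurd rfl hij
    | simp [h1, h2, Dvd.dvd.mul_left]

lemma minorsDvd_stdMat {v f : ℕ} (h : 2 * f ≤ v) : MinorsDvd ((p : ℤ) ^ f) (stdMat p v f) := by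
  have := (minorsDvd_one 1).diagonal_mul (dvd_stdMat_mul (p := p) h)
  rwa [mul_one, mul_one] at this

/-- The minor in rows and columns 0, 1 is p^f'. Thus divisibility of minors, an invariant of double
cosets, bounds the elementary divisor from below. -/
lemma le_of_minorsDvd_stdMat (hp : p.Prime) {v f f' : ℕ}
    (h : MinorsDvd ((p : ℤ) ^ f) (stdMat p v f')) : f ≤ f' := by
  have := h 0 1 0 1
  simp only [stdMat, diagonal_apply_eq, diagonal_apply_ne _ (show (0 : Fin 4) ≠ 1 by decide),
    zero_mul, sub_zero] at this
  have h2 : p ^ f ∣ p ^ f' := by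
    have h3 : (p : ℤ) ^ f ∣ (p : ℤ) ^ f' := by simpa using this
    exact_mod_cast h3
  exact (Nat.pow_dvd_pow_iff_le_right hp.one_lt).1 h2

lemma UpperDvd.mul (h : UpperDvd p M) (h' : UpperDvd p M') : UpperDvd p (M * M') := by
  simp only [UpperDvd, ← ZMod.intCast_zmod_eq_zero_iff_dvd] at *
  simp [Matrix.mul_apply, Fin.sum_univ_four, h, h']

lemma upperDvd_diagonal (u : Fin 4 → ℤ) : UpperDvd p (diagonal u) := by
  simp [UpperDvd]

lemma IsSim.upperDvd (h : IsSim N 1 M) (hp : p ∣ N) : UpperDvd p M := by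
  have : (p : ℤ) ∣ N := by exact_mod_cast hp
  obtain ⟨h1, h2, h3, h4⟩ := h.dvd
  exact ⟨this.trans h1, this.trans h2, this.trans h3, this.trans h4⟩

lemma UpperDvd.equivalent (h : UpperDvd p M) (hp : p ∣ N) (e : Equivalent N M X) :
    UpperDvd p X := by
  obtain ⟨K, K', hK, hK', rfl⟩ := e
  exact ((hK.upperDvd hp).mul h).mul (hK'.upperDvd hp)

lemma exists_eq_mul_diagonal {u : Fin 4 → ℤ} (h : ∀ i j, u j ∣ M i j) :
    ∃ K, M = K * diagonal u := by
  choose k hk using h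
  refine ⟨Matrix.of k, ?_⟩
  ext i j
  rw [Matrix.mul_diagonal, hk, mul_comm]
  rfl

/-! ### Right factors of standard matrices -/

variable [NeZero N] {m : ℕ} {T Y : IMat}

/-- The dual identity inverts Y integrally: pairing the rows of T = XY with those of Y gives
multiples of m. -/
lemma IsSim.mul_dualForm_mul_transpose (hY : IsSim N m Y) (hm : 0 < m) (e : X * Y = T) :
    T * dualForm N * Yᵀ = (m : ℤ) • (X * dualForm N) := by
  rw [← e, mul_assoc, mul_assoc, ← mul_assoc Y, hY.dual hm, mul_smul_comm]

omit [NeZero N] in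
lemma pow_dvd_of_level_mul_eq (hp : p.Prime) (hN : ¬ p ^ 2 ∣ N) {k : ℕ} {x z : ℤ}
    (e : N * x = (p : ℤ) ^ k * z) (hz : p ∣ N → (p : ℤ) ∣ z) : (p : ℤ) ^ k ∣ x := by
  by_cases hpN : p ∣ N
  · exact pow_dvd_of_level_mul hp hN (e ▸ pow_succ (p : ℤ) k ▸ mul_dvd_mul_left _ (hz hpN))
  · refine (Nat.prime_iff_prime_int.1 hp).pow_dvd_of_dvd_mul_left k ?_ (Dvd.intro _ e.symm)
    rwa [Int.natCast_dvd_natCast]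

/-- Row 0 of the preceding identity, since row 0 of the diagonal matrix is e₀. It carries a factor
N; if p ∣ N, the lost p is recovered because row 0 of X times the dual form is divisible by p. -/
lemma pow_dvd_right_factor (hp : p.Prime) (hN : ¬ p ^ 2 ∣ N) {k : ℕ} {u : Fin 4 → ℤ}
    (hY : IsSim N (p ^ k) Y) (e : X * Y = diagonal u) (hu : u 0 = 1)
    (hX : p ∣ N → UpperDvd p X) (j : Fin 4) : (p : ℤ) ^ k ∣ Y j 2 := by
  have h := congrFun (congrFun (hY.mul_dualForm_mul_transpose (pow_pos hp.pos k) e) 0) j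
  have h2 : N * Y j 2 = (p : ℤ) ^ k * -(X * dualForm N) 0 j := by
    simp only [mul_assoc, Matrix.diagonal_mul, hu, one_mul, Matrix.smul_apply, smul_eq_mul,
      Nat.cast_pow] at h
    rw [mul_neg, ← h]
    simp [Matrix.mul_apply, Fin.sum_univ_four, dualForm]
  refine pow_dvd_of_level_mul_eq hp hN h2 fun hpN => ?_
  obtain ⟨h1, h3, -, -⟩ := hX hpN
  have h4 : (p : ℤ) ∣ N := by exact_mod_cast hpN
  rw [dvd_neg]
  fin_cases j <;> simp [Matrix.mul_apply, Fin.sum_univ_four, dualForm, h1, h3, h4,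
    Dvd.dvd.mul_left]

/-- The same argument in row 1, where the entry of the dual form is a unit and nothing is lost. -/
lemma pow_dvd_right_factor' (hp : p.Prime) {k : ℕ} {u : Fin 4 → ℤ}
    (hY : IsSim N (p ^ k) Y) (e : X * Y = diagonal u) (hu : u 1 = 1) (j : Fin 4) :
    (p : ℤ) ^ k ∣ Y j 3 := by
  have h := congrFun (congrFun (hY.mul_dualForm_mul_transpose (pow_pos hp.pos k) e) 1) j
  have h2 : Y j 3 = (p : ℤ) ^ k * -(X * dualForm N) 1 j := by
    simp only [mul_assoc, Matrix.diagonal_mul, hu, one_mul, Matrix.smul_apply, smul_eq_mul,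
      Nat.cast_pow] at h
    rw [mul_neg, ← h]
    simp [Matrix.mul_apply, Fin.sum_univ_four, dualForm]
  exact ⟨_, h2⟩

/-- Uniqueness of the right factor, giving multiplicity one for products with T₁(p): columns 2 and 3
of Y are divisible by p. -/
lemma exists_isometry_mul_stdMat_one (hp : p.Prime) (hN : ¬ p ^ 2 ∣ N) {v : ℕ}
    (hY : IsSim N p Y) (e : X * Y = stdMat p v 0) (hX : p ∣ N → UpperDvd p X) :
    ∃ K, IsSim N 1 K ∧ Y = K * stdMat p 1 0 := by
  rw [← pow_one p] at hY
  have h2 := pow_dvd_right_factor hp hN hY e rfl hX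
  have h3 := pow_dvd_right_factor' hp hY e (by simp)
  obtain ⟨K, hK⟩ := exists_eq_mul_diagonal (M := Y)
    (u := ![1, (p : ℤ) ^ 0, (p : ℤ) ^ 1, (p : ℤ) ^ (1 - 0)]) (fun i j => by
      fin_cases j
      · simp
      · simp
      · exact h2 i
      · exact h3 i)
  refine ⟨K, (isSim_stdMat p (v := 1) (f := 0) (by simp)).of_mul_right (pow_pos hp.pos 1) ?_, hK⟩
  rw [one_mul]
  exact hK ▸ hY

/-- The analogue for T₂(p). Column 2 of Y is divisible by p² by duality; columns 1 and 3 are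
divisible by p because the minors of Y are and row 0 of XY is e₀. -/
lemma exists_isometry_mul_stdMat_two (hp : p.Prime) (hN : ¬ p ^ 2 ∣ N) {v f : ℕ}
    (hY : IsSim N (p ^ 2) Y) (e : X * Y = stdMat p v f) (hX : p ∣ N → UpperDvd p X)
    (hY' : MinorsDvd p Y) :
    ∃ K, IsSim N 1 K ∧ Y = K * stdMat p 2 1 := by
  have h2 := pow_dvd_right_factor hp hN hY e rfl hX
  have hrow : ∀ i j, j ≠ 0 → (p : ℤ) ∣ Y i j := by
    intro i j hj
    have := hY'.mul_left_row X 0 i 0 j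
    rw [e, stdMat, diagonal_apply_eq, diagonal_apply_ne' _ hj] at this
    simpa using this
  obtain ⟨K, hK⟩ := exists_eq_mul_diagonal (M := Y)
    (u := ![1, (p : ℤ) ^ 1, (p : ℤ) ^ 2, (p : ℤ) ^ (2 - 1)]) (fun i j => by
      fin_cases j
      · simp
      · simpa using hrow i 1 (by decide)
      · exact h2 i
      · simpa using hrow i 3 (by decide))
  refine ⟨K, (isSim_stdMat p (v := 2) (f := 1) (by simp)).of_mul_right (pow_pos hp.pos 2) ?_, hK⟩
  rw [one_mul]
  exact hK ▸ hY

lemma stdMat_mul_one {v : ℕ} : stdMat p v 0 * stdMat p 1 0 = stdMat p (v + 1) 0 := by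
  simp only [stdMat, diagonal_mul_diagonal]
  congr 1
  ext i
  fin_cases i <;> simp [pow_succ]

lemma stdMat_mul_two {v f : ℕ} (h : f ≤ v) :
    stdMat p v f * stdMat p 2 1 = stdMat p (v + 2) (f + 1) := by
  simp only [stdMat, diagonal_mul_diagonal]
  congr 1
  ext i
  have : v + 2 - (f + 1) = v - f + 1 := by omega
  fin_cases i <;> simp [pow_succ, this, mul_assoc]

end

section

variable {N : ℕ} [NeZero N] {p m v f w : ℕ} {M X U : IMat} {S : Subring (HeckeAlgebra N)}

/-! ### Subrings containing the local generators -/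

omit [NeZero N] in
lemma IsSim.exists_of_mul_smul {n : ℕ} (hp : p.Prime) (hm : ¬ p ∣ m)
    (h : IsSim N (p ^ n * m) ((p : ℤ) • X)) : ∃ k, n = k + 2 ∧ IsSim N (p ^ k * m) X := by
  have hm0 : 0 < m := Nat.pos_of_ne_zero fun h => hm (h ▸ dvd_zero p)
  obtain ⟨m', hm', e, hX⟩ := h.of_smul hp.pos (Nat.mul_pos (pow_pos hp.pos n) hm0)
  have h2 : p ^ 2 ∣ p ^ n := by
    refine (Nat.Coprime.pow_left 2 ((Nat.Prime.coprime_iff_not_dvd hp).2 hm)).dvd_of_dvd_mul_right ?_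
    exact e ▸ dvd_mul_right _ _
  obtain ⟨k, rfl⟩ : ∃ k, n = k + 2 := by
    have := (Nat.pow_dvd_pow_iff_le_right hp.one_lt).1 h2
    exact ⟨n - 2, by omega⟩
  refine ⟨k, rfl, ?_⟩
  have : m' = p ^ k * m := by
    refine Nat.eq_of_mul_eq_mul_left (pow_pos hp.pos 2) ?_
    rw [← e]
    ring
  exact this ▸ hX

/-- A subring containing the double cosets of dominant similitudes contains all of them. -/
lemma simCoset_mem_of_forall_isDominant (hp : p.Prime)
    (hU : p ∣ N → ∃ U, IsAtkinMat N p U ∧ simCoset N p U ∈ S) (hm : ¬ p ∣ m)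
    (hdom : ∀ n ≤ w + 1, ∀ X, IsSim N (p ^ n * m) X → IsDominant N p X →
      simCoset N (p ^ n * m) X ∈ S) :
    ∀ n ≤ w, ∀ M, IsSim N (p ^ n * m) M → simCoset N (p ^ n * m) M ∈ S := by
  have hm0 : 0 < m := Nat.pos_of_ne_zero fun h => hm (h ▸ dvd_zero p)
  have hpos : ∀ n, 0 < p ^ n * m := fun n => Nat.mul_pos (pow_pos hp.pos n) hm0
  have hsq : ∀ k X, IsSim N (p ^ k * m) X →
      simCoset N (p ^ (k + 2) * m) ((p : ℤ) • X) = simCoset N (p ^ k * m) X := fun k X hX => by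
    rw [← simCoset_smul (hpos k) hX hp.pos]
    congr 1
    ring
  intro n
  induction n using Nat.strong_induction_on with
  | _ n ih =>
    intro hn M hM
    by_cases hMp : ∀ i j, (p : ℤ) ∣ M i j
    · choose K hK using hMp
      obtain rfl : M = (p : ℤ) • Matrix.of K := by
        ext i j
        simp [hK]
      obtain ⟨k, rfl, hX⟩ := hM.exists_of_mul_smul hp hm
      rw [hsq k _ hX]
      exact ih k (by omega) (by omega) _ hX
    · push Not at hMp
      obtain ⟨i, j, hij⟩ := hMp
      by_cases hpN : p ∣ N
      · obtain ⟨U, hU, hUS⟩ := hU hpN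
        have e1 : p * (p ^ n * m) = p ^ (n + 1) * m := by ring
        have e2 : p ^ n * m * p = p ^ (n + 1) * m := by ring
        rcases hU.exists_isDominant hp hpN hij with h | ⟨X, hX, h⟩ | ⟨⟨X, hX, h⟩, -⟩ | ⟨h, -⟩
        · exact hdom n (by omega) M hM h
        · refine hU.mem_of_mul_mem hp.pos hpN (hpos n) hM hUS ?_
          have h2 := hU.isSim.mul hM
          rw [e1, hX] at h2
          rw [e1, hX]
          obtain ⟨k, hk, hXk⟩ := h2.exists_of_mul_smul hp hm
          rw [hk, hsq k _ hXk]
          exact hdom k (by omega) X hXk h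
        · have hUM : IsSim N (p ^ (n + 1) * m) (U * M) := e1 ▸ hU.isSim.mul hM
          refine hU.mem_of_mul_mem hp.pos hpN (hpos n) hM hUS ?_
          rw [e1]
          refine hU.mem_of_mem_mul hp.pos hpN (hpos _) hUM hUS ?_
          have e3 : p ^ (n + 1) * m * p = p ^ (n + 2) * m := by ring
          have h2 := hUM.mul hU.isSim
          rw [e3, hX] at h2
          rw [e3, hX]
          obtain ⟨k, hk, hXk⟩ := h2.exists_of_mul_smul hp hm
          rw [hk, hsq k _ hXk]
          exact hdom k (by omega) X hXk h
        -- Here the multiplier grows by a factor p; hence the bound `w + 1` in `hdom`.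
        · refine hU.mem_of_mem_mul hp.pos hpN (hpos n) hM hUS ?_
          rw [e2]
          exact hdom _ (by omega) _ (e2 ▸ hM.mul hU.isSim) h
      · obtain ⟨X, hX, h⟩ := exists_equivalent_isDominant (N := N) hp hpN hij
        rw [simCoset_eq_of_equivalent (hpos n) hM hX]
        exact hdom n (by omega) X (hX.isSim hM) h

/-- The elementary divisor theorem splits off the p-part, and coprimality turns the splitting into a
product of double cosets. -/
lemma IsDominant.simCoset_mem (hp : p.Prime) (hN : ¬ p ^ 2 ∣ N) (hm : ¬ p ∣ m)
    (hM : IsSim N (p ^ v * m) M) (h : IsDominant N p M)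
    (hstd : ∀ f, 2 * f ≤ v → simCoset N (p ^ v) (stdMat p v f) ∈ S)
    (hS : ∀ X, IsSim N m X → simCoset N m X ∈ S) : simCoset N (p ^ v * m) M ∈ S := by
  have hm0 : 0 < m := Nat.pos_of_ne_zero fun h => hm (h ▸ dvd_zero p)
  obtain ⟨f, X, hf, hX, e⟩ := h.exists_equivalent_stdMat hp hN hm hM
  have hs := isSim_stdMat (N := N) p hf
  rw [← simCoset_eq_of_equivalent (Nat.mul_pos (pow_pos hp.pos v) hm0) (hs.mul hX) e,
    ← simCoset_mul_simCoset_of_coprime (pow_pos hp.pos v) hm0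
      (Nat.Coprime.pow_left v ((Nat.Prime.coprime_iff_not_dvd hp).2 hm)) hs hX]
  exact S.mul_mem (hstd f hf) (hS X hX)

omit [NeZero N] in
/-- The Atkin–Lehner similitude commutes with `diag(1, 1, p ^ v, p ^ v)`. -/
lemma IsAtkinMat.commute_stdMat (hU : IsAtkinMat N p U) : U * stdMat p v 0 = stdMat p v 0 * U := by
  obtain ⟨α, β, γ, δ, -, rfl⟩ := hU
  ext i j
  rw [stdMat, Matrix.mul_diagonal, Matrix.diagonal_mul]
  fin_cases i <;> fin_cases j <;> simp [atkinMat, mul_comm]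

/-- Multiply UMU = pX by U on both sides. As U² is p times an isometry, M returns on the left; on
the right U passes through the isometries and commutes with diag(1, 1, p^v, p^v). -/
lemma IsAtkinMat.equivalent_stdMat_zero (hU : IsAtkinMat N p U) (hp : 0 < p) (hpN : p ∣ N)
    (hX : U * M * U = (p : ℤ) • X) (h : Equivalent N (stdMat p v 0) X) :
    Equivalent N (stdMat p v 0) M := by
  obtain ⟨K, K', hK, hK', rfl⟩ := h
  obtain ⟨L, hL, e1⟩ := hU.exists_mul_isometry hp hpN hK
  obtain ⟨L', hL', e2⟩ := hU.exists_isometry_mul hp hpN hK'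
  obtain ⟨Z, hZ, e3⟩ := hU.exists_sq hp hpN
  have hp0 : (p : ℤ) ^ 2 ≠ 0 := by positivity
  have key : Z * M * Z = L * stdMat p v 0 * (Z * L') := by
    refine smul_right_injective _ hp0 ?_
    change (p : ℤ) ^ 2 • (Z * M * Z) = (p : ℤ) ^ 2 • (L * stdMat p v 0 * (Z * L'))
    calc (p : ℤ) ^ 2 • (Z * M * Z) = (p : ℤ) • Z * M * ((p : ℤ) • Z) := by
          simp only [smul_mul_assoc, mul_smul_comm, smul_smul, sq]
      _ = U * (U * M * U) * U := by rw [← e3]; simp only [mul_assoc]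
      _ = (p : ℤ) • (U * K * stdMat p v 0 * (K' * U)) := by
          rw [hX, mul_smul_comm, smul_mul_assoc]; simp only [mul_assoc]
      _ = (p : ℤ) • (L * (U * stdMat p v 0) * U * L') := by
          rw [e1, e2]; simp only [mul_assoc]
      _ = (p : ℤ) • (L * stdMat p v 0 * (U * U) * L') := by
          rw [hU.commute_stdMat]; simp only [mul_assoc]
      _ = _ := by
          rw [e3]
          simp only [smul_mul_assoc, mul_smul_comm, smul_smul, sq, mul_assoc]
  have h1 : Equivalent N (stdMat p v 0) (Z * M * Z) :=
    key ▸ ⟨L, Z * L', hL, hL'.isometry_mul hZ, rfl⟩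
  exact h1.trans (Equivalent.symm ⟨Z, Z, hZ, hZ, rfl⟩)

lemma stdMat_dominant_cases (hp : p.Prime) (hN : ¬ p ^ 2 ∣ N) (hM : IsSim N (p ^ v) M)
    (h : IsDominant N p M) : ∃ f, 2 * f ≤ v ∧ Equivalent N (stdMat p v f) M := by
  rw [← mul_one (p ^ v)] at hM
  obtain ⟨f, X, hf, hX, e⟩ := h.exists_equivalent_stdMat hp hN
    (by rw [Nat.dvd_one]; exact hp.ne_one) hM
  exact ⟨f, hf, (equivalent_mul_right hX _).trans e⟩

/-- The double cosets which occur in the product of a standard double coset and a local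
generator, other than the leading one, lie in `S`. -/
lemma equivalent_stdMat_or_simCoset_mem (hp : p.Prime) (hN : ¬ p ^ 2 ∣ N)
    (hU : p ∣ N → ∃ U, IsAtkinMat N p U ∧ simCoset N p U ∈ S)
    (hv : ∀ w < v + 1, ∀ f, 2 * f ≤ w → simCoset N (p ^ w) (stdMat p w f) ∈ S)
    (hf : ∀ f', f < f' → 2 * f' ≤ v + 1 → simCoset N (p ^ (v + 1)) (stdMat p (v + 1) f') ∈ S)
    (hM : IsSim N (p ^ (v + 1)) M) (hminor : MinorsDvd ((p : ℤ) ^ f) M)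
    (hB : p ∣ N → UpperDvd p M)
    (hD : f ≠ 0 → (p : ℤ) ∣ M 1 1 ∧ (p : ℤ) ∣ M 1 3 ∧ (p : ℤ) ∣ M 3 1 ∧ (p : ℤ) ∣ M 3 3) :
    Equivalent N (stdMat p (v + 1) f) M ∨ simCoset N (p ^ (v + 1)) M ∈ S := by
  have hp1 : ¬ p ∣ 1 := by rw [Nat.dvd_one]; exact hp.ne_one
  have hone : ∀ X, IsSim N 1 X → simCoset N 1 X ∈ S := fun X hX => by
    rw [simCoset_eq_one hX]
    exact S.one_mem
  have hlow : ∀ n ≤ v, ∀ X, IsSim N (p ^ n * 1) X → IsDominant N p X →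
      simCoset N (p ^ n * 1) X ∈ S := fun n hn X hX h =>
    h.simCoset_mem hp hN hp1 hX (hv n (by omega)) hone
  have hpos : 0 < p ^ (v + 1) := pow_pos hp.pos _
  -- A dominant matrix with the full multiplier has some elementary divisor f', and its minors force
  -- f ≤ f'. Either f' = f, the leading coset, or `hf` applies.
  have hsame : ∀ X, IsSim N (p ^ (v + 1)) X → IsDominant N p X → MinorsDvd ((p : ℤ) ^ f) X →
      Equivalent N (stdMat p (v + 1) f) X ∨ simCoset N (p ^ (v + 1)) X ∈ S := by
    intro X hX h hmin
    obtain ⟨f', hf', e⟩ := stdMat_dominant_cases hp hN hX h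
    rcases (le_of_minorsDvd_stdMat hp (hmin.equivalent e.symm)).eq_or_lt with rfl | hlt
    · exact Or.inl e
    · refine Or.inr ?_
      rw [← simCoset_eq_of_equivalent hpos (isSim_stdMat p hf') e]
      exact hf f' hlt hf'
  by_cases hMp : ∀ i j, (p : ℤ) ∣ M i j
  · choose K hK using hMp
    obtain rfl : M = (p : ℤ) • Matrix.of K := by
      ext i j
      simp [hK]
    rw [← mul_one (p ^ (v + 1))] at hM ⊢
    obtain ⟨k, hk, hX⟩ := hM.exists_of_mul_smul hp hp1
    have h1 := simCoset_mem_of_forall_isDominant (w := k) hp hU hp1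
      (fun n hn => hlow n (by omega)) k le_rfl _ hX
    rw [← simCoset_smul (Nat.mul_pos (pow_pos hp.pos k) one_pos) hX hp.pos] at h1
    refine Or.inr ?_
    convert h1 using 2
    rw [hk]
    ring
  · push Not at hMp
    obtain ⟨i, j, hij⟩ := hMp
    by_cases hpN : p ∣ N
    · obtain ⟨U, hU, hUS⟩ := hU hpN
      rcases hU.exists_isDominant hp hpN hij with h | ⟨X, hX, h⟩ | ⟨⟨X, hX, h⟩, h'⟩ | ⟨-, h'⟩
      · exact hsame M hM h hminor
      · refine Or.inr (hU.mem_of_mul_mem hp.pos hpN hpos hM hUS ?_)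
        have h2 := hU.isSim.mul hM
        rw [← pow_succ', hX, ← mul_one (p ^ _)] at h2
        obtain ⟨k, hk, hXk⟩ := h2.exists_of_mul_smul hp hp1
        have h3 := hlow k (by omega) X hXk h
        rw [← simCoset_smul (Nat.mul_pos (pow_pos hp.pos k) one_pos) hXk hp.pos, ← hX] at h3
        convert h3 using 2
        rw [← pow_succ', hk]
        ring
      -- Passing to UMU/p keeps the multiplier, so it can return to the leading type. For f ≠ 0 the
      -- condition `hD` rules this case out; for f = 0 the standard matrix commutes with U and the
      -- leading coset is recovered.
      · obtain rfl : f = 0 := by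
          by_contra hf0
          exact h' (hD hf0)
        have hUM : IsSim N (p * p ^ (v + 1)) (U * M) := hU.isSim.mul hM
        have h2 := hUM.mul hU.isSim
        have e : p * p ^ (v + 1) * p = p ^ (v + 3) * 1 := by ring
        rw [e, hX] at h2
        obtain ⟨k, hk, hXk⟩ := h2.exists_of_mul_smul hp hp1
        obtain rfl : k = v + 1 := by omega
        rw [mul_one] at hXk
        rcases hsame X hXk h (by rw [pow_zero]; exact minorsDvd_one X) with h3 | h3
        · exact Or.inl (hU.equivalent_stdMat_zero hp.pos hpN hX h3)
        · refine Or.inr (hU.mem_of_mul_mem hp.pos hpN hpos hM hUS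
            (hU.mem_of_mem_mul hp.pos hpN (Nat.mul_pos hp.pos hpos) hUM hUS ?_))
          rw [← simCoset_smul hpos hXk hp.pos, ← hX] at h3
          convert h3 using 2
          ring
      · exact absurd (hB hpN) h'
    · obtain ⟨X, hX, h⟩ := exists_equivalent_isDominant (N := N) hp hpN hij
      rcases hsame X (hX.isSim hM) h (hminor.equivalent hX) with h1 | h1
      · exact Or.inl (h1.trans hX.symm)
      · rw [simCoset_eq_of_equivalent hpos hM hX]
        exact Or.inr h1

lemma mul_stdMat_one_minor (K : IMat) (hv : 2 * f ≤ v) :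
    MinorsDvd ((p : ℤ) ^ (f + 1)) (stdMat p v f * K * stdMat p 2 1) := by
  have := ((minorsDvd_stdMat (p := p) hv).mul_right K).mul_diagonal
    (dvd_stdMat_mul (p := p) (v := 2) (f := 1) (by norm_num))
  rwa [← pow_add] at this

/-- Upward induction on v and, for fixed v, downward induction on f. For f = 0 a factor T₁(p) is
split off on the right, for f > 0 a factor T₂(p). -/
theorem simCoset_stdMat_mem (hp : p.Prime) (hN : ¬ p ^ 2 ∣ N)
    (h₁ : simCoset N p (stdMat p 1 0) ∈ S) (h₂ : simCoset N (p ^ 2) (stdMat p 2 1) ∈ S)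
    (hU : p ∣ N → ∃ U, IsAtkinMat N p U ∧ simCoset N p U ∈ S) :
    ∀ v f, 2 * f ≤ v → simCoset N (p ^ v) (stdMat p v f) ∈ S := by
  intro v
  induction v using Nat.strong_induction_on with
  | _ v ihv =>
    intro f
    -- Decreasing v - f means increasing f, which 2f ≤ v bounds.
    induction hd : v - f using Nat.strong_induction_on generalizing f with
    | _ d ihf =>
      intro hfv
      subst hd
      have hin : ∀ f', f < f' → 2 * f' ≤ v → simCoset N (p ^ v) (stdMat p v f') ∈ S :=
        fun f' h h' => ihf (v - f') (by omega) f' rfl h'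
      have hbase : ∀ (u u' : Fin 4 → ℤ) (K : IMat), IsSim N 1 K → p ∣ N →
          UpperDvd p (diagonal u * K * diagonal u') := fun u u' K hK hpN =>
        ((upperDvd_diagonal u).mul (hK.upperDvd hpN)).mul (upperDvd_diagonal u')
      rcases Nat.eq_zero_or_pos v with rfl | hv
      · obtain rfl : f = 0 := by omega
        have : stdMat p 0 0 = 1 := by
          rw [stdMat, ← diagonal_one]
          congr 1
          ext i
          fin_cases i <;> simp
        rw [this, pow_zero, simCoset_eq_one isSim_one]
        exact S.one_mem
      · obtain ⟨v, rfl⟩ : ∃ w, v = w + 1 := ⟨v - 1, by omega⟩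
        rcases Nat.eq_zero_or_pos f with rfl | hf
        · have hs := isSim_stdMat (N := N) p (v := v) (f := 0) (by omega)
          have hs1 := isSim_stdMat (N := N) p (v := 1) (f := 0) (by omega)
          rw [pow_one] at hs1
          rw [pow_succ, ← stdMat_mul_one]
          refine simCoset_mul_mem S (pow_pos hp.pos v) hp.pos hs hs1 (ihv v (by omega) 0 (by omega))
            h₁ (fun K hK => ?_) fun X Y hX hY e => ?_
          · rw [stdMat_mul_one, ← pow_succ]
            exact equivalent_stdMat_or_simCoset_mem hp hN hU ihv hin
              ((hs.mul_isometry hK).mul hs1) (by rw [pow_zero]; exact minorsDvd_one _)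
              (hbase _ _ K hK) (fun h => absurd rfl h)
          · rw [stdMat_mul_one] at e
            exact exists_isometry_mul_stdMat_one hp hN (hY.isSim hs1) e
              fun hpN => (upperDvd_diagonal _).equivalent hpN hX
        · obtain ⟨f, rfl⟩ : ∃ g, f = g + 1 := ⟨f - 1, by omega⟩
          obtain ⟨w, rfl⟩ : ∃ w, v = w + 1 := ⟨v - 1, by omega⟩
          have hs := isSim_stdMat (N := N) p (v := w) (f := f) (by omega)
          have hs2 := isSim_stdMat (N := N) p (v := 2) (f := 1) (by omega)
          have e2 := stdMat_mul_two (p := p) (v := w) (f := f) (by omega)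
          rw [show p ^ (w + 1 + 1) = p ^ w * p ^ 2 by ring, ← e2]
          refine simCoset_mul_mem S (pow_pos hp.pos w) (pow_pos hp.pos 2) hs hs2
            (ihv w (by omega) f (by omega)) h₂ (fun K hK => ?_) fun X Y hX hY e => ?_
          · rw [e2, ← pow_add]
            refine equivalent_stdMat_or_simCoset_mem hp hN hU ihv hin ?_
              (mul_stdMat_one_minor K (by omega)) (hbase _ _ K hK) (fun _ => ?_)
            · have := (hs.mul_isometry hK).mul hs2
              rwa [← pow_add] at this
            -- Columns 1 and 3 of the right factor diag(1, p, p², p) supply the factor p.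
            · simp [stdMat, Matrix.mul_diagonal]
          · rw [e2] at e
            refine exists_isometry_mul_stdMat_two hp hN (hY.isSim hs2) e
              (fun hpN => (upperDvd_diagonal _).equivalent hpN hX) ?_
            have := (minorsDvd_stdMat (p := p) (v := 2) (f := 1) (by norm_num)).equivalent hY
            rwa [pow_one] at this

end

section

variable {N : ℕ} [NeZero N] {p m m' : ℕ} {M M' U : IMat}

/-! ### Generation of the Hecke algebra -/

/-- Induction on the multiplier: for a prime p dividing it, the full power of p is split off and the
cofactor is smaller. -/
theorem simCoset_mem_of_generators (S : Subring (HeckeAlgebra N)) (hN : Squarefree N)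
    (h₁ : ∀ p : ℕ, p.Prime → simCoset N p (stdMat p 1 0) ∈ S)
    (h₂ : ∀ p : ℕ, p.Prime → simCoset N (p ^ 2) (stdMat p 2 1) ∈ S)
    (hU : ∀ p : ℕ, p.Prime → p ∣ N → ∃ U, IsAtkinMat N p U ∧ simCoset N p U ∈ S) :
    ∀ m, 0 < m → ∀ M, IsSim N m M → simCoset N m M ∈ S := by
  intro m
  induction m using Nat.strong_induction_on with
  | _ m ih =>
    intro hm M hM
    rcases eq_or_ne m 1 with rfl | hm1
    · rw [simCoset_eq_one hM]
      exact S.one_mem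
    · obtain ⟨p, hp, hpm⟩ := Nat.exists_prime_and_dvd hm1
      have hpN : ¬ p ^ 2 ∣ N := fun h =>
        hp.one_lt.ne' (Nat.isUnit_iff.1 (hN p (by rwa [← sq])))
      obtain ⟨w, n, hn, rfl⟩ := Nat.exists_eq_pow_mul_and_not_dvd hm.ne' p hp.ne_one
      have hn0 : 0 < n := Nat.pos_of_ne_zero fun h => hn (h ▸ dvd_zero p)
      have hlt : n < p ^ w * n := by
        have hw : w ≠ 0 := by
          rintro rfl
          exact hn (by simpa using hpm)
        exact lt_mul_of_one_lt_left hn0 (Nat.one_lt_pow hw hp.one_lt)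
      exact simCoset_mem_of_forall_isDominant hp (hU p hp) hn (fun v _ X hX h =>
        h.simCoset_mem hp hpN hn hX (simCoset_stdMat_mem hp hpN (h₁ p hp) (h₂ p hp) (hU p hp) v)
          (ih n hlt hn0)) w le_rfl M hM

lemma simCoset_stdMat_one {q : ℕ} (hq : q.Prime) : simCoset N q (stdMat q 1 0) = heckeT₁ N q hq := by
  refine simCoset_eq ⟨hq.pos, ?_⟩
  change (1 / √(q : ℝ)) • _ = _
  congr 1
  simp only [toReal, stdMat]
  congr 1 <;> ext i j <;> fin_cases i <;> fin_cases j <;> simp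

lemma simCoset_stdMat_two {q : ℕ} (hq : q.Prime) :
    simCoset N (q ^ 2) (stdMat q 2 1) = heckeT₂ N q hq := by
  refine simCoset_eq ⟨pow_pos hq.pos 2, ?_⟩
  change (1 / √((q ^ 2 : ℕ) : ℝ)) • _ = _
  congr 1
  simp only [toReal, stdMat]
  congr 1 <;> ext i j <;> fin_cases i <;> fin_cases j <;> simp

theorem adjoin_generators_eq_top (hN : Squarefree N) {W : ℕ → rationalGroup}
    (hW : ∀ p : ℕ, p.Prime → p ∣ N → IsAtkinLehner N p (W p)) (s : Set (HeckeAlgebra N))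
    (hWs : ∀ p : ℕ, p.Prime → p ∣ N → doubleCoset N (W p) ∈ s)
    (h₁ : ∀ (q : ℕ) (hq : q.Prime), heckeT₁ N q hq ∈ s)
    (h₂ : ∀ (q : ℕ) (hq : q.Prime), heckeT₂ N q hq ∈ s) : Algebra.adjoin ℤ s = ⊤ := by
  rw [Algebra.eq_top_iff]
  intro f
  refine mem_of_forall_single_mem (Algebra.adjoin ℤ s).toSubring.toAddSubgroup f fun z _ => ?_
  obtain ⟨M, m, h⟩ := mem_rationalGroup_iff (N := N) |>.1 z.2
  change doubleCoset N ⟨z.1, z.2⟩ ∈ (Algebra.adjoin ℤ s).toSubring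
  rw [← simCoset_eq (g := ⟨z.1, z.2⟩) h]
  refine simCoset_mem_of_generators _ hN (fun p hp => ?_) (fun p hp => ?_) (fun p hp hpN => ?_)
    m h.1 M h.isSim
  · rw [simCoset_stdMat_one hp]
    exact Algebra.subset_adjoin (h₁ p hp)
  · rw [simCoset_stdMat_two hp]
    exact Algebra.subset_adjoin (h₂ p hp)
  · obtain ⟨U, hU, hr⟩ := IsAtkinMat.rep hp.pos (hW p hp hpN)
    refine ⟨U, hU, ?_⟩
    rw [simCoset_eq hr]
    exact Algebra.subset_adjoin (hWs p hp hpN)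

/-! ### Non-commutativity and zero divisors -/

lemma equivalent_of_simCoset_eq (hm : 0 < m) (hM : IsSim N m M) (hM' : IsSim N m M')
    (h : simCoset N m M = simCoset N m M') : Equivalent N M M' := by
  classical
  obtain ⟨g, hg⟩ := exists_rational_rep hm hM
  obtain ⟨g', hg'⟩ := exists_rational_rep hm hM'
  rw [simCoset_eq hg, simCoset_eq hg'] at h
  have h2 := congrArg (fun f => coeffAt f (g' : Sp2)) h
  simp only [doubleCoset, coeffAt_single] at h2
  rw [if_pos (show InDoubleCoset (paramodularGroup N) (g' : Sp2) g' from
    ⟨1, one_mem _, 1, one_mem _, by simp⟩)] at h2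
  exact (hg.inDoubleCoset_iff hg').1 (by_contra fun hn => by simp [hn] at h2)

/-- Both products are single double cosets. With T = diag(1, p, p², p), every entry of TU is
divisible by p, a property of the whole double coset, whereas UT contains γ, a unit at p. -/
lemma IsAtkinMat.not_commute (hU : IsAtkinMat N p U) (hp : p.Prime) (hpN : p ∣ N) :
    simCoset N p U * simCoset N (p ^ 2) (stdMat p 2 1) ≠
      simCoset N (p ^ 2) (stdMat p 2 1) * simCoset N p U := by
  have hs := isSim_stdMat (N := N) p (v := 2) (f := 1) (by norm_num)
  rw [hU.simCoset_mul hp.pos hpN (pow_pos hp.pos 2) hs,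
    hU.mul_simCoset hp.pos hpN (pow_pos hp.pos 2) hs, mul_comm (p ^ 2) p]
  intro h
  obtain ⟨K, K', -, -, e⟩ := equivalent_of_simCoset_eq (Nat.mul_pos hp.pos (pow_pos hp.pos 2))
    (mul_comm (p ^ 2) p ▸ hs.mul hU.isSim) (hU.isSim.mul hs) h.symm
  have hpp := Nat.prime_iff_prime_int.1 hp
  obtain ⟨n, hn⟩ := hpN
  have hNp : (N : ℤ) = p * n := by exact_mod_cast hn
  obtain ⟨α, β, γ, δ, hdet, rfl⟩ := hU
  have hdvd : ∀ i j, (p : ℤ) ∣ (stdMat p 2 1 * atkinMat N p α β γ δ) i j := by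
    intro i j
    rw [stdMat, Matrix.diagonal_mul]
    fin_cases i <;> fin_cases j <;> simp [atkinMat, hNp, sq, Dvd.dvd.mul_left]
  have hγ : (p : ℤ) ∣ (atkinMat N p α β γ δ * stdMat p 2 1) 1 0 := by
    rw [e, Matrix.mul_apply]
    refine Finset.dvd_sum fun b _ => Dvd.dvd.mul_right ?_ _
    rw [Matrix.mul_apply]
    exact Finset.dvd_sum fun a _ => (hdvd a b).mul_left _
  rw [stdMat, Matrix.mul_diagonal] at hγ
  simp only [atkinMat, of_apply, cons_val', cons_val_zero, cons_val_one, mul_one] at hγ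
  have h1 : p * (α * δ) - β * n * γ = 1 := by
    refine mul_left_cancel₀ hpp.ne_zero ?_
    rw [hNp] at hdet
    linear_combination hdet
  exact hpp.not_dvd_one (h1 ▸ dvd_sub (dvd_mul_right _ _) (hγ.mul_left _))

end

end Paramodular


end

theorem corollary2 (N : ℕ) [NeZero N] (hN : Squarefree N) :
    (∀ W : ℕ → Paramodular.rationalGroup,
      (∀ p : ℕ, p.Prime → p ∣ N → Paramodular.IsAtkinLehner N p (W p)) →
      Algebra.adjoin ℤ
        ({Paramodular.doubleCoset N 1} ∪
          {T | ∃ p : ℕ, p.Prime ∧ p ∣ N ∧ T = Paramodular.doubleCoset N (W p)} ∪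
          {T | ∃ (q : ℕ) (hq : q.Prime), T = Paramodular.heckeT₁ N q hq} ∪
          {T | ∃ (q : ℕ) (hq : q.Prime), T = Paramodular.heckeT₂ N q hq} :
          Set (Paramodular.HeckeAlgebra N)) = ⊤) ∧
    (1 < N →
      (∃ S T : Paramodular.HeckeAlgebra N, S * T ≠ T * S) ∧
      (∃ S T : Paramodular.HeckeAlgebra N, S ≠ 0 ∧ T ≠ 0 ∧ S * T = 0)) := by
  refine ⟨fun W hW => ?_, fun hN1 => ?_⟩
  · refine Paramodular.adjoin_generators_eq_top hN hW _ (fun p hp hpN => ?_) (fun q hq => ?_)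
      fun q hq => ?_
    · exact Or.inl (Or.inl (Or.inr ⟨p, hp, hpN, rfl⟩))
    · exact Or.inl (Or.inr ⟨q, hq, rfl⟩)
    · exact Or.inr ⟨q, hq, rfl⟩
  · obtain ⟨p, hp, hpN⟩ := Nat.exists_prime_and_dvd hN1.ne'
    obtain ⟨W, hW⟩ := Paramodular.exists_isAtkinLehner hN hp hpN
    obtain ⟨U, hU, -⟩ := Paramodular.IsAtkinMat.rep hp.pos hW
    have hne := hU.not_commute hp hpN
    -- For w the class of W_p, w² = 1 gives (1 - w)(1 + w) = 0. If a factor vanished, w = ±1 would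
    -- commute with T₂(p), against `hne`.
    refine ⟨⟨_, _, hne⟩, 1 - Paramodular.simCoset N p U, 1 + Paramodular.simCoset N p U,
      fun h => hne ?_, fun h => hne ?_, ?_⟩
    · rw [← sub_eq_zero.1 h, one_mul, mul_one]
    · rw [← neg_eq_of_add_eq_zero_right h, neg_mul, mul_neg, one_mul, mul_one]
    · rw [sub_mul, mul_add, mul_add, hU.simCoset_sq hp.pos hpN, one_mul, mul_one, one_mul,
        add_comm, sub_self]
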